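/- \textbf{Notation.} Let $W=\mathfrak S_n$ with simple reflections $s_i=(i,i+1)$, $1\le i\le n-1$, length function $\ell$ and longest element $w_0$, and let $F(w)=w_0ww_0$. Write $[w]_F=\{x^{-1}wF(x)\mid x\in W\}$ for the $F$-conjugacy class of $w$. A class is \emph{cuspidal} if it meets no subgroup $W_J=\langle J\rangle$ for a proper $F$-stable subset $J$ of $\{s_1,\dots,s_{n-1}\}$. For a class $\mathcal O$ let $\mathcal O_{\min}$ be the set of its elements of minimal length; write $\mathcal O'\le\mathcal O$ if for every $x\in\mathcal O_{\min}$ there is $x'\in\mathcal O'_{\min}$ with $x'\le x$ in the Bruhat order. For a partition $\nu=(\nu_1\ge\nu_2\ge\dots\ge\nu_m)$ of $n$ with only odd parts, cut the sequence $1,n,2,n-1,3,n-2,\dots$ (of all elements of $\{1,\dots,n\}$) into consecutive blocks of sizes $\nu_1,\dots,\nu_m$, and let $\sigma_\nu\in W$ be the product of the cycles given by these blocks. Write $\lambda^\star$ for the dual partition of $\lambda$, $\trianglelefteq$ for the dominance order on partitions, and $\chi_\mu$ for the irreducible character of a symmetric group indexed by the partition $\mu$. A partition is \emph{triangular} if it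 is of the form $(d,d-1,\dots,2,1)$ with $d\ge1$. Let $\lambda$ be a partition of $n$ such that $\lambda^\star$ is a sum of triangular partitions; equivalently, $\lambda$ is the concatenation of triangular partitions $\lambda^1,\dots,\lambda^m$, which are unique up to order. Let $n_j=|\lambda^j|$. Let $\bar{\boldsymbol\lambda}$ be the partition of $n$ obtained by concatenating, for $j=1,\dots,m$, the partition $(n_j)$ if $n_j$ is odd and $(n_j-1,1)$ if $n_j$ is even. Put $$\mathcal C_\lambda=\bigl\{[ww_0]_F \;\big|\; w=(w_1,\dots,w_m)\in\mathfrak S_{n_1}\times\cdots\times\mathfrak S_{n_m},\ \chi_{\lambda^1}(w_1)\cdots\chi_{\lambda^m}(w_m)\ne0\bigr\}.$$ We say that a partition $\lambda$ of $n$ is \emph{admissible} if $\lambda^\star$ is a sum of triangular partitions and (i) every element of $\mathcal C_\lambda$ is of the form $[\sigma_{\bar{\boldsymbol\mu}}w_0]_F$ for some $\mu\trianglelefteq\lambda$ such that $\mu^\star$ is a sum of triangular partitions; and, for every $\mu\trianglelefteq\lambda$ such that $\mu^\star$ is a sum of triangular partitions, (ii) every element of $\mathcal C_\mu$ is of the form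 $[\sigma_{\bar{\boldsymbol\nu}}w_0]_F$ for some $\nu\trianglelefteq\mu$ such that $\nu^\star$ is a sum of triangular partitions, and (iii) $\mathcal C_\mu=\{\mathcal O \text{ a cuspidal } F\text{-conjugacy class}\mid[\sigma_{\bar{\boldsymbol\mu}}w_0]_F\le\mathcal O\}$. \textbf{Proposition.} The following partitions are admissible: (1) the partitions $2^b1^{n-2b}$ of $n$ with $n\ge3b$; (2) the partitions $32^i1^j$ with $1\le i\le3$ and $i\le j\le10$, or with $i=4$ and $4\le j\le7$; (3) the partitions $3^22^21^k$ with $2\le k\le8$. -/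

import Mathlib

open scoped BigOperators

namespace UnitaryClasses

/-! ### Partitions -/

/-- The `k`-th part (counted from `0`) of a partition, the parts being listed in decreasing order
and followed by zeros. -/
def part {n : ℕ} (μ : n.Partition) (k : ℕ) : ℕ :=
  (μ.parts.sort (fun a b => b ≤ a)).getD k 0

/-- The `k`-th part (counted from `0`) of the dual (conjugate) partition of `μ`:
the number of parts of `μ` that are at least `k + 1`. -/
def dualPart {n : ℕ} (μ : n.Partition) (k : ℕ) : ℕ :=
  (μ.parts.filter (fun a => k < a)).card

/-- The dominance order `μ ⊴ ν` on the partitions of `n`. -/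
def Dominated {n : ℕ} (μ ν : n.Partition) : Prop :=
  ∀ r : ℕ, ∑ k ∈ Finset.range r, part μ k ≤ ∑ k ∈ Finset.range r, part ν k

/-- The size `1 + 2 + ⋯ + d` of the triangular partition `(d, d - 1, …, 2, 1)`. -/
def triSize (d : ℕ) : ℕ := ∑ k ∈ Finset.range d, (k + 1)

/-- The triangular partition `(d, d - 1, …, 2, 1)`. -/
def triangular (d : ℕ) : (triSize d).Partition where
  parts := (Multiset.range d).map (fun k => k + 1)
  parts_pos := by
    intro i hi
    obtain ⟨k, -, rfl⟩ := Multiset.mem_map.mp hi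
    exact Nat.succ_pos k
  parts_sum := rfl

/-- `d` encodes the multipartition `(μ¹, …, μᵐ)` whose members are the triangular partitions
`μⁱ = (dᵢ, …, 2, 1)`, `dᵢ ≥ 1`. The condition says that the dual of `μ` is the sum of these
triangular partitions. As triangular partitions are self-dual, this also says that `μ` is the
concatenation of the `μⁱ`. -/
def IsTriangularMultipartition {n m : ℕ} (d : Fin m → ℕ) (μ : n.Partition) : Prop :=
  (∀ i, 0 < d i) ∧ ∀ k, dualPart μ k = ∑ i, part (triangular (d i)) k

/-- The dual partition of `μ` is a sum of triangular partitions. -/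
def DualIsSumOfTriangular {n : ℕ} (μ : n.Partition) : Prop :=
  ∃ (m : ℕ) (d : Fin m → ℕ), IsTriangularMultipartition d μ

/-- The partition `(N)` if `N` is odd and `(N - 1, 1)` otherwise. -/
def barBlock (N : ℕ) : Multiset ℕ := if Odd N then {N} else {N - 1, 1}

/-- The parts, in decreasing order, of the concatenation over `i` of the partitions `(nᵢ)` or
`(nᵢ - 1, 1)`, where `nᵢ` is the size of the `i`-th member of the multipartition. -/
def barParts {m : ℕ} (d : Fin m → ℕ) : List ℕ :=
  (∑ i, barBlock (triSize (d i))).sort (fun a b => b ≤ a)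

/-! ### Irreducible characters of symmetric groups -/

/-- The cell (row, column) of the entry `k` in the tableau of shape `l` that is filled with
`0, 1, 2, …` row by row. -/
def tableauCell : List ℕ → ℕ → ℕ × ℕ
  | [], k => (0, k)
  | a :: l, k =>
      if k < a then (0, k) else ((tableauCell l (k - a)).1 + 1, (tableauCell l (k - a)).2)

/-- The cell of the entry `x` in the tableau of shape `μ` filled row by row. -/
def cell {n : ℕ} (μ : n.Partition) (x : Fin n) : ℕ × ℕ :=
  tableauCell (μ.parts.sort (fun a b => b ≤ a)) x

/-- The row stabilizer. -/
def rowStabilizer {n : ℕ} (μ : n.Partition) : Finset (Equiv.Perm (Fin n)) :=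
  Finset.univ.filter (fun g => ∀ x, (cell μ (g x)).1 = (cell μ x).1)

/-- The column stabilizer. -/
def columnStabilizer {n : ℕ} (μ : n.Partition) : Finset (Equiv.Perm (Fin n)) :=
  Finset.univ.filter (fun g => ∀ x, (cell μ (g x)).2 = (cell μ x).2)

/-- The Young symmetrizer of `μ`, in the complex group algebra of the symmetric group. -/
noncomputable def youngSymmetrizer {n : ℕ} (μ : n.Partition) :
    MonoidAlgebra ℂ (Equiv.Perm (Fin n)) :=
  (∑ g ∈ rowStabilizer μ, MonoidAlgebra.of ℂ _ g) *
    ∑ g ∈ columnStabilizer μ, ((Equiv.Perm.sign g : ℤ) : ℂ) • MonoidAlgebra.of ℂ _ g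

/-- The irreducible module indexed by `μ` (the Specht module), realized as the left ideal
generated by the Young symmetrizer. -/
noncomputable abbrev spechtModule {n : ℕ} (μ : n.Partition) :
    Ideal (MonoidAlgebra ℂ (Equiv.Perm (Fin n))) :=
  Ideal.span {youngSymmetrizer μ}

/-- The irreducible character `χ_μ` of the symmetric group: the trace of the action of `g` by
left multiplication on the module indexed by `μ`. -/
noncomputable def symChar {n : ℕ} (μ : n.Partition) (g : Equiv.Perm (Fin n)) : ℂ :=
  LinearMap.trace ℂ (spechtModule μ)
    (Algebra.lsmul ℂ ℂ (spechtModule μ) (MonoidAlgebra.of ℂ (Equiv.Perm (Fin n)) g))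

/-! ### Twisted conjugacy classes of the symmetric group -/

/-- The longest element `w₀` of the symmetric group. -/
def w₀ (n : ℕ) : Equiv.Perm (Fin n) := Fin.revPerm

/-- The automorphism `F(w) = w₀ w w₀`. -/
def frob {n : ℕ} (w : Equiv.Perm (Fin n)) : Equiv.Perm (Fin n) := w₀ n * w * w₀ n

/-- The `F`-conjugacy class `[w]_F = {x⁻¹ w F(x)}`. -/
def fClass {n : ℕ} (w : Equiv.Perm (Fin n)) : Set (Equiv.Perm (Fin n)) :=
  {y | ∃ x, y = x⁻¹ * w * frob x}

/-- The Coxeter length of a permutation (its number of inversions). -/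
def len {n : ℕ} (w : Equiv.Perm (Fin n)) : ℕ :=
  (Finset.univ.filter (fun p : Fin n × Fin n => p.1 < p.2 ∧ w p.2 < w p.1)).card

/-- The Bruhat order: `u ≤ v` if `v` is reached from `u` by successive right multiplications by
reflections, each of which increases the length. -/
def BruhatLE {n : ℕ} (u v : Equiv.Perm (Fin n)) : Prop :=
  Relation.ReflTransGen
    (fun x y => (∃ i j, i ≠ j ∧ y = x * Equiv.swap i j) ∧ len x < len y) u v

/-- The elements of minimal length of a set of permutations. -/
def minElements {n : ℕ} (O : Set (Equiv.Perm (Fin n))) : Set (Equiv.Perm (Fin n)) :=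
  {x | x ∈ O ∧ ∀ y ∈ O, len x ≤ len y}

/-- The order on `F`-conjugacy classes: `O' ≤ O` if every element of minimal length of `O` is
above some element of minimal length of `O'` in the Bruhat order. -/
def ClassLE {n : ℕ} (O' O : Set (Equiv.Perm (Fin n))) : Prop :=
  ∀ x ∈ minElements O, ∃ x' ∈ minElements O', BruhatLE x' x

/-- The simple reflections `(i, i + 1)`. -/
def simpleReflections (n : ℕ) : Set (Equiv.Perm (Fin n)) :=
  {s | ∃ i j : Fin n, (j : ℕ) = i + 1 ∧ s = Equiv.swap i j}

/-- A class is cuspidal if it meets no proper `F`-stable parabolic subgroup, that is, no subgroup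
generated by a proper `F`-stable set of simple reflections. -/
def IsCuspidal {n : ℕ} (O : Set (Equiv.Perm (Fin n))) : Prop :=
  ∀ J : Set (Equiv.Perm (Fin n)), J ⊂ simpleReflections n → frob '' J = J →
    Disjoint O (Subgroup.closure J : Set (Equiv.Perm (Fin n)))

/-- The first `r` terms of the sequence `a, b, a + 1, b - 1, a + 2, …`, where
`a = ⌊s / 2⌋` and `b = n - 1 - ⌈s / 2⌉` are the end points of an interval of `n - s` letters
of `{0, …, n - 1}`. -/
def zigzag (n s r : ℕ) : List (Fin n) :=
  (List.range r).filterMap (fun k =>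
    let p : ℕ := if Even k then s / 2 + k / 2 else n - 1 - (s + 1) / 2 - k / 2
    if h : p < n then some ⟨p, h⟩ else none)

/-- The product `σ_{λ₁} F(σ_{λ₂}) F²(σ_{λ₃}) ⋯`, where `σ_{λ_j}` is the cycle
`(a, b, a + 1, b - 1, …)` of length `λ_j` on the interval attached to
`s = λ₁ + ⋯ + λ_{j-1}`. The arguments `s` and `c` are the sum and the number of the parts that
have been dealt with. -/
def sigmaAux (n : ℕ) : ℕ → ℕ → List ℕ → Equiv.Perm (Fin n)
  | _, _, [] => 1
  | s, c, r :: l => frob^[c] (zigzag n s r).formPerm * sigmaAux n (s + r) (c + 1) l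

/-- Kim's permutation `σ_l` of cycle type `l`, where `l` is a list of odd positive integers of
sum `n`, in decreasing order. -/
def sigma (n : ℕ) (l : List ℕ) : Equiv.Perm (Fin n) := sigmaAux n 0 0 l

/-! ### The sets of classes attached to sums of triangular partitions -/

/-- The element `(w₁, …, wₘ)` of the Young subgroup `S_{n₁} × ⋯ × S_{nₘ}` of `S_n`,
where `n = n₁ + ⋯ + nₘ` and the factors act on consecutive intervals. -/
def youngElement {m n : ℕ} (N : Fin m → ℕ) (h : ∑ i, N i = n)
    (w : ∀ i, Equiv.Perm (Fin (N i))) : Equiv.Perm (Fin n) :=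
  (finSigmaFinEquiv.trans (finCongr h)).permCongr (Equiv.Perm.sigmaCongrRight w)

/-- The set `C_μ` of the `F`-classes `[w w₀]_F`, where `w = (w₁, …, wₘ)` runs through the elements
of the Young subgroup with `χ_{μ¹}(w₁) ⋯ χ_{μᵐ}(wₘ) ≠ 0`, for the multipartition `(μ¹, …, μᵐ)`
of triangular partitions (unique up to permutation) with concatenation `μ`. -/
def classSet {n : ℕ} (μ : n.Partition) : Set (Set (Equiv.Perm (Fin n))) :=
  {O | ∃ (m : ℕ) (d : Fin m → ℕ), IsTriangularMultipartition d μ ∧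
    ∃ (h : ∑ i, triSize (d i) = n) (w : ∀ i, Equiv.Perm (Fin (triSize (d i)))),
      ∏ i, symChar (triangular (d i)) (w i) ≠ 0 ∧
      O = fClass (youngElement (fun i => triSize (d i)) h w * w₀ n)}

/-- `O` is the class `[σ_μ̄ w₀]_F`, for the multipartition of triangular partitions with
concatenation `μ`. -/
def IsBarClass {n : ℕ} (μ : n.Partition) (O : Set (Equiv.Perm (Fin n))) : Prop :=
  ∃ (m : ℕ) (d : Fin m → ℕ), IsTriangularMultipartition d μ ∧
    O = fClass (sigma n (barParts d) * w₀ n)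

/-- Every element of `C_μ` is of the form `[σ_ν̄ w₀]_F` for some `ν ⊴ μ` whose dual is a sum of
triangular partitions. -/
def ClassesFromBelow {n : ℕ} (μ : n.Partition) : Prop :=
  ∀ O ∈ classSet μ, ∃ ν : n.Partition,
    Dominated ν μ ∧ DualIsSumOfTriangular ν ∧ IsBarClass ν O

/-- `C_μ` is the set of the cuspidal `F`-classes `O` with `[σ_μ̄ w₀]_F ≤ O`. -/
def ClassesAreUpperSet {n : ℕ} (μ : n.Partition) : Prop :=
  ∀ B, IsBarClass μ B →
    classSet μ = {O | (∃ w, O = fClass w) ∧ IsCuspidal O ∧ ClassLE B O}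

/-- The assumptions on `μ`: its dual is a sum of triangular partitions, every element of `C_μ` is
the class of some `σ_ν̄ w₀` with `ν ⊴ μ`, and for every `ν ⊴ μ` whose dual is a sum of triangular
partitions the same holds for `C_ν`, which moreover consists of all the cuspidal classes above the
class of `σ_ν̄ w₀`. -/
def SatisfiesAssumptions {n : ℕ} (μ : n.Partition) : Prop :=
  DualIsSumOfTriangular μ ∧ ClassesFromBelow μ ∧
    ∀ ν : n.Partition, Dominated ν μ → DualIsSumOfTriangular ν →
      ClassesFromBelow ν ∧ ClassesAreUpperSet ν

end UnitaryClasses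

namespace UnitaryClasses
open Equiv

/-! ### Non-inversions and the Bruhat order -/

/-! The argument is uniform for all partitions `μ` with parts at most `3` whose dual is a sum of
triangular partitions, that is, concatenations of copies of `(3,2,1)`, `(2,1)` and `(1)`. It
identifies all the sets of classes involved with sets of cycle types.

Right multiplication by `w₀` turns `F`-classes into conjugacy classes and the length into the number
of non-inversions, and it reverses the Bruhat order (`mem_fClass_iff`, `len_mul_w₀`, `classLE_iff`).
The class of `y * w₀` is cuspidal exactly when all the cycles of `y` are odd (`isCuspidal_iff`). The
characters of `(1)`, `(2,1)`, `(3,2,1)` are nonzero exactly at the elements all of whose cycles have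
length `1`, `3` or `5`. Put `E = dualPart μ 2` and `F = dualPart μ 1 - 2 * E`. Then `C_μ` consists
of the types `5^e 3^f` with `e ≤ E` and `f + 2e ≤ F + 2E` (`mem_classSet_iff`), and the bar class of
`μ` has type `5^E 3^F`. It remains to see that these two inequalities describe the cuspidal classes
above the bar class.

Sufficiency (`classLE_of_fiveThree`): from any element of type `5^e 3^f` one goes up by creating
`3`-cycles from fixed letters and merging pairs of `3`-cycles into `5`-cycles, and then up inside
the class of type `5^E 3^F` until no further gain is possible. Such a stuck element has the fewest
non-inversions of its whole class (`Stuck.isTop`). The reason is a lower bound that depends only on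
the class: by a discrete Sturm–Hurwitz inequality, two letters in cycles of odd sizes `a`, `b` keep
their relative order at least once in `max a b` steps on average (`topBound_le`). In a stuck element
every pair of letters attains this bound, as otherwise an explicit move would lead further up.

Necessity (`fiveThree_of_classLE`): Kim's element of the type of `y` attains the same bound
(`isTop_sigma`), so some element of type `5^E 3^F` lies above it. The number of letters that `w`
moves from one end of the interval to the other does not decrease on going up, and nearly all outer
letters of Kim's element are of this kind. As an odd cycle cannot alternate between the two ends for
ever, the sum of the `k` largest parts is bounded by the size that `k` cycles of type `5^E 3^F` can
reach (`sum_le_of_up`). -/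

/-- The pairs of positions at which `w` is increasing. -/
def nonInvSet {n : ℕ} (w : Perm (Fin n)) : Finset (Fin n × Fin n) :=
  Finset.univ.filter (fun p => p.1 < p.2 ∧ w p.1 < w p.2)

/-- The number of non-inversions. -/
def nonInv {n : ℕ} (w : Perm (Fin n)) : ℕ := (nonInvSet w).card

/-- One step up: two increasing values are exchanged. -/
def UpStep {n : ℕ} (w w' : Perm (Fin n)) : Prop :=
  ∃ i j, i < j ∧ w i < w j ∧ w' = w * swap i j

/-- The relation generated by the steps up. -/
def Up {n : ℕ} (w w' : Perm (Fin n)) : Prop := Relation.ReflTransGen UpStep w w'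

/-- Applying the transposition to both members of a pair, unless this reverses the pair, injects the
non-inversions of `w * swap i j` into those of `w`; the pair `(i, j)` is missed. -/
theorem nonInv_mul_swap_lt {n : ℕ} {w : Perm (Fin n)} {i j : Fin n} (hij : i < j)
    (hw : w i < w j) : nonInv (w * swap i j) < nonInv w := by
  classical
  let τ := swap i j
  let ψ : Fin n × Fin n → Fin n × Fin n := fun p => if τ p.1 < τ p.2 then (τ p.1, τ p.2) else p
  have hττ : ∀ a, τ (τ a) = a := fun a => by simp [τ]
  have hmem : ∀ p, p ∈ nonInvSet (w * τ) ↔ p.1 < p.2 ∧ w (τ p.1) < w (τ p.2) := by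
    intro p; rw [nonInvSet, Finset.mem_filter]; simp
  have hmem' : ∀ p, p ∈ nonInvSet w ↔ p.1 < p.2 ∧ w p.1 < w p.2 := by
    intro p; rw [nonInvSet, Finset.mem_filter]; simp
  have hi : τ i = j := by simp [τ]
  have hj : τ j = i := by simp [τ]
  have ho : ∀ a, a ≠ i → a ≠ j → τ a = a := fun a h1 h2 => swap_apply_of_ne_of_ne h1 h2
  have hmaps : ∀ p ∈ nonInvSet (w * τ), ψ p ∈ (nonInvSet w).erase (i, j) := by
    rintro ⟨a, b⟩ hp
    rw [hmem] at hp
    obtain ⟨hab, hwab⟩ := hp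
    simp only at hab hwab
    rw [Finset.mem_erase, hmem']
    by_cases h : τ a < τ b
    · simp only [ψ, h, if_true]
      refine ⟨?_, trivial, hwab⟩
      intro he
      rw [Prod.mk.injEq] at he
      have h1 : a = j := by rw [← hττ a, he.1, hi]
      have h2 : b = i := by rw [← hττ b, he.2, hj]
      subst h1; subst h2
      exact absurd (hab.trans hij) (lt_irrefl _)
    · simp only [ψ, h, if_false]
      by_cases ha : a = i
      · subst ha
        by_cases hb : b = j
        · subst hb
          rw [hi, hj] at hwab
          exact absurd (hwab.trans hw) (lt_irrefl _)
        · have hb' := ho b hab.ne' hb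
          rw [hi, hb'] at hwab
          refine ⟨fun he => hb (Prod.mk.inj he).2, hab, hw.trans hwab⟩
      · by_cases hb : b = j
        · subst hb
          have ha' := ho a ha hab.ne
          rw [hj, ha'] at hwab
          exact ⟨fun he => ha (Prod.mk.inj he).1, hab, hwab.trans hw⟩
        · exfalso
          by_cases ha2 : a = j
          · subst ha2
            rw [hj, ho b (fun hb2 => by subst hb2; exact lt_asymm hab hij) hb] at h
            exact h (hij.trans hab)
          · rw [ho a ha ha2] at h
            by_cases hb2 : b = i
            · subst hb2; rw [hi] at h; exact h (hab.trans hij)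
            · rw [ho b hb2 hb] at h; exact h hab
  have hinj : Set.InjOn ψ (nonInvSet (w * τ) : Finset _) := by
    rintro ⟨a, b⟩ hp ⟨c, d⟩ hq he
    rw [Finset.mem_coe, hmem] at hp hq
    simp only at hp hq
    by_cases h : τ a < τ b <;> by_cases h' : τ c < τ d <;>
      simp only [ψ, h, h', if_true, if_false, Prod.mk.injEq] at he
    · exact Prod.ext (τ.injective he.1) (τ.injective he.2)
    · rw [← he.1, ← he.2, hττ, hττ] at h'; exact absurd hp.1 h'
    · rw [he.1, he.2, hττ, hττ] at h; exact absurd hq.1 h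
    · exact Prod.ext he.1 he.2
  have hc := Finset.card_le_card_of_injOn ψ hmaps hinj
  have hin : (i, j) ∈ nonInvSet w := (hmem' _).2 ⟨hij, hw⟩
  rw [Finset.card_erase_of_mem hin] at hc
  have := Finset.card_pos.2 ⟨_, hin⟩
  unfold nonInv
  change (nonInvSet (w * τ)).card < _
  omega

theorem UpStep.nonInv_lt {n : ℕ} {w w' : Perm (Fin n)} (h : UpStep w w') :
    nonInv w' < nonInv w := by
  obtain ⟨i, j, hij, hw, rfl⟩ := h
  exact nonInv_mul_swap_lt hij hw

theorem UpStep.up {n : ℕ} {w w' : Perm (Fin n)} (h : UpStep w w') : Up w w' :=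
  Relation.ReflTransGen.single h

theorem Up.trans {n : ℕ} {u v w : Perm (Fin n)} (h : Up u v) (h' : Up v w) : Up u w :=
  Relation.ReflTransGen.trans h h'

/-- This form of a step up does not ask which position is the smaller one; all later conditions on
orders are such equivalences. -/
theorem upStep_swap {n : ℕ} {w : Perm (Fin n)} {i j : Fin n} (hij : i ≠ j)
    (h : i < j ↔ w i < w j) : UpStep w (w * swap i j) := by
  rcases lt_or_gt_of_ne hij with h1 | h1
  · exact ⟨i, j, h1, h.1 h1, rfl⟩
  · refine ⟨j, i, h1, ?_, by rw [swap_comm]⟩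
    have : ¬ w i < w j := fun h2 => lt_asymm h1 (h.2 h2)
    exact lt_of_le_of_ne (not_lt.1 this) (fun he => hij (w.injective he).symm)

/-! ### Multiplication by the longest element -/

theorem w₀_apply {n : ℕ} (i : Fin n) : w₀ n i = Fin.rev i := rfl

theorem w₀_mul_self (n : ℕ) : w₀ n * w₀ n = 1 := by
  ext i; simp [w₀_apply]

theorem w₀_inv (n : ℕ) : (w₀ n)⁻¹ = w₀ n := by
  rw [inv_eq_iff_mul_eq_one, w₀_mul_self]

theorem mul_w₀_mul_w₀ {n : ℕ} (w : Perm (Fin n)) : w * w₀ n * w₀ n = w := by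
  rw [mul_assoc, w₀_mul_self, mul_one]

theorem len_mul_w₀ {n : ℕ} (w : Perm (Fin n)) : len (w * w₀ n) = nonInv w := by
  unfold len nonInv nonInvSet
  refine Finset.card_bij' (fun p _ => (Fin.rev p.2, Fin.rev p.1))
    (fun p _ => (Fin.rev p.2, Fin.rev p.1)) ?_ ?_ ?_ ?_
  · rintro ⟨a, b⟩ h
    rw [Finset.mem_filter] at h ⊢
    simpa [w₀_apply, Fin.rev_lt_rev] using h
  · rintro ⟨a, b⟩ h
    rw [Finset.mem_filter] at h ⊢
    simpa [w₀_apply, Fin.rev_lt_rev] using h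
  · simp
  · simp

theorem mul_swap_mul_w₀ {n : ℕ} (w : Perm (Fin n)) (i j : Fin n) :
    w * swap i j * w₀ n = w * w₀ n * swap (Fin.rev i) (Fin.rev j) := by
  rw [mul_assoc, mul_assoc, ← w₀_apply, ← w₀_apply, swap_apply_apply, w₀_inv]
  simp only [← mul_assoc, w₀_mul_self, one_mul]

theorem Up.bruhatLE {n : ℕ} {w w' : Perm (Fin n)} (h : Up w w') :
    BruhatLE (w' * w₀ n) (w * w₀ n) := by
  induction h with
  | refl => exact Relation.ReflTransGen.refl
  | @tail b c _ h ih =>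
    refine Relation.ReflTransGen.trans (Relation.ReflTransGen.single ?_) ih
    have hl := h.nonInv_lt
    obtain ⟨i, j, hij, hw, rfl⟩ := h
    refine ⟨⟨Fin.rev i, Fin.rev j, fun he => hij.ne (Fin.rev_injective he), ?_⟩, ?_⟩
    · rw [mul_swap_mul_w₀, mul_assoc _ (swap _ _), swap_mul_self, mul_one]
    · rwa [len_mul_w₀, len_mul_w₀]

theorem BruhatLE.up {n : ℕ} {x' x : Perm (Fin n)} (h : BruhatLE x' x) :
    Up (x * w₀ n) (x' * w₀ n) := by
  induction h with
  | refl => exact Relation.ReflTransGen.refl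
  | @tail b c _ h ih =>
    refine Up.trans (UpStep.up ?_) ih
    obtain ⟨⟨i, j, hij, rfl⟩, hl⟩ := h
    have key : b * w₀ n = b * swap i j * w₀ n * swap (Fin.rev i) (Fin.rev j) := by
      rw [mul_swap_mul_w₀, mul_assoc _ (swap _ _), swap_mul_self, mul_one]
    have hne : Fin.rev i ≠ Fin.rev j := fun he => hij (Fin.rev_injective he)
    rw [key]
    set v := b * swap i j * w₀ n with hv
    have e1 : len b = nonInv (v * swap (Fin.rev i) (Fin.rev j)) := by
      rw [← key, ← len_mul_w₀, mul_w₀_mul_w₀]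
    have e2 : len (b * swap i j) = nonInv v := by
      rw [← len_mul_w₀, hv, mul_w₀_mul_w₀]
    apply upStep_swap hne
    -- If this step did not go up, the reverse step would, and the length would drop instead of
    -- growing.
    by_contra hcon
    have : UpStep (v * swap (Fin.rev i) (Fin.rev j)) (v * swap (Fin.rev i) (Fin.rev j) *
        swap (Fin.rev i) (Fin.rev j)) := by
      apply upStep_swap hne
      simp only [Perm.mul_apply, swap_apply_left, swap_apply_right]
      have h3 : v (Fin.rev i) ≠ v (Fin.rev j) := fun he => hne (v.injective he)
      constructor
      · intro h1
        rcases lt_or_gt_of_ne h3 with h4 | h4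
        · exact absurd (iff_of_true h1 h4) hcon
        · exact h4
      · intro h1
        by_contra h4
        exact hcon (iff_of_false h4 (lt_asymm h1))
    have := this.nonInv_lt
    rw [mul_assoc v, swap_mul_self, mul_one] at this
    omega

/-! ### Twisted classes -/

/-- Since `frob x * w₀ = w₀ * x`, multiplication by `w₀` turns twisted conjugation into conjugation.
-/
theorem mem_fClass_iff {n : ℕ} (y z : Perm (Fin n)) :
    z ∈ fClass (y * w₀ n) ↔ IsConj y (z * w₀ n) := by
  rw [isConj_iff]
  constructor
  · rintro ⟨x, rfl⟩
    refine ⟨x⁻¹, ?_⟩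
    simp only [frob, inv_inv, mul_assoc, w₀_mul_self, mul_one]
    rw [← mul_assoc (w₀ n) (w₀ n), w₀_mul_self, one_mul]
  · rintro ⟨c, hc⟩
    refine ⟨c⁻¹, ?_⟩
    have : z = c * y * c⁻¹ * w₀ n := by rw [hc, mul_w₀_mul_w₀]
    rw [this]
    simp only [frob, inv_inv, mul_assoc]
    rw [← mul_assoc (w₀ n) (w₀ n), w₀_mul_self, one_mul]

theorem fClass_eq_of_isConj {n : ℕ} {y z : Perm (Fin n)} (h : IsConj y z) :
    fClass (y * w₀ n) = fClass (z * w₀ n) := by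
  ext x
  rw [mem_fClass_iff, mem_fClass_iff]
  exact ⟨h.symm.trans, h.trans⟩

theorem isConj_of_fClass_eq {n : ℕ} {y z : Perm (Fin n)}
    (h : fClass (y * w₀ n) = fClass (z * w₀ n)) : IsConj y z := by
  have : z * w₀ n ∈ fClass (z * w₀ n) := by
    rw [mem_fClass_iff, mul_w₀_mul_w₀]
  rw [← h, mem_fClass_iff, mul_w₀_mul_w₀] at this
  exact this

/-- `w` has the fewest non-inversions in its conjugacy class. -/
def IsTop {n : ℕ} (w : Perm (Fin n)) : Prop := ∀ v, IsConj w v → nonInv w ≤ nonInv v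

theorem mem_minElements_iff {n : ℕ} (y z : Perm (Fin n)) :
    z * w₀ n ∈ minElements (fClass (y * w₀ n)) ↔ IsConj y z ∧ IsTop z := by
  unfold minElements IsTop
  rw [Set.mem_ofPred_eq, mem_fClass_iff, mul_w₀_mul_w₀]
  refine and_congr_right fun h => ?_
  constructor
  · intro H v hv
    have := H (v * w₀ n) (by rw [mem_fClass_iff, mul_w₀_mul_w₀]; exact h.trans hv)
    rwa [len_mul_w₀, len_mul_w₀] at this
  · intro H x hx
    rw [mem_fClass_iff] at hx
    have := H _ (h.symm.trans hx)
    rwa [len_mul_w₀, ← mul_w₀_mul_w₀ x, len_mul_w₀]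

/-- Minimal length becomes `IsTop` and the Bruhat order is reversed, so that lengths disappear from
the comparison of classes. -/
theorem classLE_iff {n : ℕ} (y' y : Perm (Fin n)) :
    ClassLE (fClass (y' * w₀ n)) (fClass (y * w₀ n)) ↔
      ∀ z, IsConj y z → IsTop z → ∃ z', IsConj y' z' ∧ IsTop z' ∧ Up z z' := by
  unfold ClassLE
  constructor
  · intro H z hz ht
    obtain ⟨x', hx', hb⟩ := H (z * w₀ n) ((mem_minElements_iff y z).2 ⟨hz, ht⟩)
    rw [← mul_w₀_mul_w₀ x', mem_minElements_iff] at hx'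
    refine ⟨x' * w₀ n, hx'.1, hx'.2, ?_⟩
    have := hb.up
    rwa [mul_w₀_mul_w₀] at this
  · intro H x hx
    rw [← mul_w₀_mul_w₀ x, mem_minElements_iff] at hx
    obtain ⟨z', h1, h2, h3⟩ := H _ hx.1 hx.2
    refine ⟨z' * w₀ n, (mem_minElements_iff y' z').2 ⟨h1, h2⟩, ?_⟩
    have := h3.bruhatLE
    rwa [mul_w₀_mul_w₀] at this

end UnitaryClasses

namespace UnitaryClasses

/-! ### A discrete Sturm–Hurwitz inequality -/

/-- A trigonometric factor changing sign between `k` and `k + 1` modulo `T`. -/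
noncomputable def sineFactor (T k t : ℕ) : ℝ := Real.sin (Real.pi * (t - k - 1 / 2) / T)

theorem sineFactor_mul_succ (T k t : ℕ) :
    sineFactor T k t * sineFactor T k (t + 1) =
      (Real.cos (Real.pi / T) - Real.cos (2 * Real.pi * ((t : ℝ) - k) / T)) / 2 := by
  have h1 : Real.pi / T = Real.pi * (((t + 1 : ℕ) : ℝ) - k - 1 / 2) / T
      - Real.pi * (t - k - 1 / 2) / T := by
    push_cast; ring
  have h2 : 2 * Real.pi * ((t : ℝ) - k) / T = Real.pi * (((t + 1 : ℕ) : ℝ) - k - 1 / 2) / T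
      + Real.pi * (t - k - 1 / 2) / T := by
    push_cast; ring
  unfold sineFactor
  rw [h1, h2, Real.cos_add, Real.cos_sub]
  ring

theorem cos_lt_cos_pi_div {T r : ℕ} (h0 : 0 < r) (hr : r < T) :
    Real.cos (2 * Real.pi * r / T) < Real.cos (Real.pi / T) := by
  have hT : (0 : ℝ) < T := by exact_mod_cast h0.trans hr
  have hpi := Real.pi_pos
  have hr1 : (1 : ℝ) ≤ r := by exact_mod_cast h0
  have hr2 : (r : ℝ) + 1 ≤ T := by exact_mod_cast hr
  have hpos : 0 ≤ Real.pi / T := by positivity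
  by_cases hx : 2 * Real.pi * r / T ≤ Real.pi
  · apply Real.cos_lt_cos_of_nonneg_of_le_pi hpos hx
    rw [div_lt_div_iff_of_pos_right hT]
    nlinarith
  · rw [← Real.cos_two_pi_sub]
    push Not at hx
    apply Real.cos_lt_cos_of_nonneg_of_le_pi hpos (by linarith)
    rw [div_lt_iff₀ hT, sub_mul, div_mul_cancel₀ _ hT.ne']
    nlinarith

/-- By the product formula the sign is that of `cos (π / T) - cos (2π (t - k) / T)`, and at integers
the second cosine is the larger one only if `T` divides `t - k`. -/
theorem sineFactor_mul_succ_sign {T k : ℕ} (hk : k < T) (t : ℕ) :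
    (t % T = k → sineFactor T k t * sineFactor T k (t + 1) < 0) ∧
    (t % T ≠ k → 0 < sineFactor T k t * sineFactor T k (t + 1)) := by
  have hT0 : 0 < T := by omega
  have hT : (T : ℝ) ≠ 0 := by exact_mod_cast hT0.ne'
  rw [sineFactor_mul_succ]
  have hdm : (t : ℝ) = T * (t / T : ℕ) + (t % T : ℕ) := by exact_mod_cast (Nat.div_add_mod t T).symm
  have hlt := Nat.mod_lt t hT0
  have hpi := Real.pi_pos
  constructor
  · intro h
    have e : 2 * Real.pi * ((t : ℝ) - k) / T = ((t / T : ℕ) : ℝ) * (2 * Real.pi) := by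
      rw [hdm, h]; field_simp; ring
    rw [e, Real.cos_nat_mul_two_pi]
    have : Real.cos (Real.pi / T) < Real.cos 0 := by
      apply Real.cos_lt_cos_of_nonneg_of_le_pi le_rfl
      · apply div_le_self hpi.le; exact_mod_cast hT0
      · positivity
    rw [Real.cos_zero] at this
    linarith
  · intro h
    suffices H : ∃ r, 0 < r ∧ r < T ∧
        Real.cos (2 * Real.pi * ((t : ℝ) - k) / T) = Real.cos (2 * Real.pi * (r : ℕ) / T) by
      obtain ⟨r, h0, hr, he⟩ := H
      have := cos_lt_cos_pi_div h0 hr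
      rw [he]; linarith
    rcases lt_or_gt_of_ne h with h1 | h1
    · refine ⟨k - t % T, by omega, by omega, ?_⟩
      have e : 2 * Real.pi * ((t : ℝ) - k) / T =
          -(2 * Real.pi * ((k - t % T : ℕ) : ℝ) / T) + ((t / T : ℕ) : ℝ) * (2 * Real.pi) := by
        rw [Nat.cast_sub h1.le]
        rw [hdm]; field_simp; ring
      rw [e, Real.cos_add_nat_mul_two_pi, Real.cos_neg]
    · refine ⟨t % T - k, by omega, by omega, ?_⟩
      have e : 2 * Real.pi * ((t : ℝ) - k) / T =
          2 * Real.pi * ((t % T - k : ℕ) : ℝ) / T + ((t / T : ℕ) : ℝ) * (2 * Real.pi) := by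
        rw [Nat.cast_sub h1.le]
        nth_rw 1 [hdm]
        field_simp; ring
      rw [e, Real.cos_add_nat_mul_two_pi]

/-- Trigonometric polynomials in `π t / T` of degree at most `D`. -/
noncomputable def trigPoly (T D : ℕ) : Submodule ℂ (ℕ → ℂ) :=
  Submodule.span ℂ {h | ∃ s : ℤ, |s| ≤ D ∧ h = fun t : ℕ =>
    Complex.exp (Complex.I * (Real.pi * s / T : ℝ) * t)}

theorem one_mem_trigPoly (T : ℕ) : (fun _ => 1) ∈ trigPoly T 0 := by
  apply Submodule.subset_span
  exact ⟨0, by simp, by ext t; simp⟩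

/-- A sine is a combination of two exponentials, which shift every frequency by `1` or `-1`. -/
theorem sineFactor_mul_mem {T D : ℕ} (k : ℕ) {h : ℕ → ℂ} (hh : h ∈ trigPoly T D) :
    (fun t => (sineFactor T k t : ℂ) * h t) ∈ trigPoly T (D + 1) := by
  induction hh using Submodule.span_induction with
  | mem h hh =>
    obtain ⟨s, hs, rfl⟩ := hh
    have hs' := abs_le.1 hs
    set φ : ℝ := Real.pi * (-k - 1 / 2) / T with hφ
    have e : (fun t : ℕ => (sineFactor T k t : ℂ) *
        Complex.exp (Complex.I * (Real.pi * s / T : ℝ) * t)) =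
        (Complex.exp (-φ * Complex.I) * Complex.I / 2) • (fun t : ℕ =>
          Complex.exp (Complex.I * (Real.pi * (s - 1 : ℤ) / T : ℝ) * t)) -
        (Complex.exp (φ * Complex.I) * Complex.I / 2) • (fun t : ℕ =>
          Complex.exp (Complex.I * (Real.pi * (s + 1 : ℤ) / T : ℝ) * t)) := by
      ext t
      simp only [Pi.sub_apply, Pi.smul_apply, smul_eq_mul]
      have e1 : (sineFactor T k t : ℂ) =
          (Complex.exp (-(φ + Real.pi * t / T : ℝ) * Complex.I) -
            Complex.exp ((φ + Real.pi * t / T : ℝ) * Complex.I)) * Complex.I / 2 := by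
        rw [← Complex.sin, ← Complex.ofReal_sin, sineFactor, hφ]
        congr 2
        ring
      rw [e1, sub_mul, sub_div, sub_mul]
      congr 1
      · have : Complex.exp (-(φ + Real.pi * t / T : ℝ) * Complex.I) *
            Complex.exp (Complex.I * (Real.pi * s / T : ℝ) * t) = Complex.exp (-φ * Complex.I) *
            Complex.exp (Complex.I * (Real.pi * (s - 1 : ℤ) / T : ℝ) * t) := by
          rw [← Complex.exp_add, ← Complex.exp_add]
          congr 1
          push_cast; ring
        linear_combination (Complex.I / 2) * this
      · have : Complex.exp ((φ + Real.pi * t / T : ℝ) * Complex.I) *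
            Complex.exp (Complex.I * (Real.pi * s / T : ℝ) * t) = Complex.exp (φ * Complex.I) *
            Complex.exp (Complex.I * (Real.pi * (s + 1 : ℤ) / T : ℝ) * t) := by
          rw [← Complex.exp_add, ← Complex.exp_add]
          congr 1
          push_cast; ring
        linear_combination (Complex.I / 2) * this
    rw [e]
    refine Submodule.sub_mem _ (Submodule.smul_mem _ _ (Submodule.subset_span ⟨s - 1, ?_, rfl⟩))
      (Submodule.smul_mem _ _ (Submodule.subset_span ⟨s + 1, ?_, rfl⟩))
    · rw [abs_le]; push_cast; constructor <;> linarith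
    · rw [abs_le]; push_cast; constructor <;> linarith
  | zero => simp only [Pi.zero_apply, mul_zero]; exact Submodule.zero_mem (trigPoly T (D + 1))
  | add x y _ _ hx hy =>
    convert Submodule.add_mem _ hx hy using 1
    ext t; simp [mul_add]
  | smul a x _ hx =>
    convert Submodule.smul_mem _ a hx using 1
    ext t; simp; ring

theorem prod_sineFactor_mem (T : ℕ) (K : Finset ℕ) :
    (fun t => ((∏ k ∈ K, sineFactor T k t : ℝ) : ℂ)) ∈ trigPoly T K.card := by
  classical
  induction K using Finset.induction_on with
  | empty => simpa using one_mem_trigPoly T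
  | insert k K hk ih =>
    rw [Finset.card_insert_of_notMem hk]
    convert sineFactor_mul_mem k ih using 1
    ext t
    rw [Finset.prod_insert hk]; push_cast; rfl

/-! ### Orthogonality and the count of sign changes -/

theorem sum_range_shift {P : ℕ} {φ : ℕ → ℂ} (h : ∀ t, φ (t + P) = φ t) (a : ℕ) :
    ∑ t ∈ Finset.range P, φ (t + a) = ∑ t ∈ Finset.range P, φ t := by
  induction a with
  | zero => rfl
  | succ a ih =>
    rw [← ih]
    have h1 := Finset.sum_range_succ (fun t => φ (t + a)) P
    have h2 := Finset.sum_range_succ' (fun t => φ (t + a)) P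
    have h3 : φ (P + a) = φ (0 + a) := by rw [add_comm P, h, zero_add]
    simp only [h3] at h1
    rw [h1] at h2
    have h4 := add_right_cancel h2
    rw [h4]
    refine Finset.sum_congr rfl fun t _ => ?_
    congr 1; ring

/-- For a frequency `s`, shifting the summation by `a` multiplies the sum by `-exp (iπ s a / T)`.
This factor is not `1` because `|s a / T| < 1`, so the sum vanishes: antiperiodic sequences have no
low frequencies. -/
theorem sum_antiperiodic_mul_eq_zero {T D a : ℕ} (hT : 0 < T) (hD : D * a < T) {u h : ℕ → ℂ}
    (hu : ∀ t, u (t + a) = - u t) (hu2 : ∀ t, u (t + 2 * T) = u t) (hh : h ∈ trigPoly T D) :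
    ∑ t ∈ Finset.range (2 * T), u t * h t = 0 := by
  have hT' : (T : ℝ) ≠ 0 := by exact_mod_cast hT.ne'
  have hT'' : (T : ℂ) ≠ 0 := by exact_mod_cast hT.ne'
  induction hh using Submodule.span_induction with
  | mem h hh =>
    obtain ⟨s, hs, rfl⟩ := hh
    set φ : ℕ → ℂ := fun t => u t * Complex.exp (Complex.I * (Real.pi * s / T : ℝ) * t) with hφ
    set ζ := Complex.exp ((Real.pi * (s * a / T) : ℝ) * Complex.I) with hζ
    have hper : ∀ t, φ (t + 2 * T) = φ t := by
      intro t
      simp only [hφ, hu2]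
      congr 1
      rw [Complex.exp_eq_exp_iff_exists_int]
      refine ⟨s, ?_⟩
      push_cast
      field_simp
    have hshift : ∀ t, φ (t + a) = -ζ * φ t := by
      intro t
      simp only [hφ, hu, hζ]
      rw [neg_mul, neg_mul, mul_left_comm, ← Complex.exp_add]
      congr 3
      push_cast; ring
    have hsum := sum_range_shift hper a
    simp only [hshift, ← Finset.mul_sum] at hsum
    by_contra hne
    have h1 : -ζ = 1 := by
      have : (-ζ) * (∑ t ∈ Finset.range (2 * T), φ t) = 1 * ∑ t ∈ Finset.range (2 * T), φ t := by
        rw [hsum, one_mul]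
      exact mul_right_cancel₀ hne this
    have h2 : Real.cos (Real.pi * (s * a / T)) = -1 := by
      have := congrArg Complex.re h1
      rw [hζ, Complex.neg_re, Complex.exp_ofReal_mul_I_re, Complex.one_re] at this
      linarith
    have h3 : |(s : ℝ) * a / T| < 1 := by
      rw [abs_div, Nat.abs_cast, div_lt_one (by exact_mod_cast hT), abs_mul, Nat.abs_cast]
      have hs' : |(s : ℝ)| ≤ D := by exact_mod_cast hs
      calc |(s : ℝ)| * a ≤ D * a := by gcongr
        _ < T := by exact_mod_cast hD
    have h4 : Real.cos Real.pi < Real.cos |Real.pi * (s * a / T)| := by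
      apply Real.cos_lt_cos_of_nonneg_of_le_pi (abs_nonneg _) le_rfl
      rw [abs_mul, abs_of_pos Real.pi_pos]
      nlinarith [Real.pi_pos]
    rw [Real.cos_abs, h2, Real.cos_pi] at h4
    exact lt_irrefl _ h4
  | zero => simp
  | add x y _ _ hx hy =>
    simp only [Pi.add_apply, mul_add, Finset.sum_add_distrib, hx, hy, add_zero]
  | smul c x _ hx =>
    simp only [Pi.smul_apply, smul_eq_mul, mul_left_comm _ c, ← Finset.mul_sum, hx, mul_zero]

/-- If there were fewer sign changes, the product of the sine factors attached to them would be a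
trigonometric polynomial of degree so small that `u` and `v` are both orthogonal to it. But its
product with `u - v` has constant sign. -/
theorem le_mul_card_signChanges {T m : ℕ} (hT : 0 < T) {u v : ℕ → ℝ} {a b : ℕ}
    (ham : a ≤ m) (hbm : b ≤ m)
    (hu : ∀ t, u (t + a) = - u t) (hv : ∀ t, v (t + b) = - v t)
    (huT : ∀ t, u (t + T) = - u t) (hvT : ∀ t, v (t + T) = - v t)
    (hne : ∀ t, u t - v t ≠ 0) :
    T ≤ m * ((Finset.range T).filter
      (fun t => (u t - v t) * (u (t + 1) - v (t + 1)) < 0)).card := by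
  classical
  set g : ℕ → ℝ := fun t => u t - v t with hg
  set K := (Finset.range T).filter (fun t => g t * g (t + 1) < 0) with hK
  by_contra hlt
  push Not at hlt
  change m * K.card < T at hlt
  set P : ℕ → ℝ := fun t => ∏ k ∈ K, sineFactor T k t with hP
  have hgT : ∀ t, g (t + T) = - g t := by
    intro t; simp only [hg, huT, hvT]; ring
  -- The sequence `g` only changes sign under `t ↦ t + T`, so products of successive values have
  -- period `T`.
  have hgmod : ∀ t, g t * g (t + 1) = g (t % T) * g (t % T + 1) := by
    have : ∀ q r, g (r + T * q) * g (r + T * q + 1) = g r * g (r + 1) := by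
      intro q r
      induction q with
      | zero => rfl
      | succ q ih =>
        rw [← ih, show r + T * (q + 1) = (r + T * q) + T by ring, hgT,
          show r + T * q + T + 1 = (r + T * q + 1) + T by ring, hgT]
        ring
    intro t
    have := this (t / T) (t % T)
    rwa [Nat.mod_add_div] at this
  have hmem : ∀ t, t % T ∈ K ↔ g t * g (t + 1) < 0 := by
    intro t
    rw [hK, Finset.mem_filter, Finset.mem_range, hgmod t]
    exact and_iff_right (Nat.mod_lt t hT)
  have hKT : ∀ k ∈ K, k < T := fun k hk => Finset.mem_range.1 (Finset.mem_filter.1 hk).1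
  have hstep : ∀ t, 0 < (g t * P t) * (g (t + 1) * P (t + 1)) := by
    intro t
    have e : (g t * P t) * (g (t + 1) * P (t + 1)) =
        (g t * g (t + 1)) * ∏ k ∈ K, (sineFactor T k t * sineFactor T k (t + 1)) := by
      rw [Finset.prod_mul_distrib]; simp only [hP]; ring
    rw [e]
    by_cases ht : t % T ∈ K
    · rw [← Finset.mul_prod_erase K _ ht, ← mul_assoc]
      apply mul_pos
      · exact mul_pos_of_neg_of_neg ((hmem t).1 ht)
          ((sineFactor_mul_succ_sign (hKT _ ht) t).1 rfl)
      · apply Finset.prod_pos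
        intro k hk
        rw [Finset.mem_erase] at hk
        exact (sineFactor_mul_succ_sign (hKT _ hk.2) t).2 hk.1.symm
    · apply mul_pos
      · have h1 : g t * g (t + 1) ≠ 0 := mul_ne_zero (hne t) (hne (t + 1))
        have h2 : ¬ g t * g (t + 1) < 0 := fun h => ht ((hmem t).2 h)
        exact lt_of_le_of_ne (not_lt.1 h2) h1.symm
      · apply Finset.prod_pos
        intro k hk
        exact (sineFactor_mul_succ_sign (hKT _ hk) t).2 (fun h => ht (h ▸ hk))
  have hsign : ∀ t, 0 < (g 0 * P 0) * (g t * P t) := by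
    intro t
    induction t with
    | zero =>
      have := hstep 0
      exact mul_self_pos.2 (left_ne_zero_of_mul this.ne')
    | succ t ih =>
      have h1 := mul_pos ih (hstep t)
      have h2 : 0 < (g t * P t) * (g t * P t) :=
        mul_self_pos.2 (left_ne_zero_of_mul (hstep t).ne')
      have h3 : (g 0 * P 0) * (g t * P t) * ((g t * P t) * (g (t + 1) * P (t + 1))) =
        ((g 0 * P 0) * (g (t + 1) * P (t + 1))) * ((g t * P t) * (g t * P t)) := by ring
      rw [h3] at h1
      exact (pos_iff_pos_of_mul_pos h1).2 h2
  have hpos : 0 < ∑ t ∈ Finset.range (2 * T), (g 0 * P 0) * (g t * P t) :=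
    Finset.sum_pos (fun t _ => hsign t) ⟨0, Finset.mem_range.2 (by omega)⟩
  have hzero : ∀ (x : ℕ → ℝ) (p : ℕ), p ≤ m → (∀ t, x (t + p) = - x t) →
      (∀ t, x (t + T) = - x t) → ∑ t ∈ Finset.range (2 * T), x t * P t = 0 := by
    intro x p hp hx hxT
    have := sum_antiperiodic_mul_eq_zero (D := K.card) (a := p) (u := fun t => (x t : ℂ)) hT
      (lt_of_le_of_lt (by rw [mul_comm]; exact Nat.mul_le_mul_right _ hp) hlt)
      (fun t => by simp only [hx t]; push_cast; rfl)
      (fun t => by rw [show t + 2 * T = t + T + T by ring, hxT, hxT, neg_neg])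
      (prod_sineFactor_mem T K)
    exact_mod_cast this
  rw [← Finset.mul_sum] at hpos
  have : ∑ t ∈ Finset.range (2 * T), g t * P t = 0 := by
    simp only [hg, sub_mul, Finset.sum_sub_distrib]
    rw [hzero u a ham hu huT, hzero v b hbm hv hvT, sub_zero]
  rw [this, mul_zero] at hpos
  exact lt_irrefl _ hpos

/-- Two sequences of odd periods keep their relative order at least `T / max a b` times during a
common odd period `T`. -/
theorem le_max_mul_card_orderKept {T a b : ℕ} (hT : Odd T) (haT : a ∣ T) (hbT : b ∣ T)
    {c d : ℕ → ℕ} (hc : ∀ t, c (t + a) = c t) (hd : ∀ t, d (t + b) = d t)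
    (hne : ∀ t, c t ≠ d t) :
    T ≤ max a b * ((Finset.range T).filter
      (fun t => (c t < d t ↔ c (t + 1) < d (t + 1)))).card := by
  have hper : ∀ {x : ℕ → ℕ} {p : ℕ}, (∀ t, x (t + p) = x t) → p ∣ T → ∀ t, x (t + T) = x t := by
    rintro x p hx ⟨q, rfl⟩ t
    induction q with
    | zero => simp at hT
    | succ q ih =>
      have : ∀ q t, x (t + p * q) = x t := by
        intro q
        induction q with
        | zero => simp
        | succ q ih => intro t; rw [show t + p * (q + 1) = t + p * q + p by ring, hx, ih]
      exact this _ _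
  have hanti : ∀ {x : ℕ → ℕ} {p : ℕ}, (∀ t, x (t + p) = x t) → Odd p →
      ∀ t, (-1 : ℝ) ^ (t + p) * (x (t + p) : ℝ) = -((-1) ^ t * x t) := by
    intro x p hx hp t
    rw [hx, pow_add, hp.neg_one_pow]; ring
  -- The factor `(-1) ^ t` turns odd periods into antiperiods, and steps that keep the order into
  -- sign changes.
  have key := le_mul_card_signChanges (u := fun t => (-1 : ℝ) ^ t * c t)
    (v := fun t => (-1 : ℝ) ^ t * d t) hT.pos (le_max_left a b) (le_max_right a b)
    (hanti hc (hT.of_dvd_nat haT)) (hanti hd (hT.of_dvd_nat hbT)) (hanti (hper hc haT) hT)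
    (hanti (hper hd hbT) hT) (fun t => by
      rw [← mul_sub]
      exact mul_ne_zero (by simp) (sub_ne_zero.2 (by exact_mod_cast hne t)))
  convert key using 6 with t
  have e : ((-1 : ℝ) ^ t * c t - (-1) ^ t * d t) * ((-1) ^ (t + 1) * c (t + 1) -
      (-1) ^ (t + 1) * d (t + 1)) = -(((c t : ℝ) - d t) * (c (t + 1) - d (t + 1))) := by
    have h1 : ((-1 : ℝ) ^ t) * (-1) ^ t = 1 := by
      rw [← mul_pow]; norm_num
    rw [pow_succ]
    linear_combination (-(((c t : ℝ) - d t) * (c (t + 1) - d (t + 1)))) * h1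
  rw [e, neg_lt_zero, mul_pos_iff]
  simp only [sub_pos, sub_neg, Nat.cast_lt]
  have h1 := hne t
  have h2 := hne (t + 1)
  omega

end UnitaryClasses

namespace UnitaryClasses
open Equiv

/-! ### The minimal number of non-inversions in a class of odd order -/

/-- The size of the cycle through `i`. -/
noncomputable def sz {n : ℕ} (w : Perm (Fin n)) (i : Fin n) : ℕ := Function.minimalPeriod w i

/-- How often two letters keep their relative order during `T` applications of `w`. -/
def kept {n : ℕ} (w : Perm (Fin n)) (T : ℕ) (i j : Fin n) : ℕ :=
  ((Finset.range T).filter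
    (fun t => ((w ^ t) i < (w ^ t) j ↔ (w ^ (t + 1)) i < (w ^ (t + 1)) j))).card

/-- The lower bound for twice the number of non-inversions. -/
noncomputable def topBound {n : ℕ} (w : Perm (Fin n)) : ℚ :=
  ∑ p ∈ (Finset.univ : Finset (Fin n)).offDiag, 1 / (max (sz w p.1) (sz w p.2) : ℕ)

theorem pow_apply_eq_iterate {n : ℕ} (w : Perm (Fin n)) (t : ℕ) (i : Fin n) :
    (w ^ t) i = w^[t] i := by
  rw [Perm.iterate_eq_pow]

theorem sz_dvd {n : ℕ} {w : Perm (Fin n)} {T : ℕ} (h : w ^ T = 1) (i : Fin n) : sz w i ∣ T := by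
  apply Function.IsPeriodicPt.minimalPeriod_dvd
  rw [Function.IsPeriodicPt, Function.IsFixedPt, ← pow_apply_eq_iterate, h, Perm.one_apply]

theorem pow_add_sz_apply {n : ℕ} (w : Perm (Fin n)) (t : ℕ) (i : Fin n) :
    (w ^ (t + sz w i)) i = (w ^ t) i := by
  rw [pow_apply_eq_iterate, pow_apply_eq_iterate]
  exact Function.iterate_add_minimalPeriod_eq

theorem sz_pos {n : ℕ} (w : Perm (Fin n)) (i : Fin n) : 0 < sz w i :=
  Nat.pos_of_dvd_of_pos (sz_dvd (pow_orderOf_eq_one w) i) (orderOf_pos w)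

theorem sz_eq_one_iff {n : ℕ} {w : Perm (Fin n)} {i : Fin n} : sz w i = 1 ↔ w i = i :=
  Function.minimalPeriod_eq_one_iff_isFixedPt

theorem sz_conj {n : ℕ} (w g : Perm (Fin n)) (i : Fin n) : sz (g * w * g⁻¹) (g i) = sz w i := by
  apply Function.minimalPeriod_eq_minimalPeriod_iff.2
  intro k
  simp only [Function.IsPeriodicPt, Function.IsFixedPt, ← pow_apply_eq_iterate, conj_pow,
    Perm.mul_apply, EmbeddingLike.apply_eq_iff_eq]
  simp

theorem topBound_eq_of_isConj {n : ℕ} {w v : Perm (Fin n)} (h : IsConj w v) :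
    topBound w = topBound v := by
  obtain ⟨g, rfl⟩ := isConj_iff.1 h
  unfold topBound
  refine Finset.sum_bij (fun p _ => (g p.1, g p.2)) ?_ ?_ ?_ ?_
  · rintro ⟨a, b⟩ h
    simpa [Finset.mem_offDiag] using h
  · rintro ⟨a, b⟩ - ⟨c, d⟩ - h
    simpa using h
  · rintro ⟨a, b⟩ h
    exact ⟨(g⁻¹ a, g⁻¹ b), by simpa [Finset.mem_offDiag] using h, by simp⟩
  · rintro ⟨a, b⟩ -
    simp only [sz_conj]

theorem two_mul_nonInv {n : ℕ} (w : Perm (Fin n)) :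
    2 * nonInv w = ((Finset.univ : Finset (Fin n)).offDiag.filter
      (fun p => (p.1 < p.2 ↔ w p.1 < w p.2))).card := by
  classical
  have e : (Finset.univ : Finset (Fin n)).offDiag.filter
      (fun p => (p.1 < p.2 ↔ w p.1 < w p.2)) = nonInvSet w ∪ (nonInvSet w).image Prod.swap := by
    ext ⟨a, b⟩
    simp only [Finset.mem_filter, Finset.mem_offDiag, Finset.mem_univ, true_and, nonInvSet,
      Finset.mem_union, Finset.mem_image, Prod.exists, Prod.swap_prod_mk, Prod.mk.injEq]
    constructor
    · rintro ⟨hne, hiff⟩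
      have hne' : w a ≠ w b := fun h => hne (w.injective h)
      rcases lt_or_gt_of_ne hne with h | h
      · exact Or.inl ⟨h, hiff.1 h⟩
      · refine Or.inr ⟨b, a, ⟨h, ?_⟩, rfl, rfl⟩
        have : ¬ w a < w b := fun h' => lt_asymm h (hiff.2 h')
        exact lt_of_le_of_ne (not_lt.1 this) hne'.symm
    · rintro (⟨h1, h2⟩ | ⟨c, d, ⟨h1, h2⟩, rfl, rfl⟩)
      · exact ⟨h1.ne, iff_of_true h1 h2⟩
      · exact ⟨h1.ne', iff_of_false (lt_asymm h1) (lt_asymm h2)⟩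
  rw [e, Finset.card_union_of_disjoint, Finset.card_image_of_injective _ Prod.swap_injective,
    two_mul]
  · rfl
  · rw [Finset.disjoint_left]
    rintro ⟨a, b⟩ h1 h2
    simp only [nonInvSet, Finset.mem_filter, Finset.mem_univ, true_and, Finset.mem_image,
      Prod.exists, Prod.swap_prod_mk, Prod.mk.injEq] at h1 h2
    obtain ⟨c, d, ⟨h3, h4⟩, rfl, rfl⟩ := h2
    exact lt_asymm h1.1 h3

/-- Double counting: `w ^ t` permutes the ordered pairs, so each of the `T` times contributes `2 *
nonInv w`. -/
theorem sum_kept {n : ℕ} (w : Perm (Fin n)) (T : ℕ) :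
    ∑ p ∈ (Finset.univ : Finset (Fin n)).offDiag, kept w T p.1 p.2 = T * (2 * nonInv w) := by
  classical
  have h1 : ∀ p : Fin n × Fin n, kept w T p.1 p.2 = ∑ t ∈ Finset.range T,
      if ((w ^ t) p.1 < (w ^ t) p.2 ↔ (w ^ (t + 1)) p.1 < (w ^ (t + 1)) p.2) then 1 else 0 := by
    intro p; rw [kept, Finset.card_filter]
  simp only [h1]
  rw [Finset.sum_comm, two_mul_nonInv, Finset.card_filter]
  have h2 : ∀ t, ∑ p ∈ (Finset.univ : Finset (Fin n)).offDiag,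
      (if ((w ^ t) p.1 < (w ^ t) p.2 ↔ (w ^ (t + 1)) p.1 < (w ^ (t + 1)) p.2) then 1 else 0) =
      ∑ p ∈ (Finset.univ : Finset (Fin n)).offDiag,
        if (p.1 < p.2 ↔ w p.1 < w p.2) then 1 else 0 := by
    intro t
    refine Finset.sum_bij (fun p _ => ((w ^ t) p.1, (w ^ t) p.2)) ?_ ?_ ?_ ?_
    · rintro ⟨a, b⟩ h
      simpa [Finset.mem_offDiag] using h
    · rintro ⟨a, b⟩ - ⟨c, d⟩ - h
      simpa using h
    · rintro ⟨a, b⟩ h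
      exact ⟨((w ^ t)⁻¹ a, (w ^ t)⁻¹ b), by simpa [Finset.mem_offDiag] using h, by simp⟩
    · rintro ⟨a, b⟩ -
      simp only [pow_succ', Perm.mul_apply]
  rw [Finset.sum_congr rfl (fun t _ => h2 t), Finset.sum_const, Finset.card_range, smul_eq_mul]

theorem le_max_mul_kept {n : ℕ} {w : Perm (Fin n)} {T : ℕ} (hT : Odd T) (hw : w ^ T = 1)
    {i j : Fin n} (hij : i ≠ j) : T ≤ max (sz w i) (sz w j) * kept w T i j := by
  have := le_max_mul_card_orderKept (c := fun t => ((w ^ t) i : ℕ)) (d := fun t => ((w ^ t) j : ℕ))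
    hT (sz_dvd hw i) (sz_dvd hw j) (fun t => by simp only [pow_add_sz_apply])
    (fun t => by simp only [pow_add_sz_apply])
    (fun t h => hij ((w ^ t).injective (Fin.ext h)))
  simpa only [kept, Fin.lt_def] using this

/-- Averaging over a period of `w` bounds the number of non-inversions pair by pair. The bound sees
only cycle sizes, hence is the same on the whole class. -/
theorem topBound_le {n : ℕ} {w : Perm (Fin n)} {T : ℕ} (hT : Odd T) (hw : w ^ T = 1) :
    topBound w ≤ 2 * nonInv w := by
  have hT' : (0 : ℚ) < T := by exact_mod_cast hT.pos
  have h := sum_kept w T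
  have h' : (T : ℚ) * (2 * nonInv w) =
      ∑ p ∈ (Finset.univ : Finset (Fin n)).offDiag, (kept w T p.1 p.2 : ℚ) := by
    exact_mod_cast h.symm
  rw [← mul_le_mul_iff_right₀ hT', h', topBound, Finset.mul_sum]
  refine Finset.sum_le_sum fun p hp => ?_
  have hm : (0 : ℚ) < (max (sz w p.1) (sz w p.2) : ℕ) := by
    exact_mod_cast lt_max_of_lt_left (sz_pos w p.1)
  rw [mul_one_div, div_le_iff₀ hm, mul_comm]
  exact_mod_cast le_max_mul_kept hT hw (Finset.mem_offDiag.1 hp).2.2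

theorem isTop_of_le_topBound {n : ℕ} {w : Perm (Fin n)} {T : ℕ} (hT : Odd T) (hw : w ^ T = 1)
    (h : (2 * nonInv w : ℚ) ≤ topBound w) : IsTop w := by
  intro v hv
  have hv' : v ^ T = 1 := by
    obtain ⟨g, rfl⟩ := isConj_iff.1 hv
    rw [conj_pow, hw, mul_one, mul_inv_cancel]
  have h1 := topBound_le hT hv'
  rw [← topBound_eq_of_isConj hv] at h1
  have : (2 * nonInv w : ℚ) ≤ 2 * nonInv v := h.trans h1
  have : 2 * nonInv w ≤ 2 * nonInv v := by exact_mod_cast this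
  omega

/-- Equality in the bound for every pair of letters; both the stuck elements and Kim's elements are
recognized as top elements in this way. -/
theorem isTop_of_kept_le {n : ℕ} {w : Perm (Fin n)} {T : ℕ} (hT : Odd T) (hw : w ^ T = 1)
    (h : ∀ i j, i ≠ j → max (sz w i) (sz w j) * kept w T i j ≤ T) : IsTop w := by
  apply isTop_of_le_topBound hT hw
  have hT' : (0 : ℚ) < T := by exact_mod_cast hT.pos
  have h' : (T : ℚ) * (2 * nonInv w) =
      ∑ p ∈ (Finset.univ : Finset (Fin n)).offDiag, (kept w T p.1 p.2 : ℚ) := by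
    exact_mod_cast (sum_kept w T).symm
  rw [← mul_le_mul_iff_right₀ hT', h', topBound, Finset.mul_sum]
  refine Finset.sum_le_sum fun p hp => ?_
  have hm : (0 : ℚ) < (max (sz w p.1) (sz w p.2) : ℕ) := by
    exact_mod_cast lt_max_of_lt_left (sz_pos w p.1)
  rw [mul_one_div, le_div_iff₀ hm, mul_comm]
  exact_mod_cast h _ _ (Finset.mem_offDiag.1 hp).2.2

end UnitaryClasses

namespace UnitaryClasses
open Equiv

/-! ### Moves inside a conjugacy class -/

/-- No element of the class of `w` above `w` has fewer non-inversions. -/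
def Stuck {n : ℕ} (w : Perm (Fin n)) : Prop :=
  ∀ w', Up w w' → IsConj w w' → nonInv w ≤ nonInv w'

theorem exists_up_stuck {n : ℕ} (w : Perm (Fin n)) : ∃ w', Up w w' ∧ IsConj w w' ∧ Stuck w' := by
  induction h : nonInv w using Nat.strong_induction_on generalizing w with
  | _ k ih =>
    by_cases hs : Stuck w
    · exact ⟨w, Relation.ReflTransGen.refl, IsConj.refl w, hs⟩
    · unfold Stuck at hs
      push Not at hs
      obtain ⟨w', hu, hc, hlt⟩ := hs
      obtain ⟨w'', hu', hc', hs'⟩ := ih (nonInv w') (h ▸ hlt) w' rfl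
      exact ⟨w'', hu.trans hu', hc.trans hc', hs'⟩

theorem not_stuck_of_steps {n : ℕ} {w w₁ w₂ : Perm (Fin n)} (h1 : UpStep w w₁) (h2 : UpStep w₁ w₂)
    (h : IsConj w w₂) : ¬ Stuck w := by
  intro hs
  have := hs w₂ (h1.up.trans h2.up) h
  have := h1.nonInv_lt
  have := h2.nonInv_lt
  omega

theorem isConj_swap_mul_mul_swap {n : ℕ} (w : Perm (Fin n)) (i j : Fin n) :
    IsConj w (swap i j * w * swap i j) :=
  isConj_iff.2 ⟨swap i j, by rw [swap_inv]⟩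

theorem swap_mul_eq {n : ℕ} (w : Perm (Fin n)) (i j : Fin n) :
    swap i j * w = w * swap (w⁻¹ i) (w⁻¹ j) := by
  rw [swap_apply_apply, inv_inv]
  simp [mul_assoc]

/-- If two moved letters keep their relative order in two successive steps, then conjugation by
their transposition is two steps up. The first multiplication affects the preimages compared in the
second one only if `w` maps one of the letters to the other, whence the cases. -/
theorem not_stuck_of_run {n : ℕ} {w : Perm (Fin n)} {i j : Fin n} (hij : i ≠ j) (hi : w i ≠ i)
    (hj : w j ≠ j) (h1 : i < j ↔ w i < w j) (h2 : w⁻¹ i < w⁻¹ j ↔ i < j) : ¬ Stuck w := by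
  have hstep := upStep_swap hij h1
  refine not_stuck_of_steps (w₂ := swap i j * (w * swap i j)) hstep ?_
    (by rw [← mul_assoc]; exact isConj_swap_mul_mul_swap w i j)
  rw [swap_mul_eq]
  have e : ∀ x, (w * swap i j)⁻¹ x = swap i j (w⁻¹ x) := by
    intro x; rw [mul_inv_rev, swap_inv]; rfl
  have hv : ∀ x, (w * swap i j) ((w * swap i j)⁻¹ x) = x := fun x => by simp
  have hw : ∀ x, w (w⁻¹ x) = x := fun x => by simp
  apply upStep_swap (fun h => hij ((w * swap i j)⁻¹.injective h))
  rw [hv, hv, e, e]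
  have hpi : w⁻¹ i ≠ i := fun h => hi (by rw [← h, hw, h])
  have hqj : w⁻¹ j ≠ j := fun h => hj (by rw [← h, hw, h])
  by_cases hp : w⁻¹ i = j
  · by_cases hq : w⁻¹ j = i
    · rw [hp, hq] at h2
      exfalso
      rcases lt_or_gt_of_ne hij with h | h
      · exact lt_asymm h (h2.2 h)
      · exact lt_asymm h (h2.1 h)
    · rw [hp, swap_apply_right, swap_apply_of_ne_of_ne hq hqj]
      rw [hp] at h2
      generalize w⁻¹ j = q at *
      simp only [Fin.lt_def, ne_eq, Fin.ext_iff] at *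
      omega
  · rw [swap_apply_of_ne_of_ne hpi hp]
    by_cases hq : w⁻¹ j = i
    · rw [hq, swap_apply_left]
      rw [hq] at h2
      generalize w⁻¹ i = q at *
      simp only [Fin.lt_def, ne_eq, Fin.ext_iff] at *
      omega
    · rw [swap_apply_of_ne_of_ne hq hqj]
      exact h2

/-- Here `w⁻¹ j`, `j`, `w j` lie on one side of the fixed letter `i`, and one of the two neighbours
is farther from `i` than `j`. Conjugation by the transposition, which makes `j` the fixed letter, is
then two steps up; the neighbour decides on which side to multiply first. -/
theorem not_stuck_of_fixed {n : ℕ} {w : Perm (Fin n)} {i j : Fin n} (hi : w i = i)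
    (hj : w j ≠ j) (h1 : i < j ↔ i < w j) (h2 : i < j ↔ i < w⁻¹ j)
    (h3 : (i < j ↔ j < w j) ∨ (i < j ↔ j < w⁻¹ j)) : ¬ Stuck w := by
  have hij : i ≠ j := by rintro rfl; exact hj hi
  have hw : ∀ x, w (w⁻¹ x) = x := fun x => by simp
  have hi' : w⁻¹ i = i := by rw [Perm.inv_eq_iff_eq, hi]
  have hqj : w⁻¹ j ≠ j := fun h => hj (by rw [← h, hw, h])
  have hqi : w⁻¹ j ≠ i := fun h => hij (by rw [← hw j, h, hi])
  have hwji : w j ≠ i := fun h => hij (w.injective (by rw [h, hi]))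
  rcases h3 with h3 | h3
  · refine not_stuck_of_steps (w₁ := swap i j * w) (w₂ := swap i j * w * swap i j) ?_ ?_
      (isConj_swap_mul_mul_swap w i j)
    · rw [swap_mul_eq, hi']
      apply upStep_swap hqi.symm
      rw [hi, hw]
      exact h2.symm
    · apply upStep_swap hij
      simp only [Perm.mul_apply, hi, swap_apply_left]
      rw [swap_apply_of_ne_of_ne hwji hj]
      exact h3
  · refine not_stuck_of_steps (w₁ := w * swap i j) (w₂ := swap i j * (w * swap i j)) ?_ ?_
      (by rw [← mul_assoc]; exact isConj_swap_mul_mul_swap w i j)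
    · apply upStep_swap hij
      rw [hi]
      exact h1
    · rw [swap_mul_eq]
      have e : ∀ x, (w * swap i j)⁻¹ x = swap i j (w⁻¹ x) := by
        intro x; rw [mul_inv_rev, swap_inv]; rfl
      have hv : ∀ x, (w * swap i j) ((w * swap i j)⁻¹ x) = x := fun x => by simp
      apply upStep_swap (fun h => hij ((w * swap i j)⁻¹.injective h))
      rw [hv, hv, e, e, hi', swap_apply_left, swap_apply_of_ne_of_ne hqi hqj]
      exact h3.symm

/-- The condition for `a ↦ w b ↦ …`, the product of `w` with a `3`-cycle, to be above `w`. -/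
theorem up_mul_swap_mul_swap {n : ℕ} {w : Perm (Fin n)} {a b c : Fin n} (hab : a ≠ b) (hbc : b ≠ c)
    (hac : a ≠ c) (h1 : a < b ↔ w a < w b) (h2 : b < c ↔ w a < w c) :
    UpStep w (w * swap a b) ∧ UpStep (w * swap a b) (w * swap a b * swap b c) := by
  refine ⟨upStep_swap hab h1, upStep_swap hbc ?_⟩
  simp only [Perm.mul_apply, swap_apply_right]
  rw [swap_apply_of_ne_of_ne hac.symm hbc.symm]
  exact h2

/-- A `3`-cycle can be factored starting from any of its letters, which gives three different
conditions for reaching the same product by two steps up. -/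
theorem swap_mul_swap_rotate {n : ℕ} {a b c : Fin n} (hab : a ≠ b) (hac : a ≠ c) :
    swap b c * swap c a = swap a b * swap b c := by
  have := swap_apply_apply (swap b c) c a
  rw [swap_apply_right, swap_apply_of_ne_of_ne hab hac, swap_comm b a] at this
  rw [this, inv_mul_cancel_right]

/-! ### Permutations supported on labelled points -/

section Labels
variable {n k : ℕ} (v : Fin k ↪ Fin n)

/-- The permutation of the letters induced by a permutation of the labels. -/
noncomputable def lift : Perm (Fin k) →* Perm (Fin n) := Perm.viaEmbeddingHom v

theorem lift_apply (σ : Perm (Fin k)) (l : Fin k) : lift v σ (v l) = v (σ l) :=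
  Perm.viaEmbedding_apply σ v l

theorem lift_apply_of_notMem (σ : Perm (Fin k)) {x : Fin n} (hx : x ∉ Set.range v) :
    lift v σ x = x :=
  Perm.viaEmbedding_apply_of_notMem σ v x hx

theorem lift_swap (a b : Fin k) : lift v (swap a b) = swap (v a) (v b) := by
  ext x
  by_cases hx : x ∈ Set.range v
  · obtain ⟨l, rfl⟩ := hx
    rw [lift_apply, v.injective.swap_apply]
  · rw [lift_apply_of_notMem v _ hx, swap_apply_of_ne_of_ne]
    · rintro rfl; exact hx ⟨a, rfl⟩
    · rintro rfl; exact hx ⟨b, rfl⟩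

theorem cycleType_lift (σ : Perm (Fin k)) : (lift v σ).cycleType = σ.cycleType := by
  rw [lift, Perm.viaEmbeddingHom_apply, Perm.viaEmbedding]
  exact @Perm.cycleType_extendDomain (Fin k) _ _ (Fin n) _ _ (· ∈ Set.range v.1)
    (fun _ => Classical.propDecidable _) (Equiv.ofInjective v.1 v.2) σ

theorem exists_lift_mul {w : Perm (Fin n)} {π : Perm (Fin k)} (h : ∀ l, w (v l) = v (π l)) :
    ∃ ρ, w = lift v π * ρ ∧ ∀ σ, (lift v σ).Disjoint ρ := by
  refine ⟨(lift v π)⁻¹ * w, by simp, fun σ x => ?_⟩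
  by_cases hx : x ∈ Set.range v
  · obtain ⟨l, rfl⟩ := hx
    right
    rw [Perm.mul_apply, h, Perm.inv_eq_iff_eq, lift_apply]
  · left
    exact lift_apply_of_notMem v σ hx

/-- The part of `w` off the labelled letters commutes with whatever is supported on them, so the
conjugacy need only be verified in the small group, by computation. -/
theorem isConj_mul_lift {w : Perm (Fin n)} {π σ g : Perm (Fin k)} (h : ∀ l, w (v l) = v (π l))
    (hg : g * π * g⁻¹ = π * σ) : IsConj w (w * lift v σ) := by
  obtain ⟨ρ, rfl, hρ⟩ := exists_lift_mul v h
  refine isConj_iff.2 ⟨lift v g, ?_⟩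
  have h1 : ρ * (lift v g)⁻¹ = (lift v g)⁻¹ * ρ := by
    rw [← map_inv]; exact ((hρ g⁻¹).commute.eq).symm
  rw [mul_assoc, mul_assoc, h1, mul_assoc (lift v π), ← (hρ σ).commute.eq, ← mul_assoc,
    ← mul_assoc, ← mul_assoc, ← map_mul, ← map_inv, ← map_mul, ← map_mul, hg]

/-- The same splitting, with cycle types of disjoint factors added up; the additive form avoids
differences of multisets. -/
theorem cycleType_mul_lift {w : Perm (Fin n)} {π : Perm (Fin k)} (σ : Perm (Fin k))
    (h : ∀ l, w (v l) = v (π l)) :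
    (w * lift v σ).cycleType + π.cycleType = w.cycleType + (π * σ).cycleType := by
  obtain ⟨ρ, rfl, hρ⟩ := exists_lift_mul v h
  have e : lift v π * ρ * lift v σ = lift v (π * σ) * ρ := by
    rw [mul_assoc, ← (hρ σ).commute.eq, map_mul, mul_assoc]
  rw [e, (hρ (π * σ)).cycleType_mul, (hρ π).cycleType_mul, cycleType_lift, cycleType_lift]
  abel

end Labels

/-! ### Ranks of finitely many letters -/

/-- The rank of a letter in a list. -/
def rank {n : ℕ} (l : List (Fin n)) (x : Fin n) : ℕ := (l.toFinset.filter (· < x)).card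

theorem rank_lt_rank {n : ℕ} {l : List (Fin n)} {x y : Fin n} (hx : x ∈ l) (hy : y ∈ l) :
    rank l x < rank l y ↔ x < y := by
  have mono : ∀ {x y : Fin n}, x ∈ l → x < y → rank l x < rank l y := by
    intro x y hx h
    apply Finset.card_lt_card
    rw [Finset.ssubset_iff_of_subset]
    · exact ⟨x, by simp [hx, h], by simp⟩
    · intro z hz
      simp only [Finset.mem_filter] at hz ⊢
      exact ⟨hz.1, hz.2.trans h⟩
  refine ⟨fun h => ?_, mono hx⟩
  by_contra hc
  rcases eq_or_lt_of_le (not_lt.1 hc) with h1 | h1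
  · rw [h1] at h; exact lt_irrefl _ h
  · exact lt_asymm h (mono hy h1)

theorem rank_lt_length {n : ℕ} {l : List (Fin n)} {x : Fin n} (hx : x ∈ l) :
    rank l x < l.length := by
  refine lt_of_lt_of_le (Finset.card_lt_card ?_) (List.toFinset_card_le l)
  rw [Finset.ssubset_iff_of_subset (Finset.filter_subset _ _)]
  exact ⟨x, by simpa using hx, by simp⟩

theorem nodup_map_rank {n : ℕ} {l : List (Fin n)} (hl : l.Nodup) : (l.map (rank l)).Nodup := by
  refine List.Nodup.map_on ?_ hl
  intro x hx y hy h
  rcases lt_trichotomy x y with h1 | h1 | h1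
  · exact absurd h ((rank_lt_rank hx hy).2 h1).ne
  · exact h1
  · exact absurd h ((rank_lt_rank hy hx).2 h1).ne'

/-- A test on all the arrangements of `k` elements of `rem`, put in reverse order before `acc`,
except for those having an end segment discarded by `Q`. -/
def allArrangements (P Q : List ℕ → Bool) : ℕ → List ℕ → List ℕ → Bool
  | 0, _, acc => P acc
  | k + 1, rem, acc =>
      rem.all fun x => Q (x :: acc) || allArrangements P Q k (rem.erase x) (x :: acc)

theorem of_allArrangements {P Q : List ℕ → Bool} {k : ℕ} {rem acc : List ℕ}
    (h : allArrangements P Q k rem acc = true) {l : List ℕ} (hk : l.length = k) (hl : l.Nodup)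
    (hsub : ∀ x ∈ l, x ∈ rem) (hQ : ∀ s, s <:+ l.reverse ++ acc → Q s = false) :
    P (l.reverse ++ acc) = true := by
  induction k generalizing rem acc l with
  | zero =>
    rw [List.length_eq_zero_iff] at hk
    subst hk
    simpa [allArrangements] using h
  | succ k ih =>
    obtain _ | ⟨x, l⟩ := l
    · simp at hk
    have e : (x :: l).reverse ++ acc = l.reverse ++ (x :: acc) := by simp
    rw [allArrangements, List.all_eq_true] at h
    have hx := h x (hsub x (by simp))
    rw [hQ (x :: acc) (by rw [e]; exact List.suffix_append _ _), Bool.false_or] at hx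
    rw [e] at hQ ⊢
    exact ih hx (l := l) (by simpa using hk) (List.nodup_cons.1 hl).2
      (fun y hy => by
        have hne : y ≠ x := by rintro rfl; exact (List.nodup_cons.1 hl).1 hy
        exact (List.mem_erase_of_ne hne).2 (hsub y (by simp [hy]))) hQ

/-- The ranks of `k` distinct letters are the numbers `0, …, k - 1` in some order, so a property of
relative orders follows from an enumeration. -/
theorem test_map_rank {n k : ℕ} {P Q : List ℕ → Bool} {l : List (Fin n)} (hl : l.Nodup)
    (hk : l.length = k) (h : allArrangements P Q k (List.range k) [] = true)
    (hQ : ∀ m, Q ((l.map (rank l)).drop m) = false) : P (l.map (rank l)) = true := by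
  have := of_allArrangements h (l := (l.map (rank l)).reverse) (by simpa using hk)
    (List.nodup_reverse.2 (nodup_map_rank hl)) (by
      intro x hx
      rw [List.mem_reverse, List.mem_map] at hx
      obtain ⟨y, hy, rfl⟩ := hx
      exact List.mem_range.2 (hk ▸ rank_lt_length hy)) (by
      intro s hs
      rw [List.reverse_reverse, List.append_nil, List.suffix_iff_eq_drop] at hs
      rw [hs]
      exact hQ _)
  simpa using this

end UnitaryClasses

namespace UnitaryClasses
open Equiv

/-! ### Stuck elements with cycles of length at most five -/

theorem pow_mod_sz {n : ℕ} (w : Perm (Fin n)) (i : Fin n) (t : ℕ) :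
    (w ^ (t % sz w i)) i = (w ^ t) i := by
  rw [pow_apply_eq_iterate, pow_apply_eq_iterate]
  exact Function.iterate_mod_minimalPeriod_eq

theorem sz_pow_apply {n : ℕ} (w : Perm (Fin n)) (t : ℕ) (i : Fin n) : sz w ((w ^ t) i) = sz w i := by
  rw [pow_apply_eq_iterate]
  exact Function.minimalPeriod_apply_iterate
    (Function.minimalPeriod_pos_iff_mem_periodicPts.1 (sz_pos w i)) t

theorem pow_apply_inj {n : ℕ} {w : Perm (Fin n)} {i : Fin n} {s t : ℕ} (hs : s < sz w i)
    (ht : t < sz w i) (h : (w ^ s) i = (w ^ t) i) : s = t := by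
  rw [pow_apply_eq_iterate, pow_apply_eq_iterate] at h
  exact (Function.iterate_eq_iterate_iff_of_lt_minimalPeriod hs ht).1 h

/-- The first `k` letters of the orbit of `i`. -/
def orbitList {n : ℕ} (w : Perm (Fin n)) (i : Fin n) (k : ℕ) : List (Fin n) :=
  (List.range k).map fun t => (w ^ t) i

theorem nodup_orbitList {n : ℕ} (w : Perm (Fin n)) (i : Fin n) :
    (orbitList w i (sz w i)).Nodup := by
  refine List.Nodup.map_on ?_ List.nodup_range
  intro s hs t ht h
  exact pow_apply_inj (List.mem_range.1 hs) (List.mem_range.1 ht) h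

theorem nodup_orbitList_append {n : ℕ} {w : Perm (Fin n)} {i j : Fin n}
    (h : ∀ s t, (w ^ s) i ≠ (w ^ t) j) :
    (orbitList w i (sz w i) ++ orbitList w j (sz w j)).Nodup := by
  refine List.Nodup.append (nodup_orbitList w i) (nodup_orbitList w j) ?_
  intro x hx hy
  obtain ⟨s, -, rfl⟩ := List.mem_map.1 hx
  obtain ⟨t, -, ht⟩ := List.mem_map.1 hy
  exact h s t ht.symm

theorem pow_apply_ne_of_sz_ne {n : ℕ} {w : Perm (Fin n)} {i j : Fin n} (h : sz w i ≠ sz w j)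
    (s t : ℕ) : (w ^ s) i ≠ (w ^ t) j := by
  intro he
  apply h
  rw [← sz_pow_apply w s, he, sz_pow_apply]

theorem kept_eq_card {n : ℕ} (w : Perm (Fin n)) (T : ℕ) (i j : Fin n) :
    kept w T i j = ((Finset.range T).filter (fun t =>
      decide ((w ^ t) i < (w ^ t) j) = decide ((w ^ (t + 1)) i < (w ^ (t + 1)) j))).card := by
  unfold kept
  congr 1
  ext t
  simp only [Finset.mem_filter, decide_eq_decide]

theorem kept_comm {n : ℕ} (w : Perm (Fin n)) (T : ℕ) {i j : Fin n} (hij : i ≠ j) :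
    kept w T i j = kept w T j i := by
  unfold kept
  congr 1
  ext t
  simp only [Finset.mem_filter]
  have h1 : (w ^ t) i ≠ (w ^ t) j := fun h => hij ((w ^ t).injective h)
  have h2 : (w ^ (t + 1)) i ≠ (w ^ (t + 1)) j := fun h => hij ((w ^ (t + 1)).injective h)
  refine and_congr_right fun _ => ?_
  simp only [Fin.lt_def, ne_eq, Fin.ext_iff] at *
  omega

/-! ### Pairs of letters in a stuck element -/

/-- Round a period of odd length the number of changes is even, so the number of equalities is odd.
It is not three, as there is no run, so it is one in each of the five periods. -/
theorem card_kept_of_period_three {s : ℕ → Bool} (h : ∀ t, s (t + 3) = s t)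
    (hr : ∀ t, s t = s (t + 1) → s (t + 1) ≠ s (t + 2)) :
    3 * ((Finset.range 15).filter (fun t => s t = s (t + 1))).card ≤ 15 := by
  have h3 : s 3 = s 0 := h 0
  have h4 : s 4 = s 1 := h 1
  have h5 : s 5 = s 2 := h 2
  have h6 : s 6 = s 0 := (h 3).trans h3
  have h7 : s 7 = s 1 := (h 4).trans h4
  have h8 : s 8 = s 2 := (h 5).trans h5
  have h9 : s 9 = s 0 := (h 6).trans h6
  have h10 : s 10 = s 1 := (h 7).trans h7
  have h11 : s 11 = s 2 := (h 8).trans h8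
  have h12 : s 12 = s 0 := (h 9).trans h9
  have h13 : s 13 = s 1 := (h 10).trans h10
  have h14 : s 14 = s 2 := (h 11).trans h11
  have h15 : s 15 = s 0 := (h 12).trans h12
  have hr0 : s 0 = s 1 → s 1 ≠ s 2 := hr 0
  simp only [Finset.card_filter, Finset.sum_range_succ, Finset.sum_range_zero, Nat.reduceAdd,
    zero_add, h3, h4, h5, h6, h7, h8, h9, h10, h11, h12, h13, h14, h15]
  clear h3 h4 h5 h6 h7 h8 h9 h10 h11 h12 h13 h14 h15 h hr
  revert hr0
  generalize s 0 = x, s 1 = y, s 2 = z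
  revert x y z
  decide

/-- Round the period there is an even number of runs, each of length at most two; hence there are
four, and exactly one equality in each of the three periods. -/
theorem card_kept_of_period_five {s : ℕ → Bool} (h : ∀ t, s (t + 5) = s t)
    (hr : ∀ t, s t = s (t + 1) → s (t + 1) ≠ s (t + 2)) :
    5 * ((Finset.range 15).filter (fun t => s t = s (t + 1))).card ≤ 15 := by
  have h5 : s 5 = s 0 := h 0
  have h6 : s 6 = s 1 := h 1
  have h7 : s 7 = s 2 := h 2
  have h8 : s 8 = s 3 := h 3
  have h9 : s 9 = s 4 := h 4
  have h10 : s 10 = s 0 := (h 5).trans h5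
  have h11 : s 11 = s 1 := (h 6).trans h6
  have h12 : s 12 = s 2 := (h 7).trans h7
  have h13 : s 13 = s 3 := (h 8).trans h8
  have h14 : s 14 = s 4 := (h 9).trans h9
  have h15 : s 15 = s 0 := (h 10).trans h10
  have hr0 : s 0 = s 1 → s 1 ≠ s 2 := hr 0
  have hr1 : s 1 = s 2 → s 2 ≠ s 3 := hr 1
  have hr2 : s 2 = s 3 → s 3 ≠ s 4 := hr 2
  have hr3 : s 3 = s 4 → s 4 ≠ s 5 := hr 3
  have hr4 : s 4 = s 5 → s 5 ≠ s 6 := hr 4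
  simp only [Finset.card_filter, Finset.sum_range_succ, Finset.sum_range_zero, Nat.reduceAdd,
    zero_add, h5, h6, h7, h8, h9, h10, h11, h12, h13, h14, h15] at hr3 hr4 ⊢
  clear h5 h6 h7 h8 h9 h10 h11 h12 h13 h14 h15 h hr
  revert hr0 hr1 hr2 hr3 hr4
  generalize s 0 = x, s 1 = y, s 2 = z, s 3 = p, s 4 = q
  revert x y z p q
  decide

theorem Stuck.no_run {n : ℕ} {w : Perm (Fin n)} (hs : Stuck w) {i j : Fin n} (hij : i ≠ j)
    (hi : sz w i ≠ 1) (hj : sz w j ≠ 1) (t : ℕ)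
    (h : decide ((w ^ t) i < (w ^ t) j) = decide ((w ^ (t + 1)) i < (w ^ (t + 1)) j)) :
    decide ((w ^ (t + 1)) i < (w ^ (t + 1)) j) ≠ decide ((w ^ (t + 2)) i < (w ^ (t + 2)) j) := by
  intro h'
  rw [decide_eq_decide] at h h'
  refine not_stuck_of_run (i := (w ^ (t + 1)) i) (j := (w ^ (t + 1)) j)
    (fun he => hij ((w ^ (t + 1)).injective he)) ?_ ?_ ?_ ?_ hs
  · intro he; exact hi (by rw [← sz_pow_apply w (t + 1), sz_eq_one_iff, he])
  · intro he; exact hj (by rw [← sz_pow_apply w (t + 1), sz_eq_one_iff, he])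
  · rw [← Perm.mul_apply, ← Perm.mul_apply, ← pow_succ']; exact h'
  · rw [pow_succ', Perm.mul_apply, Perm.mul_apply, Perm.inv_def, symm_apply_apply,
      symm_apply_apply]
    rw [pow_succ', Perm.mul_apply, Perm.mul_apply] at h
    exact h

/-- If three successive letters of a cycle lie on one side of a fixed letter, the middle one is the
farthest of the three. -/
theorem Stuck.extremal_of_fixed {n : ℕ} {w : Perm (Fin n)} (hs : Stuck w) {i j : Fin n}
    (hi : w i = i) (hj : sz w j ≠ 1) (t : ℕ)
    (h1 : i < (w ^ (t + 1)) j ↔ i < (w ^ (t + 2)) j) (h2 : i < (w ^ (t + 1)) j ↔ i < (w ^ t) j) :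
    ¬ (i < (w ^ (t + 1)) j ↔ (w ^ (t + 1)) j < (w ^ (t + 2)) j) ∧
    ¬ (i < (w ^ (t + 1)) j ↔ (w ^ (t + 1)) j < (w ^ t) j) := by
  have hj' : w ((w ^ (t + 1)) j) ≠ (w ^ (t + 1)) j := by
    intro he; exact hj (by rw [← sz_pow_apply w (t + 1), sz_eq_one_iff, he])
  have e1 : w ((w ^ (t + 1)) j) = (w ^ (t + 2)) j := by
    rw [← Perm.mul_apply, ← pow_succ']
  have e2 : w⁻¹ ((w ^ (t + 1)) j) = (w ^ t) j := by
    rw [pow_succ', Perm.mul_apply, Perm.inv_def, symm_apply_apply]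
  have key := fun h3 => not_stuck_of_fixed hi hj' (by rw [e1]; exact h1) (by rw [e2]; exact h2) h3 hs
  rw [e1, e2] at key
  exact ⟨fun h => key (Or.inl h), fun h => key (Or.inr h)⟩

theorem fixed_pow {n : ℕ} {w : Perm (Fin n)} {i : Fin n} (hi : w i = i) (t : ℕ) :
    (w ^ t) i = i := by
  rw [pow_apply_eq_iterate]; exact Function.iterate_fixed hi t

theorem Stuck.kept_one_three {n : ℕ} {w : Perm (Fin n)} (hs : Stuck w) {i j : Fin n}
    (hi : sz w i = 1) (hj : sz w j = 3) : 3 * kept w 15 i j ≤ 15 := by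
  rw [sz_eq_one_iff] at hi
  have hper : ∀ t, (w ^ (t + 3)) j = (w ^ t) j := fun t => by rw [← hj, pow_add_sz_apply]
  have hj1 : sz w j ≠ 1 := by omega
  rw [kept_eq_card]
  refine card_kept_of_period_three (s := fun t => decide ((w ^ t) i < (w ^ t) j)) ?_ ?_
  · intro t; simp only [fixed_pow hi, hper]
  · intro t h1 h2
    simp only [fixed_pow hi, decide_eq_decide] at h1 h2
    -- The whole `3`-cycle now lies on one side of `i`, and extremality at two neighbouring letters
    -- makes each of them farther from `i` than the other.
    have a1 := (hs.extremal_of_fixed hi hj1 t h2.symm.symm h1.symm).2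
    have a2 := (hs.extremal_of_fixed hi hj1 (t + 2) (by rw [hper t, hper (t + 1)]; exact h1)
      (by rw [hper t]; exact h1.trans h2)).1
    rw [show t + 2 + 1 = t + 3 by ring, show t + 2 + 2 = t + 1 + 3 by ring, hper, hper] at a2
    have hne : (w ^ t) j ≠ (w ^ (t + 1)) j := by
      intro he
      apply hj1
      rw [← sz_pow_apply w t, sz_eq_one_iff, ← Perm.mul_apply, ← pow_succ', he]
    simp only [Fin.lt_def, ne_eq, Fin.ext_iff] at *
    omega

theorem Stuck.kept_one_five {n : ℕ} {w : Perm (Fin n)} (hs : Stuck w) {i j : Fin n}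
    (hi : sz w i = 1) (hj : sz w j = 5) : 5 * kept w 15 i j ≤ 15 := by
  rw [sz_eq_one_iff] at hi
  have hper : ∀ t, (w ^ (t + 5)) j = (w ^ t) j := fun t => by rw [← hj, pow_add_sz_apply]
  have hj1 : sz w j ≠ 1 := by omega
  rw [kept_eq_card]
  refine card_kept_of_period_five (s := fun t => decide ((w ^ t) i < (w ^ t) j)) ?_ ?_
  · intro t; simp only [fixed_pow hi, hper]
  · intro t h1 h2
    simp only [fixed_pow hi, decide_eq_decide] at h1 h2
    have hne : ∀ s, (w ^ s) j ≠ (w ^ (s + 1)) j := by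
      intro s he
      apply hj1
      rw [← sz_pow_apply w s, sz_eq_one_iff, ← Perm.mul_apply, ← pow_succ', he]
    have hnei : ∀ s, (w ^ s) j ≠ i := by
      intro s he
      apply hj1
      rw [← sz_pow_apply w s, he, sz_eq_one_iff, hi]
    have ex := fun s => hs.extremal_of_fixed hi hj1 s
    have run := fun s => hs.no_run (hne 0) (by rwa [sz_pow_apply]) (by rwa [sz_pow_apply]) s
    have es : ∀ s k, (w ^ s) ((w ^ k) j) = (w ^ (s + k)) j := by
      intro s k; rw [pow_add, Perm.mul_apply]
    simp only [es, decide_eq_decide, ne_eq, add_zero] at run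
    have e0 := ex t
    have e1 := ex (t + 1)
    have e4 := ex (t + 4)
    have r1 := run (t + 1)
    have r3 := run (t + 3)
    have n0 := hne t
    have n1 := hne (t + 1)
    have n2 := hne (t + 2)
    have n3 := hne (t + 3)
    have n4 := hne (t + 4)
    have m3 := hnei (t + 3)
    have m4 := hnei (t + 4)
    have p0 := hper t
    have p1 := hper (t + 1)
    clear ex run es hne hnei hper
    simp only [zero_add, add_assoc, Nat.reduceAdd] at *
    simp only [p0, p1] at *
    -- Suppose `x0`, `x1`, `x2` lie above `i`. Then `x1` is the farthest of them, and extremality at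
    -- `x2` and `x0` puts `x3` and `x4` below `i`. From `x1 > x2 > x3` the absence of runs gives `x3
    -- < x4`, and then `x3 < x4 < x0 < x1` is a run. The case below `i` is symmetric.
    generalize (w ^ t) j = x0, (w ^ (t + 1)) j = x1, (w ^ (t + 2)) j = x2, (w ^ (t + 3)) j = x3,
      (w ^ (t + 4)) j = x4 at *
    clear hi hj hj1 p0 p1 hs
    simp only [Fin.lt_def] at *
    omega

end UnitaryClasses

namespace UnitaryClasses
open Equiv

/-! ### A five-cycle and a three-cycle -/

/-- The comparison of `c t` with `d t`, for the list `d 2, d 1, d 0, c 4, …, c 0` of the ranks of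
the letters of a `3`-cycle `d` and a `5`-cycle `c`. -/
def rankLt (r : List ℕ) (t : ℕ) : Bool := Nat.blt (r.getD (7 - t % 5) 0) (r.getD (2 - t % 3) 0)

/-- Three successive comparisons agree. -/
def hasRun (r : List ℕ) : ℕ → Bool → Bool → Bool
  | 0, _, _ => false
  | t + 1, x, y => let z := rankLt r t; (x == y && y == z) || hasRun r t y z

/-- The number of times two successive comparisons agree. -/
def keptCount (r : List ℕ) : ℕ → Bool → ℕ
  | 0, _ => 0
  | t + 1, x => let z := rankLt r t; keptCount r t z + cond (z == x) 1 0

/-- The condition of `up_mul_swap_mul_swap` for the positions `p, q, s` and the values `x, y, z`. -/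
def upTriple (p q s x y z : ℕ) : Bool := (Nat.blt p q == Nat.blt x y) && (Nat.blt q s == Nat.blt x z)

/-- Two letters of the `5`-cycle can be transferred to the `3`-cycle. -/
def hasTransfer (r : List ℕ) : Bool :=
  (List.range 5).any fun t => (List.range 3).any fun s =>
    let d := fun k => r.getD (2 - (s + k) % 3) 0
    let c := fun k => r.getD (7 - (t + k) % 5) 0
    upTriple (d 0) (c 0) (c 2) (d 1) (c 1) (c 3) || upTriple (c 0) (c 2) (d 0) (c 1) (c 3) (d 1) ||
      upTriple (c 2) (d 0) (c 0) (c 3) (d 1) (c 1)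

/-- The first letter of one of the cycles is not its smallest one. -/
def notNormalized : List ℕ → Bool
  | [x, c] => Nat.blt x c
  | [x, _, c] => Nat.blt x c
  | [x, _, _, c] => Nat.blt x c
  | [x, _, _, _, c] => Nat.blt x c
  | [x, d, _, _, _, _, _] => Nat.blt x d
  | [x, _, d, _, _, _, _, _] => Nat.blt x d
  | _ => false

/-- No obstruction arises from the given ranks. -/
def okRanks (r : List ℕ) : Bool :=
  hasRun r 15 (rankLt r 1) (rankLt r 0) || Nat.ble (keptCount r 15 (rankLt r 0)) 3 || hasTransfer r

/-- The finite check on relative orders: either the two cycles attain the bound of `3` in `15`, or a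
run or a transfer of two letters is available. -/
theorem allArrangements_okRanks :
    allArrangements okRanks notNormalized 8 (List.range 8) [] = true := by
  decide +kernel

theorem keptCount_eq (r : List ℕ) (T : ℕ) : keptCount r T (rankLt r T) =
    ((Finset.range T).filter (fun t => rankLt r t = rankLt r (t + 1))).card := by
  induction T with
  | zero => rfl
  | succ T ih =>
    rw [keptCount, ih, Finset.range_add_one, Finset.filter_insert]
    by_cases h : rankLt r T = rankLt r (T + 1)
    · rw [if_pos h, Finset.card_insert_of_notMem (by simp)]
      simp [h]
    · rw [if_neg h]
      have : (rankLt r T == rankLt r (T + 1)) = false := by simpa using h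
      simp [this]

theorem exists_of_hasRun {r : List ℕ} {T : ℕ}
    (h : hasRun r T (rankLt r (T + 1)) (rankLt r T) = true) :
    ∃ t, rankLt r t = rankLt r (t + 1) ∧ rankLt r (t + 1) = rankLt r (t + 2) := by
  induction T with
  | zero => simp [hasRun] at h
  | succ T ih =>
    simp only [hasRun, Bool.or_eq_true, Bool.and_eq_true, beq_iff_eq] at h
    rcases h with h | h
    · exact ⟨T, h.2.symm, h.1.symm⟩
    · exact ih h

/-- Over a full period the count does not depend on the starting time. -/
theorem kept_pow {n : ℕ} {w : Perm (Fin n)} {T : ℕ} (hw : w ^ T = 1) (s : ℕ) (i j : Fin n) :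
    kept w T ((w ^ s) i) ((w ^ s) j) = kept w T i j := by
  induction s with
  | zero => rfl
  | succ s ih =>
    rw [← ih, pow_succ', Perm.mul_apply, Perm.mul_apply]
    generalize (w ^ s) i = a, (w ^ s) j = b
    have e : ∀ t x, (w ^ t) (w x) = (w ^ (t + 1)) x := fun t x => by
      rw [pow_succ, Perm.mul_apply]
    simp only [kept, e, Finset.card_filter]
    have h1 := Finset.sum_range_succ (fun t =>
      if ((w ^ t) a < (w ^ t) b ↔ (w ^ (t + 1)) a < (w ^ (t + 1)) b) then 1 else 0) T
    rw [Finset.sum_range_succ'] at h1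
    have h2 : w ^ (T + 1) = w ^ (0 + 1) := by rw [pow_succ, hw, one_mul, zero_add, pow_one]
    simp only [h2, hw, pow_zero] at h1
    exact add_right_cancel h1

/-- Multiplication by the `3`-cycle on `j`, `i`, `w² i` inserts `w i` and `w² i` behind `j`. The
cycle sizes `5` and `3` are exchanged, so the class is unchanged. The three alternatives are the
three factorizations of the `3`-cycle into two steps up. -/
theorem not_stuck_of_transfer {n : ℕ} {w : Perm (Fin n)} {i j : Fin n} (hi : sz w i = 5)
    (hj : sz w j = 3)
    (h : ((j < i ↔ w j < w i) ∧ (i < (w ^ 2) i ↔ w j < (w ^ 3) i)) ∨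
      ((i < (w ^ 2) i ↔ w i < (w ^ 3) i) ∧ ((w ^ 2) i < j ↔ w i < w j)) ∨
      (((w ^ 2) i < j ↔ (w ^ 3) i < w j) ∧ (j < i ↔ (w ^ 3) i < w i))) : ¬ Stuck w := by
  have hl := nodup_orbitList_append (pow_apply_ne_of_sz_ne (w := w) (i := i) (j := j) (by omega))
  rw [hi, hj] at hl
  have hv : Function.Injective ![(w ^ 0) i, (w ^ 1) i, (w ^ 2) i, (w ^ 3) i, (w ^ 4) i, (w ^ 0) j,
      (w ^ 1) j, (w ^ 2) j] := by
    rw [← List.nodup_ofFn]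
    exact hl
  let v : Fin 8 ↪ Fin n := ⟨_, hv⟩
  have h5 : (w ^ 5) i = (w ^ 0) i := by
    have := pow_add_sz_apply w 0 i; rwa [hi] at this
  have h3 : (w ^ 3) j = (w ^ 0) j := by
    have := pow_add_sz_apply w 0 j; rwa [hj] at this
  have hw : ∀ l, w (v l) = v ((swap 0 1 * swap 1 2 * swap 2 3 * swap 3 4 *
      (swap 5 6 * swap 6 7) : Perm (Fin 8)) l) := by
    have e : ∀ t x, w ((w ^ t) x) = (w ^ (t + 1)) x := fun t x => by rw [pow_succ', Perm.mul_apply]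
    intro l
    fin_cases l
    · exact e 0 i
    · exact e 1 i
    · exact e 2 i
    · exact e 3 i
    · exact (e 4 i).trans h5
    · exact e 0 j
    · exact e 1 j
    · exact (e 2 j).trans h3
  have hconj : IsConj w (w * (swap j i * swap i ((w ^ 2) i))) := by
    -- The new cycles on the labels are `(5 1 2 6 7)` and `(0 3 4)`, and `g` carries the old ones to
    -- them.
    have := isConj_mul_lift v (σ := swap 5 0 * swap 0 2)
      (g := swap 0 5 * swap 3 6 * swap 4 7) hw (by decide)
    rw [map_mul, lift_swap, lift_swap] at this
    exact this
  have hij : j ≠ i := fun he => absurd (hv.eq_iff (a := 5) (b := 0) |>.1 he) (by decide)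
  have hi2 : i ≠ (w ^ 2) i := fun he => absurd (hv.eq_iff (a := 0) (b := 2) |>.1 he) (by decide)
  have hj2 : j ≠ (w ^ 2) i := fun he => absurd (hv.eq_iff (a := 5) (b := 2) |>.1 he) (by decide)
  have e3 : w ((w ^ 2) i) = (w ^ 3) i := by rw [← Perm.mul_apply, ← pow_succ']
  rcases h with h | h | h
  · obtain ⟨u1, u2⟩ := up_mul_swap_mul_swap hij hi2 hj2 h.1 (by rw [e3]; exact h.2)
    rw [mul_assoc] at u2
    exact not_stuck_of_steps u1 u2 hconj
  · obtain ⟨u1, u2⟩ := up_mul_swap_mul_swap hi2 hj2.symm hij.symm (by rw [e3]; exact h.1) h.2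
    rw [mul_assoc, swap_mul_swap_rotate hij hj2] at u2
    exact not_stuck_of_steps u1 u2 hconj
  · obtain ⟨u1, u2⟩ := up_mul_swap_mul_swap hj2.symm hij hi2.symm (by rw [e3]; exact h.1)
      (by rw [e3]; exact h.2)
    rw [mul_assoc, swap_mul_swap_rotate hi2 hij.symm, swap_mul_swap_rotate hij hj2] at u2
    exact not_stuck_of_steps u1 u2 hconj

theorem upTriple_iff {p q s x y z : ℕ} :
    upTriple p q s x y z = true ↔ (p < q ↔ x < y) ∧ (q < s ↔ x < z) := by
  have e : ∀ a b c d : ℕ, (Nat.blt a b == Nat.blt c d) = true ↔ (a < b ↔ c < d) := by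
    intro a b c d
    rw [beq_iff_eq, Bool.eq_iff_iff, Nat.blt_eq, Nat.blt_eq]
  rw [upTriple, Bool.and_eq_true, e, e]

theorem exists_min_pow {n : ℕ} (w : Perm (Fin n)) (i : Fin n) :
    ∃ a, ∀ t, (w ^ a) i ≤ (w ^ t) i := by
  obtain ⟨a, -, ha⟩ := Finset.exists_min_image (Finset.range (sz w i)) (fun t => (w ^ t) i)
    ⟨0, Finset.mem_range.2 (sz_pos w i)⟩
  refine ⟨a, fun t => ?_⟩
  rw [← pow_mod_sz w i t]
  exact ha _ (Finset.mem_range.2 (Nat.mod_lt _ (sz_pos w i)))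

theorem Stuck.kept_five_three {n : ℕ} {w : Perm (Fin n)} (hs : Stuck w) (hw : w ^ 15 = 1)
    {i j : Fin n} (hi : sz w i = 5) (hj : sz w j = 3) : 5 * kept w 15 i j ≤ 15 := by
  obtain ⟨a, ha⟩ := exists_min_pow w i
  obtain ⟨b, hb⟩ := exists_min_pow w j
  -- The sizes are coprime, so at some common time both cycles are at their smallest letters.
  -- Starting there normalizes the arrangements to be enumerated.
  obtain ⟨m, hm5, hm3⟩ := Nat.chineseRemainder (by decide : Nat.Coprime 5 3) a b
  have ea : (w ^ m) i = (w ^ a) i := by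
    rw [← pow_mod_sz w i m, hi, hm5, ← hi, pow_mod_sz]
  have eb : (w ^ m) j = (w ^ b) j := by
    rw [← pow_mod_sz w j m, hj, hm3, ← hj, pow_mod_sz]
  rw [← kept_pow hw m i j, ea, eb]
  have hi' : sz w ((w ^ a) i) = 5 := by rw [sz_pow_apply, hi]
  have hj' : sz w ((w ^ b) j) = 3 := by rw [sz_pow_apply, hj]
  have ha' : ∀ t, (w ^ a) i ≤ (w ^ t) ((w ^ a) i) := fun t => by
    rw [← Perm.mul_apply, ← pow_add]; exact ha _
  have hb' : ∀ t, (w ^ b) j ≤ (w ^ t) ((w ^ b) j) := fun t => by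
    rw [← Perm.mul_apply, ← pow_add]; exact hb _
  clear ea eb hm5 hm3 m
  generalize (w ^ a) i = i at *
  generalize (w ^ b) j = j at *
  clear hi hj ha hb a b
  -- The list is reversed because `allArrangements` fills it from the end: the first letter of the
  -- `5`-cycle is chosen first, and arrangements that are not normalized are discarded early.
  have hl := List.nodup_reverse.2
    (nodup_orbitList_append (pow_apply_ne_of_sz_ne (w := w) (i := i) (j := j) (by omega)))
  rw [hi', hj'] at hl
  set l := (orbitList w i 5 ++ orbitList w j 3).reverse with hldef
  have hci : ∀ t, (w ^ t) i ∈ l := by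
    intro t
    rw [hldef, List.mem_reverse, List.mem_append]
    left
    rw [← pow_mod_sz, hi']
    exact List.mem_map.2 ⟨t % 5, List.mem_range.2 (Nat.mod_lt _ (by omega)), rfl⟩
  have hdj : ∀ t, (w ^ t) j ∈ l := by
    intro t
    rw [hldef, List.mem_reverse, List.mem_append]
    right
    rw [← pow_mod_sz, hj']
    exact List.mem_map.2 ⟨t % 3, List.mem_range.2 (Nat.mod_lt _ (by omega)), rfl⟩
  have hlen : l.length = 8 := rfl
  have hle : l = [(w ^ 2) j, (w ^ 1) j, (w ^ 0) j, (w ^ 4) i, (w ^ 3) i, (w ^ 2) i, (w ^ 1) i,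
    (w ^ 0) i] := rfl
  clear_value l
  set r := l.map (rank l) with hr
  have hre : r = [rank l ((w ^ 2) j), rank l ((w ^ 1) j), rank l ((w ^ 0) j), rank l ((w ^ 4) i),
      rank l ((w ^ 3) i), rank l ((w ^ 2) i), rank l ((w ^ 1) i), rank l ((w ^ 0) i)] := by
    rw [hr]; nth_rw 2 [hle]; rfl
  have hbi : ∀ t, Nat.blt (rank l ((w ^ t) i)) (rank l ((w ^ 0) i)) = false := by
    intro t
    rw [← Bool.not_eq_true, Nat.blt_eq, rank_lt_rank (hci t) (hci 0), not_lt]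
    exact ha' t
  have hbj : ∀ t, Nat.blt (rank l ((w ^ t) j)) (rank l ((w ^ 0) j)) = false := by
    intro t
    rw [← Bool.not_eq_true, Nat.blt_eq, rank_lt_rank (hdj t) (hdj 0), not_lt]
    exact hb' t
  have htest := test_map_rank (P := okRanks) hl hlen allArrangements_okRanks (by
    intro m
    rw [← hr, hre]
    rcases m with _ | _ | _ | _ | _ | _ | _ | _ | m
    · exact hbj 2
    · exact hbj 1
    · rfl
    · exact hbi 4
    · exact hbi 3
    · exact hbi 2
    · exact hbi 1
    · rfl
    · simp only [List.drop_succ_cons, List.drop_nil]; rfl)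
  rw [← hr] at htest
  have hc : ∀ t, r.getD (7 - t % 5) 0 = rank l ((w ^ t) i) := by
    intro t
    rw [← pow_mod_sz w i t, hi', hre]
    have : t % 5 < 5 := Nat.mod_lt _ (by omega)
    generalize t % 5 = k at *
    interval_cases k <;> rfl
  have hd : ∀ t, r.getD (2 - t % 3) 0 = rank l ((w ^ t) j) := by
    intro t
    rw [← pow_mod_sz w j t, hj', hre]
    have : t % 3 < 3 := Nat.mod_lt _ (by omega)
    generalize t % 3 = k at *
    interval_cases k <;> rfl
  have hlt : ∀ t, rankLt r t = decide ((w ^ t) i < (w ^ t) j) := by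
    intro t
    rw [rankLt, hc, hd, Bool.eq_iff_iff, Nat.blt_eq, rank_lt_rank (hci t) (hdj t), decide_eq_true_iff]
  have hij : i ≠ j := by rintro rfl; omega
  simp only [okRanks, Bool.or_eq_true] at htest
  rcases htest with (h | h) | h
  · exfalso
    obtain ⟨t, h1, h2⟩ := exists_of_hasRun (T := 15) h
    rw [hlt, hlt] at h1 h2
    exact hs.no_run hij (by omega) (by omega) t h1 h2
  · have e := keptCount_eq r 15
    have e0 : rankLt r 15 = rankLt r 0 := rfl
    rw [e0] at e
    rw [e, Nat.ble_eq] at h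
    simp only [hlt] at h
    rw [kept_eq_card]
    omega
  · exfalso
    simp only [hasTransfer, List.any_eq_true, List.mem_range, Bool.or_eq_true, upTriple_iff, hc, hd]
      at h
    obtain ⟨t, -, s, -, h⟩ := h
    refine not_stuck_of_transfer (w := w) (i := (w ^ t) i) (j := (w ^ s) j)
      (by rw [sz_pow_apply, hi']) (by rw [sz_pow_apply, hj']) ?_ hs
    have e : ∀ k m x, (w ^ k) ((w ^ m) x) = (w ^ (m + k)) x := by
      intro k m x; rw [← Perm.mul_apply, ← pow_add, add_comm]
    have e' : ∀ m x, w ((w ^ m) x) = (w ^ (m + 1)) x := by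
      intro m x; rw [pow_succ', Perm.mul_apply]
    simp only [rank_lt_rank, hci, hdj, add_zero] at h
    simp only [e, e']
    rw [or_assoc] at h
    exact h

/-- For cycles of size `1`, `3`, `5`, local extremality implies global extremality, as every pair of
letters attains the bound. For two nontrivial cycles of equal size the absence of runs is enough. -/
theorem Stuck.isTop {n : ℕ} {w : Perm (Fin n)} (hs : Stuck w) (hw : w ^ 15 = 1)
    (hsz : ∀ i, sz w i = 1 ∨ sz w i = 3 ∨ sz w i = 5) : IsTop w := by
  refine isTop_of_kept_le (T := 15) (by decide) hw ?_
  have period : ∀ {m i}, sz w i ∣ m → ∀ t, (w ^ (t + m)) i = (w ^ t) i := by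
    intro m i hm t
    rw [← pow_mod_sz w i (t + m), Nat.add_mod, Nat.mod_eq_zero_of_dvd hm, add_zero, Nat.mod_mod,
      pow_mod_sz]
  intro i j hij
  rcases hsz i with hi | hi | hi <;> rcases hsz j with hj | hj | hj <;>
    simp only [hi, hj, Nat.reduceLeDiff, sup_of_le_left, sup_of_le_right, le_refl]
  · rw [one_mul]
    exact (Finset.card_filter_le _ _).trans (by simp)
  · exact hs.kept_one_three hi hj
  · exact hs.kept_one_five hi hj
  · rw [kept_comm w 15 hij]; exact hs.kept_one_three hj hi
  · rw [kept_eq_card]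
    refine card_kept_of_period_three (s := fun t => decide ((w ^ t) i < (w ^ t) j)) ?_ ?_
    · intro t; simp only [period (m := 3) (dvd_of_eq hi), period (m := 3) (dvd_of_eq hj)]
    · exact hs.no_run hij (by omega) (by omega)
  · rw [kept_comm w 15 hij]; exact hs.kept_five_three hw hj hi
  · rw [kept_comm w 15 hij]; exact hs.kept_one_five hj hi
  · exact hs.kept_five_three hw hi hj
  · rw [kept_eq_card]
    refine card_kept_of_period_five (s := fun t => decide ((w ^ t) i < (w ^ t) j)) ?_ ?_
    · intro t; simp only [period (m := 5) (dvd_of_eq hi), period (m := 5) (dvd_of_eq hj)]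
    · exact hs.no_run hij (by omega) (by omega)

end UnitaryClasses

namespace UnitaryClasses
open Equiv

/-! ### Cycle sizes and cycle types -/

theorem pow_apply_eq_self_iff {n : ℕ} {w : Perm (Fin n)} {i : Fin n} {k : ℕ} :
    (w ^ k) i = i ↔ sz w i ∣ k := by
  rw [pow_apply_eq_iterate]
  exact Function.isPeriodicPt_iff_minimalPeriod_dvd

theorem sz_eq_card_support {n : ℕ} {w : Perm (Fin n)} {i : Fin n} (h : w i ≠ i) :
    sz w i = (w.cycleOf i).support.card := by
  have hc := Perm.isCycle_cycleOf w h
  have key : ∀ k, sz w i ∣ k ↔ orderOf (w.cycleOf i) ∣ k := by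
    intro k
    rw [← pow_apply_eq_self_iff, orderOf_dvd_iff_pow_eq_one,
      hc.pow_eq_one_iff' (x := i) (by rwa [Perm.cycleOf_apply_self]), Perm.cycleOf_pow_apply_self]
  rw [← hc.orderOf]
  exact Nat.dvd_antisymm ((key _).2 dvd_rfl) ((key _).1 dvd_rfl)

theorem sz_mem_cycleType {n : ℕ} {w : Perm (Fin n)} {i : Fin n} (h : w i ≠ i) :
    sz w i ∈ w.cycleType := by
  rw [sz_eq_card_support h, Perm.cycleType_def, Multiset.mem_map]
  exact ⟨w.cycleOf i, by
    rw [Finset.mem_val, Perm.cycleOf_mem_cycleFactorsFinset_iff, Perm.mem_support]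
    exact h, rfl⟩

theorem card_sz_eq {n : ℕ} (w : Perm (Fin n)) {m : ℕ} (hm : 2 ≤ m) :
    (Finset.univ.filter fun i => sz w i = m).card = m * w.cycleType.count m := by
  have hne : ∀ i, sz w i = m → w i ≠ i := by
    intro i hi h
    rw [sz_eq_one_iff.2 h] at hi
    omega
  have e : (Finset.univ.filter fun i => sz w i = m) =
      (w.cycleFactorsFinset.filter fun c => c.support.card = m).biUnion Perm.support := by
    ext i
    rw [Finset.mem_filter, Finset.mem_biUnion]
    constructor
    · rintro ⟨-, hi⟩
      have h := hne i hi
      refine ⟨w.cycleOf i, ?_, ?_⟩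
      · rw [Finset.mem_filter, ← sz_eq_card_support h]
        exact ⟨Perm.cycleOf_mem_cycleFactorsFinset_iff.2 (Perm.mem_support.2 h), hi⟩
      · rw [Perm.mem_support, Perm.cycleOf_apply_self]
        exact h
    · rintro ⟨c, hc, hi⟩
      rw [Finset.mem_filter] at hc
      have hcc := Perm.cycle_is_cycleOf hi hc.1
      have h : w i ≠ i := Perm.mem_support.1
        (Perm.mem_cycleFactorsFinset_support_le hc.1 hi)
      exact ⟨Finset.mem_univ _, by rw [sz_eq_card_support h, ← hcc, hc.2]⟩
  rw [e, Finset.card_biUnion]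
  · rw [Finset.sum_congr rfl (g := fun _ => m) (fun c hc => (Finset.mem_filter.1 hc).2),
      Finset.sum_const, smul_eq_mul, mul_comm, Perm.cycleType_def, Multiset.count_map]
    congr 1
    rw [Finset.card_def, Finset.filter_val]
    congr 2
    ext c
    exact eq_comm
  · intro c hc d hd hcd
    exact Perm.disjoint_iff_disjoint_support.1 (Perm.cycleFactorsFinset_pairwise_disjoint w
      (Finset.mem_filter.1 hc).1 (Finset.mem_filter.1 hd).1 hcd)

theorem exists_sz_eq {n : ℕ} {w : Perm (Fin n)} {m : ℕ} (hm : m ∈ w.cycleType) :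
    ∃ i, sz w i = m := by
  have h2 := Perm.two_le_of_mem_cycleType hm
  have h := card_sz_eq w h2
  have : 0 < (Finset.univ.filter fun i => sz w i = m).card := by
    rw [h]
    exact Nat.mul_pos (by omega) (Multiset.count_pos.2 hm)
  obtain ⟨i, hi⟩ := Finset.card_pos.1 this
  exact ⟨i, (Finset.mem_filter.1 hi).2⟩

theorem card_fixed {n : ℕ} (w : Perm (Fin n)) :
    (Finset.univ.filter fun i => w i = i).card + w.cycleType.sum = n := by
  have := Finset.card_filter_add_card_filter_not (s := (Finset.univ : Finset (Fin n)))
    (fun i => w i = i)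
  rw [Finset.card_univ, Fintype.card_fin] at this
  rw [Perm.sum_cycleType]
  convert this using 3
  ext i
  simp

/-- The cycle type of permutations with `e` cycles of length `5` and `f` of length `3`. -/
def fiveThree (e f : ℕ) : Multiset ℕ := Multiset.replicate e 5 + Multiset.replicate f 3

theorem sum_fiveThree (e f : ℕ) : (fiveThree e f).sum = 5 * e + 3 * f := by
  simp [fiveThree, mul_comm]

theorem mem_fiveThree {e f m : ℕ} (h : m ∈ fiveThree e f) : m = 5 ∨ m = 3 := by
  rcases Multiset.mem_add.1 h with h | h
  · exact Or.inl (Multiset.eq_of_mem_replicate h)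
  · exact Or.inr (Multiset.eq_of_mem_replicate h)

theorem sz_of_fiveThree {n e f : ℕ} {w : Perm (Fin n)} (h : w.cycleType = fiveThree e f)
    (i : Fin n) : sz w i = 1 ∨ sz w i = 3 ∨ sz w i = 5 := by
  by_cases hi : w i = i
  · exact Or.inl (sz_eq_one_iff.2 hi)
  · have := sz_mem_cycleType hi
    rw [h] at this
    rcases mem_fiveThree this with h | h <;> omega

theorem pow_eq_one_of_fiveThree {n e f : ℕ} {w : Perm (Fin n)}
    (h : w.cycleType = fiveThree e f) : w ^ 15 = 1 := by
  ext i : 1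
  rw [Perm.one_apply, pow_apply_eq_self_iff]
  rcases sz_of_fiveThree h i with h | h | h <;> rw [h] <;> decide

/-! ### Going up to longer cycles -/

/-- On three fixed letters `w` is increasing, so both factors of the `3`-cycle on them are steps up.
-/
theorem exists_up_add_three {n : ℕ} {w : Perm (Fin n)} (h : w.cycleType.sum + 3 ≤ n) :
    ∃ w', Up w w' ∧ w'.cycleType = w.cycleType + {3} := by
  have hc := card_fixed w
  let v := Finset.orderEmbOfCardLe (Finset.univ.filter fun i => w i = i) (k := 3) (by omega)
  have hw : ∀ l, w (v l) = v l := fun l =>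
    (Finset.mem_filter.1 (Finset.orderEmbOfCardLe_mem (Finset.univ.filter fun i => w i = i)
      (k := 3) (by omega) l)).2
  have h01 : v 0 < v 1 := v.strictMono (by decide)
  have h12 : v 1 < v 2 := v.strictMono (by decide)
  have h02 := h01.trans h12
  obtain ⟨u1, u2⟩ := up_mul_swap_mul_swap (w := w) h01.ne h12.ne h02.ne (by simp only [hw])
    (by simp only [hw, h12, h02])
  refine ⟨_, u1.up.trans u2.up, ?_⟩
  have := cycleType_mul_lift v.toEmbedding (w := w) (π := 1) (swap 0 1 * swap 1 2) (by simpa using hw)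
  rw [map_mul, lift_swap, lift_swap, Perm.cycleType_one, add_zero, one_mul] at this
  rw [mul_assoc]
  refine this.trans ?_
  congr 1


/-- Multiplication by the `3`-cycle on `i`, `j`, `w² j` inserts `w j` and `w² j` behind `i` and
makes `j` fixed; the alternatives are again the three factorizations. -/
theorem exists_up_merge {n : ℕ} {w : Perm (Fin n)} {i j : Fin n} (hi : sz w i = 3)
    (hj : sz w j = 3) (hij : ∀ s t, (w ^ s) i ≠ (w ^ t) j)
    (h : ((i < j ↔ w i < w j) ∧ (j < (w ^ 2) j ↔ w i < j)) ∨
      ((j < (w ^ 2) j ↔ w j < j) ∧ ((w ^ 2) j < i ↔ w j < w i)) ∨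
      (((w ^ 2) j < i ↔ j < w i) ∧ (i < j ↔ j < w j))) :
    ∃ w', Up w w' ∧ w'.cycleType + {3, 3} = w.cycleType + {5} := by
  have hl := nodup_orbitList_append hij
  rw [hi, hj] at hl
  have hv : Function.Injective ![(w ^ 0) i, (w ^ 1) i, (w ^ 2) i, (w ^ 0) j,
      (w ^ 1) j, (w ^ 2) j] := by
    rw [← List.nodup_ofFn]
    exact hl
  let v : Fin 6 ↪ Fin n := ⟨_, hv⟩
  have h3i : (w ^ 3) i = (w ^ 0) i := by
    have := pow_add_sz_apply w 0 i; rwa [hi] at this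
  have h3 : (w ^ 3) j = (w ^ 0) j := by
    have := pow_add_sz_apply w 0 j; rwa [hj] at this
  have hw : ∀ l, w (v l) = v ((swap 0 1 * swap 1 2 * (swap 3 4 * swap 4 5) : Perm (Fin 6)) l) := by
    have e : ∀ t x, w ((w ^ t) x) = (w ^ (t + 1)) x := fun t x => by rw [pow_succ', Perm.mul_apply]
    intro l
    fin_cases l
    · exact e 0 i
    · exact e 1 i
    · exact (e 2 i).trans h3i
    · exact e 0 j
    · exact e 1 j
    · exact (e 2 j).trans h3
  have hct : (w * (swap i j * swap j ((w ^ 2) j))).cycleType + {3, 3} = w.cycleType + {5} := by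
    have := cycleType_mul_lift v (swap 0 3 * swap 3 5) hw
    rw [map_mul, lift_swap, lift_swap] at this
    have e1 : (swap 0 1 * swap 1 2 * (swap 3 4 * swap 4 5) : Perm (Fin 6)).cycleType = {3, 3} := by
      decide
    have e2 : (swap 0 1 * swap 1 2 * (swap 3 4 * swap 4 5) * (swap 0 3 * swap 3 5) :
      Perm (Fin 6)).cycleType = {5} := by
      decide
    rw [e1, e2] at this
    exact this
  have hab : i ≠ j := hij 0 0
  have hbc : j ≠ (w ^ 2) j := fun he => absurd (hv.eq_iff (a := 3) (b := 5) |>.1 he) (by decide)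
  have hac : i ≠ (w ^ 2) j := hij 0 2
  have e3 : w ((w ^ 2) j) = j := by rw [← Perm.mul_apply, ← pow_succ', h3]; rfl
  rcases h with h | h | h
  · obtain ⟨u1, u2⟩ := up_mul_swap_mul_swap hab hbc hac h.1 (by rw [e3]; exact h.2)
    rw [mul_assoc] at u2
    exact ⟨_, u1.up.trans u2.up, hct⟩
  · obtain ⟨u1, u2⟩ := up_mul_swap_mul_swap hbc hac.symm hab.symm (by rw [e3]; exact h.1) h.2
    rw [mul_assoc, swap_mul_swap_rotate hab hac] at u2
    exact ⟨_, u1.up.trans u2.up, hct⟩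
  · obtain ⟨u1, u2⟩ := up_mul_swap_mul_swap hac.symm hab hbc.symm (by rw [e3]; exact h.1)
      (by rw [e3]; exact h.2)
    rw [mul_assoc, swap_mul_swap_rotate hbc hab.symm, swap_mul_swap_rotate hab hac] at u2
    exact ⟨_, u1.up.trans u2.up, hct⟩

/-- Two `3`-cycles can be merged, for the given ranks. -/
def hasMerge (r : List ℕ) : Bool :=
  (List.range 3).any fun s => (List.range 3).any fun t =>
    let c := fun k => r.getD ((s + k) % 3) 0
    let d := fun k => r.getD (3 + (t + k) % 3) 0
    (upTriple (c 0) (d 0) (d 2) (c 1) (d 1) (d 0) || upTriple (d 0) (d 2) (c 0) (d 1) (d 0) (c 1) ||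
      upTriple (d 2) (c 0) (d 0) (d 0) (c 1) (d 1)) ||
    (upTriple (d 0) (c 0) (c 2) (d 1) (c 1) (c 0) || upTriple (c 0) (c 2) (d 0) (c 1) (c 0) (d 1) ||
      upTriple (c 2) (d 0) (c 0) (c 0) (d 1) (c 1))

/-- Whatever the relative order of two `3`-cycles, one of them can absorb two letters of the other;
stuckness plays no role here. -/
theorem allArrangements_hasMerge :
    allArrangements hasMerge (fun _ => false) 6 (List.range 6) [] = true := by
  decide +kernel

theorem exists_up_merge_three {n : ℕ} {w : Perm (Fin n)} {i j : Fin n} (hi : sz w i = 3)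
    (hj : sz w j = 3) (hij : ∀ s t, (w ^ s) i ≠ (w ^ t) j) :
    ∃ w', Up w w' ∧ w'.cycleType + {3, 3} = w.cycleType + {5} := by
  have hl := nodup_orbitList_append hij
  rw [hi, hj] at hl
  set l := orbitList w i 3 ++ orbitList w j 3 with hldef
  have hci : ∀ t, (w ^ t) i ∈ l := by
    intro t
    rw [hldef, List.mem_append]
    left
    rw [← pow_mod_sz, hi]
    exact List.mem_map.2 ⟨t % 3, List.mem_range.2 (Nat.mod_lt _ (by omega)), rfl⟩
  have hdj : ∀ t, (w ^ t) j ∈ l := by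
    intro t
    rw [hldef, List.mem_append]
    right
    rw [← pow_mod_sz, hj]
    exact List.mem_map.2 ⟨t % 3, List.mem_range.2 (Nat.mod_lt _ (by omega)), rfl⟩
  have hlen : l.length = 6 := rfl
  have hle : l = [(w ^ 0) i, (w ^ 1) i, (w ^ 2) i, (w ^ 0) j, (w ^ 1) j, (w ^ 2) j] := rfl
  clear_value l
  have htest := test_map_rank (P := hasMerge) hl hlen allArrangements_hasMerge (fun _ => rfl)
  set r := l.map (rank l) with hr
  have hre : r = [rank l ((w ^ 0) i), rank l ((w ^ 1) i), rank l ((w ^ 2) i),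
      rank l ((w ^ 0) j), rank l ((w ^ 1) j), rank l ((w ^ 2) j)] := by
    rw [hr]; nth_rw 2 [hle]; rfl
  have hc : ∀ t, r.getD (t % 3) 0 = rank l ((w ^ t) i) := by
    intro t
    rw [← pow_mod_sz w i t, hi, hre]
    have : t % 3 < 3 := Nat.mod_lt _ (by omega)
    generalize t % 3 = k at *
    interval_cases k <;> rfl
  have hd : ∀ t, r.getD (3 + t % 3) 0 = rank l ((w ^ t) j) := by
    intro t
    rw [← pow_mod_sz w j t, hj, hre]
    have : t % 3 < 3 := Nat.mod_lt _ (by omega)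
    generalize t % 3 = k at *
    interval_cases k <;> rfl
  simp only [hasMerge, List.any_eq_true, List.mem_range, Bool.or_eq_true, upTriple_iff, hc, hd] at htest
  obtain ⟨s, -, t, -, h⟩ := htest
  have e : ∀ k m x, (w ^ k) ((w ^ m) x) = (w ^ (m + k)) x := by
    intro k m x; rw [← Perm.mul_apply, ← pow_add, add_comm]
  have e' : ∀ m x, w ((w ^ m) x) = (w ^ (m + 1)) x := by
    intro m x; rw [pow_succ', Perm.mul_apply]
  simp only [rank_lt_rank, hci, hdj, add_zero] at h
  rcases h with h | h
  · refine exists_up_merge (i := (w ^ s) i) (j := (w ^ t) j) (by rw [sz_pow_apply, hi])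
      (by rw [sz_pow_apply, hj]) (fun a b => by rw [e, e]; exact hij _ _) ?_
    simp only [e, e']
    rw [or_assoc] at h
    exact h
  · refine exists_up_merge (j := (w ^ s) i) (i := (w ^ t) j) (by rw [sz_pow_apply, hj])
      (by rw [sz_pow_apply, hi]) (fun a b => by rw [e, e]; exact (hij _ _).symm) ?_
    simp only [e, e']
    rw [or_assoc] at h
    exact h

theorem exists_up_add_five {n e f : ℕ} {w : Perm (Fin n)} (h : w.cycleType = fiveThree e (f + 2)) :
    ∃ w', Up w w' ∧ w'.cycleType = fiveThree (e + 1) f := by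
  have hcard := card_sz_eq w (m := 3) (by omega)
  have hcount : w.cycleType.count 3 = f + 2 := by
    rw [h, fiveThree, Multiset.count_add, Multiset.count_replicate, Multiset.count_replicate]
    simp
  rw [hcount] at hcard
  obtain ⟨i, hi⟩ := (Finset.card_pos (s := Finset.univ.filter fun i => sz w i = 3)).1 (by omega)
  -- At least six letters lie in `3`-cycles, so one of them is outside the cycle of `i`.
  obtain ⟨j, hj, hij⟩ := Finset.exists_mem_notMem_of_card_lt_card
    (s := (orbitList w i 3).toFinset) (t := Finset.univ.filter fun i => sz w i = 3) (by
      have : (orbitList w i 3).toFinset.card ≤ 3 := (List.toFinset_card_le _).trans (by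
        simp [orbitList])
      omega)
  rw [Finset.mem_filter] at hi hj
  obtain ⟨w', hu, hw'⟩ := exists_up_merge_three hi.2 hj.2 (by
    intro s t hst
    apply hij
    -- On a cycle of size three, `w ^ (2 * t)` is inverse to `w ^ t`.
    have key : j = (w ^ (s + 2 * t)) i := by
      rw [add_comm, pow_add, Perm.mul_apply, hst, ← Perm.mul_apply, ← pow_add]
      symm
      rw [pow_apply_eq_self_iff, hj.2]
      omega
    rw [List.mem_toFinset, key, ← pow_mod_sz, hi.2]
    exact List.mem_map.2 ⟨_, List.mem_range.2 (Nat.mod_lt _ (by omega)), rfl⟩)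
  refine ⟨w', hu, ?_⟩
  rw [h] at hw'
  have e2 : fiveThree e (f + 2) + {5} = fiveThree (e + 1) f + {3, 3} := by
    simp only [fiveThree, Multiset.replicate_add, Multiset.replicate_one]
    have : (Multiset.replicate 2 3 : Multiset ℕ) = {3, 3} := rfl
    rw [this]
    abel
  rw [e2] at hw'
  exact add_right_cancel hw'

/-- With `k = E - e`, first `3`-cycles are added until there are `F + 2 * k` of them, and then `k`
pairs are merged. The intermediate type uses `5 * e + 3 * F + 6 * k` letters, which is at most `6 *
E + 3 * F`. -/
theorem exists_up_fiveThree {n e f E F : ℕ} {w : Perm (Fin n)} (h : w.cycleType = fiveThree e f)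
    (he : e ≤ E) (hf : f + 2 * e ≤ F + 2 * E) (hn : 6 * E + 3 * F ≤ n) :
    ∃ w', Up w w' ∧ w'.cycleType = fiveThree E F := by
  obtain ⟨k, rfl⟩ := Nat.exists_eq_add_of_le he
  have add : ∀ m f' (v : Perm (Fin n)), v.cycleType = fiveThree e f' →
      f' + m + 2 * e = F + 2 * (e + k) → ∃ v', Up v v' ∧ v'.cycleType = fiveThree e (F + 2 * k) := by
    intro m
    induction m with
    | zero =>
      intro f' v hv hm
      refine ⟨v, Relation.ReflTransGen.refl, ?_⟩
      rw [hv]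
      congr 1
      omega
    | succ m ih =>
      intro f' v hv hm
      obtain ⟨v₁, hu, hv₁⟩ := exists_up_add_three (w := v) (by
        rw [hv, sum_fiveThree]
        omega)
      obtain ⟨v₂, hu₂, hv₂⟩ := ih (f' + 1) v₁ (by
        rw [hv₁, hv, fiveThree, fiveThree, Multiset.replicate_add, Multiset.replicate_one, add_assoc])
        (by omega)
      exact ⟨v₂, hu.trans hu₂, hv₂⟩
  obtain ⟨v, hu, hv⟩ := add (F + 2 * k - f) f w h (by omega)
  clear add
  have merge : ∀ m e' (u : Perm (Fin n)), u.cycleType = fiveThree e' (F + 2 * m) →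
      ∃ u', Up u u' ∧ u'.cycleType = fiveThree (e' + m) F := by
    intro m
    induction m with
    | zero => intro e' u hu; exact ⟨u, Relation.ReflTransGen.refl, hu⟩
    | succ m ih =>
      intro e' u hu
      obtain ⟨u₁, h₁, h₁'⟩ := exists_up_add_five (f := F + 2 * m) (w := u) hu
      obtain ⟨u₂, h₂, h₂'⟩ := ih (e' + 1) u₁ h₁'
      refine ⟨u₂, h₁.trans h₂, ?_⟩
      rw [h₂']
      congr 1
      omega
  obtain ⟨v', hu', hv'⟩ := merge k e v hv
  exact ⟨v', hu.trans hu', hv'⟩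

/-- After the required cycle type has been reached, one continues up inside its class until stuck,
and stuck elements are top. -/
theorem classLE_of_fiveThree {n e f E F : ℕ} {y y' : Perm (Fin n)}
    (h : y.cycleType = fiveThree e f) (h' : y'.cycleType = fiveThree E F)
    (he : e ≤ E) (hf : f + 2 * e ≤ F + 2 * E) (hn : 6 * E + 3 * F ≤ n) :
    ClassLE (fClass (y' * w₀ n)) (fClass (y * w₀ n)) := by
  rw [classLE_iff]
  intro z hz _
  obtain ⟨v, hu, hv⟩ := exists_up_fiveThree ((Perm.isConj_iff_cycleType_eq.1 hz).symm.trans h) he hf hn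
  obtain ⟨v', hu', hc, hs⟩ := exists_up_stuck v
  have hv' : v'.cycleType = fiveThree E F := (Perm.isConj_iff_cycleType_eq.1 hc).symm.trans hv
  exact ⟨v', Perm.isConj_iff_cycleType_eq.2 (h'.trans hv'.symm),
    hs.isTop (pow_eq_one_of_fiveThree hv') (sz_of_fiveThree hv'), hu.trans hu'⟩

end UnitaryClasses

namespace UnitaryClasses
open Equiv

/-! ### Kim's elements -/

/-- The position of a letter in the sequence `0, n - 1, 1, n - 2, …`. -/
def pos {n : ℕ} (x : Fin n) : ℕ := if 2 * (x : ℕ) < n then 2 * x else 2 * (n - 1 - x) + 1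

theorem pos_lt {n : ℕ} (x : Fin n) : pos x < n := by
  have := x.2
  unfold pos
  split_ifs <;> omega

theorem pos_injective (n : ℕ) : Function.Injective (pos (n := n)) := by
  intro x y h
  have := x.2
  have := y.2
  unfold pos at h
  ext
  split_ifs at h <;> omega

theorem exists_pos_eq {n p : ℕ} (hp : p < n) : ∃ x : Fin n, pos x = p := by
  rcases Nat.even_or_odd' p with ⟨k, rfl | rfl⟩
  · refine ⟨⟨k, by omega⟩, ?_⟩
    simp only [pos]
    rw [if_pos hp]
  · refine ⟨⟨n - 1 - k, by omega⟩, ?_⟩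
    simp only [pos]
    split_ifs <;> omega

/-- The sequence removes the letters of the interval alternately from the left and from the right,
so the earlier of two letters is an end point of an interval that contains the other. -/
theorem lt_iff_even_pos {n : ℕ} {x y : Fin n} (h : pos x < pos y) : x < y ↔ pos x % 2 = 0 := by
  have := x.2
  have := y.2
  rw [Fin.lt_def]
  unfold pos at *
  split_ifs at * <;> omega

/-! ### Kim's elements rotate blocks of consecutive positions -/

theorem formPerm_map {α : Type*} [DecidableEq α] (g : Perm α) (L : List α) :
    (L.map g).formPerm = g * L.formPerm * g⁻¹ := by
  induction L with
  | nil => simp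
  | cons x L ih =>
    cases L with
    | nil => simp
    | cons y L =>
      rw [List.map_cons, List.map_cons, List.formPerm_cons_cons, ← List.map_cons, ih,
        List.formPerm_cons_cons, swap_apply_apply]
      simp only [mul_assoc, inv_mul_cancel_left]

theorem frob_iterate_formPerm {n : ℕ} (c : ℕ) (L : List (Fin n)) :
    frob^[c] L.formPerm = (L.map (w₀ n ^ c)).formPerm := by
  induction c with
  | zero => simp
  | succ c ih =>
    rw [Function.iterate_succ_apply', ih, frob, pow_succ']
    rw [Perm.coe_mul, ← List.map_map, formPerm_map (w₀ n), w₀_inv]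

theorem map_filterMap_eq {α β γ : Type*} {f : α → Option β} {g : β → γ} {h : α → γ} {l : List α}
    (H : ∀ k ∈ l, ∃ x, f k = some x ∧ g x = h k) : (l.filterMap f).map g = l.map h := by
  induction l with
  | nil => rfl
  | cons a l ih =>
    obtain ⟨x, hx, hg⟩ := H a (by simp)
    rw [List.filterMap_cons_some hx, List.map_cons, List.map_cons, hg,
      ih fun k hk => H k (by simp [hk])]

theorem w₀_pow_apply {n : ℕ} (c : ℕ) (x : Fin n) :
    (((w₀ n ^ c) x : Fin n) : ℕ) = if c % 2 = 0 then (x : ℕ) else n - 1 - x := by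
  have hx := x.2
  induction c with
  | zero => simp
  | succ c ih =>
    rw [pow_succ', Perm.mul_apply, w₀, Fin.revPerm_apply, Fin.val_rev, ← w₀, ih]
    split_ifs <;> omega

/-- After an odd number `s` of letters the sequence continues at the right end, while `zigzag`
always starts at the left; the twist by `frob` repairs this. The numbers `c` and `s` have the same
parity because the parts are odd. -/
theorem exists_frob_iterate_zigzag {n s r c : ℕ} (h : s + r ≤ n) (hc : c % 2 = s % 2) :
    ∃ L : List (Fin n), L.Nodup ∧ L.map pos = (List.range r).map (s + ·) ∧
      frob^[c] (zigzag n s r).formPerm = L.formPerm := by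
  have key : ((zigzag n s r).map (w₀ n ^ c)).map pos = (List.range r).map (s + ·) := by
    rw [List.map_map, zigzag]
    refine map_filterMap_eq ?_
    intro k hk
    rw [List.mem_range] at hk
    set p : ℕ := if Even k then s / 2 + k / 2 else n - 1 - (s + 1) / 2 - k / 2 with hp
    have hpn : p < n := by rw [hp]; split_ifs <;> omega
    refine ⟨⟨p, hpn⟩, by rw [dif_pos hpn], ?_⟩
    rw [Function.comp_apply, pos, w₀_pow_apply]
    simp only
    simp only [Nat.even_iff] at hp
    split_ifs at * <;> omega
  refine ⟨_, ?_, key, frob_iterate_formPerm c _⟩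
  refine List.Nodup.of_map pos ?_
  rw [key]
  exact List.nodup_range.map (fun a b h => Nat.add_left_cancel h)

/-- The positions, after one step, of the letters in blocks of sizes `l` starting at `s`. -/
def next : ℕ → List ℕ → ℕ → ℕ
  | _, [], p => p
  | s, r :: l, p => if s ≤ p ∧ p < s + r then s + (p - s + 1) % r else next (s + r) l p

theorem next_of_lt {s p : ℕ} (l : List ℕ) (h : p < s) : next s l p = p := by
  induction l generalizing s with
  | nil => rfl
  | cons r l ih =>
    rw [next, if_neg (by omega), ih (by omega)]

theorem next_eq {s r : ℕ} (l₁ l₂ : List ℕ) {a : ℕ} (ha : a < r) :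
    next s (l₁ ++ r :: l₂) (s + l₁.sum + a) = s + l₁.sum + (a + 1) % r := by
  induction l₁ generalizing s with
  | nil =>
    rw [List.nil_append, next, if_pos (by simp [ha])]
    simp
  | cons b l ih =>
    rw [List.cons_append, next, if_neg (by simp; omega), List.sum_cons, ← add_assoc]
    exact ih

theorem pos_formPerm {n s r : ℕ} {L : List (Fin n)} (hL : L.Nodup)
    (h : L.map pos = (List.range r).map (s + ·)) (x : Fin n) :
    pos (L.formPerm x) = if s ≤ pos x ∧ pos x < s + r then s + (pos x - s + 1) % r else pos x := by
  have hlen : L.length = r := by simpa using congrArg List.length h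
  have hget : ∀ k (hk : k < L.length), pos L[k] = s + k := by
    intro k hk
    have : (L.map pos)[k]'(by simpa using hk) = s + k := by
      simp only [h, List.getElem_map, List.getElem_range]
    simpa using this
  split_ifs with hx
  · have hk : pos x - s < L.length := by omega
    have e : x = L[pos x - s] := pos_injective n (by rw [hget]; omega)
    conv_lhs => rw [e]
    rw [List.formPerm_apply_getElem _ hL, hget, hlen]
  · rw [List.formPerm_apply_of_notMem]
    intro hm
    obtain ⟨k, hk, rfl⟩ := List.getElem_of_mem hm
    rw [hget] at hx
    omega

theorem pos_sigmaAux {n s c : ℕ} {l : List ℕ} (hl : ∀ r ∈ l, Odd r) (h : s + l.sum ≤ n)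
    (hc : c % 2 = s % 2) (x : Fin n) : pos (sigmaAux n s c l x) = next s l (pos x) := by
  induction l generalizing s c with
  | nil => rfl
  | cons r l ih =>
    rw [List.sum_cons] at h
    obtain ⟨L, hL, hL', e⟩ := exists_frob_iterate_zigzag (n := n) (s := s) (r := r) (by omega) hc
    have hr := Nat.odd_iff.1 (hl r (by simp))
    have ih' := ih (s := s + r) (c := c + 1) (fun a ha => hl a (by simp [ha])) (by omega) (by omega)
    rw [sigmaAux, e, Perm.mul_apply, pos_formPerm hL hL', ih', next]
    by_cases hx : pos x < s + r
    · rw [next_of_lt l hx]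
    · rw [if_neg (c := s ≤ pos x ∧ _) (by omega), if_neg]
      -- The later factors keep a position within the later blocks, so the factor of the current
      -- block does not move it.
      have : s + r ≤ next (s + r) l (pos x) := by
        clear ih ih' hc h hl e hL'
        generalize s + r = s at *
        induction l generalizing s with
        | nil => simpa [next] using hx
        | cons b l ih =>
          rw [next]
          split_ifs
          · omega
          · exact le_trans (by omega) (ih (s + b) (by omega))
      omega

theorem cycleType_sigmaAux {n s c : ℕ} {l : List ℕ} (hl : ∀ r ∈ l, Odd r) (h : s + l.sum ≤ n)
    (hc : c % 2 = s % 2) :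
    (sigmaAux n s c l).cycleType = (l : Multiset ℕ).filter (1 < ·) := by
  induction l generalizing s c with
  | nil => simp [sigmaAux]
  | cons r l ih =>
    rw [List.sum_cons] at h
    obtain ⟨L, hL, hL', e⟩ := exists_frob_iterate_zigzag (n := n) (s := s) (r := r) (by omega) hc
    have hr := Nat.odd_iff.1 (hl r (by simp))
    have hlen : L.length = r := by simpa using congrArg List.length hL'
    have hl' : ∀ a ∈ l, Odd a := fun a ha => hl a (by simp [ha])
    have ih' := ih (s := s + r) (c := c + 1) hl' (by omega) (by omega)
    have hd : Perm.Disjoint (L.formPerm) (sigmaAux n (s + r) (c + 1) l) := by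
      intro x
      by_cases hx : pos x < s + r
      · right
        apply pos_injective n
        rw [pos_sigmaAux hl' (by omega) (by omega), next_of_lt l hx]
      · left
        apply pos_injective n
        rw [pos_formPerm hL hL', if_neg (by omega)]
    rw [sigmaAux, e, hd.cycleType_mul, ih', ← Multiset.cons_coe]
    by_cases h1 : 1 < r
    · rw [Multiset.filter_cons_of_pos _ h1, (List.isCycle_formPerm hL (by omega)).cycleType,
        List.support_formPerm_of_nodup _ hL (by rintro x rfl; simp at hlen; omega),
        List.toFinset_card_of_nodup hL, hlen, Multiset.singleton_add]
    · obtain rfl : r = 1 := by omega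
      obtain ⟨x, rfl⟩ := List.length_eq_one_iff.1 hlen
      simp

theorem exists_block {l : List ℕ} {p : ℕ} (h : p < l.sum) :
    ∃ l₁ r l₂ a, l = l₁ ++ r :: l₂ ∧ p = l₁.sum + a ∧ a < r := by
  induction l generalizing p with
  | nil => simp at h
  | cons b l ih =>
    by_cases hp : p < b
    · exact ⟨[], b, l, p, rfl, by simp, hp⟩
    · rw [List.sum_cons] at h
      obtain ⟨l₁, r, l₂, a, rfl, ha, har⟩ := ih (p := p - b) (by omega)
      exact ⟨b :: l₁, r, l₂, a, rfl, by rw [List.sum_cons]; omega, har⟩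

/-- A position lies in the same block as a smaller one, or in a later block. -/
theorem exists_block_pair {l : List ℕ} {p q : ℕ} (hpq : p < q) (h : q < l.sum) :
    ∃ l₁ r l₂ a, l = l₁ ++ r :: l₂ ∧ p = l₁.sum + a ∧ a < r ∧
      ((∃ b, q = l₁.sum + b ∧ b < r) ∨
        ∃ l₃ r' l₄ b, l₂ = l₃ ++ r' :: l₄ ∧ q = (l₁ ++ r :: l₃).sum + b ∧ b < r') := by
  obtain ⟨l₁, r, l₂, a, rfl, ha, har⟩ := exists_block (hpq.trans h)
  refine ⟨l₁, r, l₂, a, rfl, ha, har, ?_⟩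
  by_cases hq : q < l₁.sum + r
  · exact Or.inl ⟨q - l₁.sum, by omega, by omega⟩
  · right
    rw [List.sum_append, List.sum_cons] at h
    obtain ⟨l₃, r', l₄, b, rfl, hb, hbr⟩ := exists_block (l := l₂) (p := q - l₁.sum - r) (by omega)
    exact ⟨l₃, r', l₄, b, rfl, by rw [List.sum_append, List.sum_cons]; omega, hbr⟩

section Sigma
variable {n : ℕ} {l : List ℕ} (hl : ∀ r ∈ l, Odd r) (h : l.sum = n)
include hl h

theorem pos_sigma (x : Fin n) : pos (sigma n l x) = next 0 l (pos x) :=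
  pos_sigmaAux hl (by omega) rfl x

theorem cycleType_sigma : (sigma n l).cycleType = (l : Multiset ℕ).filter (1 < ·) :=
  cycleType_sigmaAux hl (by omega) rfl

theorem pos_sigma_pow {l₁ l₂ : List ℕ} {r a : ℕ} (e : l = l₁ ++ r :: l₂) (ha : a < r) {x : Fin n}
    (hx : pos x = l₁.sum + a) (t : ℕ) : pos ((sigma n l ^ t) x) = l₁.sum + (a + t) % r := by
  induction t with
  | zero => rw [pow_zero, Perm.one_apply, hx, add_zero, Nat.mod_eq_of_lt ha]
  | succ t ih =>
    have := next_eq (s := 0) l₁ l₂ (a := (a + t) % r) (Nat.mod_lt _ (by omega))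
    rw [pow_succ', Perm.mul_apply, pos_sigma hl h, ih, e]
    rw [zero_add] at this
    rw [this, Nat.mod_add_mod, add_assoc]

theorem sz_sigma {l₁ l₂ : List ℕ} {r a : ℕ} (e : l = l₁ ++ r :: l₂) (ha : a < r) {x : Fin n}
    (hx : pos x = l₁.sum + a) : sz (sigma n l) x = r := by
  have key : ∀ k, sz (sigma n l) x ∣ k ↔ r ∣ k := by
    intro k
    rw [← pow_apply_eq_self_iff, ← (pos_injective n).eq_iff, pos_sigma_pow hl h e ha hx, hx,
      add_right_inj, ← Nat.add_modEq_left_iff (n := r) (a := a), Nat.ModEq,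
      Nat.mod_eq_of_lt ha]
  exact Nat.dvd_antisymm ((key _).2 dvd_rfl) ((key _).1 dvd_rfl)

end Sigma

/-! ### Kim's elements are top -/

theorem mul_card_le_of_modEq {r T : ℕ} (hr : 0 < r) (hT : r ∣ T) (p : ℕ → Prop) [DecidablePred p]
    (h : ∀ s t, p s → p t → s ≡ t [MOD r]) : r * ((Finset.range T).filter p).card ≤ T := by
  rcases Finset.eq_empty_or_nonempty ((Finset.range T).filter p) with h0 | ⟨s, hs⟩
  · simp [h0]
  · have hs' := (Finset.mem_filter.1 hs).2
    have h1 : ((Finset.range T).filter p).card ≤ Nat.count (· ≡ s [MOD r]) T := by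
      rw [Nat.count_eq_card_filter_range]
      apply Finset.card_le_card
      intro t ht
      rw [Finset.mem_filter] at ht ⊢
      exact ⟨ht.1, h t s ht.2 hs'⟩
    rw [Nat.count_modEq_card _ hr, Nat.mod_eq_zero_of_dvd hT, if_neg (by omega), add_zero] at h1
    calc _ ≤ r * (T / r) := Nat.mul_le_mul_left _ h1
      _ = T := Nat.mul_div_cancel' hT

/-- For letters in different blocks, the order is decided by the parity of the position of the one
in the earlier block. This parity alternates except when the letter returns to the start of its
block, and the earlier block is the larger one because the parts decrease. In a common block, the
order is kept only when one letter returns to the start and the other one has an odd offset. In both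
cases these times form a single residue class modulo the larger size. -/
theorem isTop_sigma {n : ℕ} {l : List ℕ} (hl : ∀ r ∈ l, Odd r) (h : l.sum = n)
    (hs : l.Pairwise (· ≥ ·)) : IsTop (sigma n l) := by
  have hT : Odd l.prod := by
    clear h hs
    induction l with
    | nil => simp
    | cons a l ih =>
      rw [List.prod_cons]
      exact (hl a (by simp)).mul (ih fun r hr => hl r (by simp [hr]))
  refine isTop_of_kept_le hT ?_ ?_
  · ext x : 1
    rw [Perm.one_apply, pow_apply_eq_self_iff]
    obtain ⟨l₁, r, l₂, a, e, hx, ha⟩ := exists_block (l := l) (p := pos x) (h ▸ pos_lt x)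
    rw [sz_sigma hl h e ha hx, e]
    exact List.dvd_prod (by simp)
  · suffices H : ∀ i j : Fin n, pos i < pos j →
        max (sz (sigma n l) i) (sz (sigma n l) j) * kept (sigma n l) l.prod i j ≤ l.prod by
      intro i j hij
      rcases lt_trichotomy (pos i) (pos j) with hlt | heq | hlt
      · exact H i j hlt
      · exact absurd (pos_injective n heq) hij
      · rw [kept_comm _ _ hij, max_comm]
        exact H j i hlt
    intro i j hij
    have hjl : pos j < l.sum := h.symm ▸ pos_lt j
    obtain ⟨l₁, r, l₂, a, e, hi, ha, hj⟩ := exists_block_pair hij hjl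
    have hr : r % 2 = 1 := Nat.odd_iff.1 (hl r (by rw [e]; simp))
    have hdvd : r ∣ l.prod := List.dvd_prod (by rw [e]; simp)
    rw [sz_sigma hl h e ha hi]
    have hmod : ∀ a t, (a + (t + 1)) % r = if (a + t) % r = r - 1 then 0 else (a + t) % r + 1 := by
      intro a t
      have := Nat.mod_lt (a + t) (show 0 < r by omega)
      rw [← add_assoc, ← Nat.mod_add_mod]
      split_ifs with h
      · rw [h, Nat.sub_add_cancel (by omega), Nat.mod_self]
      · exact Nat.mod_eq_of_lt (by omega)
    rcases hj with ⟨b, hj, hb⟩ | ⟨l₃, r', l₄, b, e', hj, hb⟩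
    · rw [sz_sigma hl h e hb hj, max_self]
      refine mul_card_le_of_modEq (by omega) hdvd _ ?_
      have hab : a ≠ b := by omega
      have key : ∀ t, ((sigma n l ^ t) i < (sigma n l ^ t) j ↔
          (sigma n l ^ (t + 1)) i < (sigma n l ^ (t + 1)) j) →
          ((a + t) % r = r - 1 ∧ (b + t) % r % 2 = 1) ∨
          ((b + t) % r = r - 1 ∧ (a + t) % r % 2 = 1) := by
        intro t ht
        have hne : (a + t) % r ≠ (b + t) % r := by
          intro h
          have := Nat.ModEq.add_right_cancel' t h
          rw [Nat.ModEq, Nat.mod_eq_of_lt ha, Nat.mod_eq_of_lt hb] at this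
          exact hab this
        have pi := pos_sigma_pow hl h e ha hi
        have pj := pos_sigma_pow hl h e hb hj
        have lt' : ∀ {x y : Fin n}, pos x < pos y → (y < x ↔ pos x % 2 = 1) := by
          intro x y hxy
          have h1 := lt_iff_even_pos hxy
          have h2 : x ≠ y := by rintro rfl; omega
          rw [← not_iff_not, not_lt, le_iff_lt_or_eq, h1]
          simp only [h2, or_false]
          omega
        have order : ∀ t, ((sigma n l ^ t) i < (sigma n l ^ t) j ↔
            ((a + t) % r < (b + t) % r ∧ (l₁.sum + (a + t) % r) % 2 = 0) ∨
            ((b + t) % r < (a + t) % r ∧ (l₁.sum + (b + t) % r) % 2 = 1)) := by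
          intro t
          rcases lt_trichotomy (pos ((sigma n l ^ t) i)) (pos ((sigma n l ^ t) j)) with hlt | heq | hlt
          · rw [lt_iff_even_pos hlt, pi]
            rw [pi, pj] at hlt
            omega
          · have := (sigma n l ^ t).injective (pos_injective n heq)
            rw [this] at hi
            omega
          · rw [lt' hlt, pj]
            rw [pi, pj] at hlt
            omega
        have h1 := Nat.mod_lt (a + t) (show 0 < r by omega)
        have h2 := Nat.mod_lt (b + t) (show 0 < r by omega)
        rw [order, order, hmod, hmod] at ht
        split_ifs at ht <;> omega
      -- Otherwise the two odd residues plus `2` would sum to a multiple of `r` between `4` and `2 *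
      -- r - 2`, hence to `r`, which is odd, while that sum is even.
      have mixed : ∀ s t, (a + s) % r = r - 1 → (b + s) % r % 2 = 1 → (b + t) % r = r - 1 →
          (a + t) % r % 2 = 1 → False := by
        intro s t h1 h2 h3 h4
        have e1 : (b + s) % r + (a + t) % r + 2 ≡ ((a + s) % r + 1) + ((b + t) % r + 1) [MOD r] := by
          have m : ∀ x, x % r ≡ x [MOD r] := fun x => Nat.mod_modEq x r
          calc (b + s) % r + (a + t) % r + 2 ≡ b + s + (a + t) + 2 [MOD r] :=
                ((m _).add (m _)).add_right 2
            _ = (a + s + 1) + (b + t + 1) := by ring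
            _ ≡ _ [MOD r] := (((m _).symm.add_right 1).add ((m _).symm.add_right 1))
        rw [h1, h3, Nat.sub_add_cancel (by omega)] at e1
        have e2 : r ∣ (b + s) % r + (a + t) % r + 2 :=
          Nat.modEq_zero_iff_dvd.1 (e1.trans (Nat.modEq_zero_iff_dvd.2 ⟨2, by ring⟩))
        have l1 := Nat.mod_lt (b + s) (show 0 < r by omega)
        have l2 := Nat.mod_lt (a + t) (show 0 < r by omega)
        obtain ⟨k, hk⟩ := e2
        have : k < 2 := by
          by_contra hc
          have := Nat.mul_le_mul_left r (not_lt.1 hc)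
          omega
        interval_cases k <;> omega
      intro s t hs ht
      rcases key s hs with h1 | h1 <;> rcases key t ht with h2 | h2
      · exact Nat.ModEq.add_left_cancel' a (h1.1.trans h2.1.symm)
      · exact (mixed s t h1.1 h1.2 h2.1 h2.2).elim
      · exact (mixed t s h2.1 h2.2 h1.1 h1.2).elim
      · exact Nat.ModEq.add_left_cancel' b (h1.1.trans h2.1.symm)
    · have e'' : l = (l₁ ++ r :: l₃) ++ r' :: l₄ := by rw [e, e']; simp
      have hr' : r' ≤ r := by
        rw [e, List.pairwise_append] at hs
        exact (List.pairwise_cons.1 hs.2.1).1 r' (by rw [e']; simp)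
      rw [sz_sigma hl h e'' hb hj, max_eq_left hr']
      refine mul_card_le_of_modEq (by omega) hdvd _ ?_
      have key : ∀ t, ((sigma n l ^ t) i < (sigma n l ^ t) j ↔
          (sigma n l ^ (t + 1)) i < (sigma n l ^ (t + 1)) j) → (a + t) % r = r - 1 := by
        intro t ht
        have hlt : ∀ t, pos ((sigma n l ^ t) i) < pos ((sigma n l ^ t) j) := by
          intro t
          rw [pos_sigma_pow hl h e ha hi, pos_sigma_pow hl h e'' hb hj, List.sum_append,
            List.sum_cons]
          have := Nat.mod_lt (a + t) (show 0 < r by omega)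
          omega
        rw [lt_iff_even_pos (hlt t), lt_iff_even_pos (hlt (t + 1)), pos_sigma_pow hl h e ha hi,
          pos_sigma_pow hl h e ha hi, hmod] at ht
        split_ifs at ht <;> omega
      intro s t hs ht
      have := (key s hs).trans (key t ht).symm
      exact Nat.ModEq.add_left_cancel' a this

end UnitaryClasses

namespace UnitaryClasses
open Equiv

/-! ### Cycle types of elements above Kim's elements -/

/-- The letters less than `p` that are moved to letters at least `m`, and conversely. -/
def crossing {n : ℕ} (p m : ℕ) (w : Perm (Fin n)) : Finset (Fin n) :=
  Finset.univ.filter fun x => ((x : ℕ) < p ∧ m ≤ (w x : ℕ)) ∨ (m ≤ (x : ℕ) ∧ (w x : ℕ) < p)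

theorem sum_le_sum_of_pair {ι : Type*} [Fintype ι] [DecidableEq ι] {f g : ι → ℕ} {i j : ι}
    (hij : i ≠ j) (h : ∀ x, x ≠ i → x ≠ j → f x = g x) (h' : f i + f j ≤ g i + g j) :
    ∑ x, f x ≤ ∑ x, g x := by
  have e : ∀ f : ι → ℕ, ∑ x, f x = f i + f j + ∑ x ∈ (Finset.univ.erase i).erase j, f x := by
    intro f
    rw [← Finset.add_sum_erase _ f (Finset.mem_univ i), ← Finset.add_sum_erase _ f
      (Finset.mem_erase.2 ⟨hij.symm, Finset.mem_univ j⟩), add_assoc]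
  rw [e f, e g]
  refine add_le_add h' (Finset.sum_le_sum fun x hx => (h x ?_ ?_).le)
  · exact Finset.ne_of_mem_erase (Finset.mem_of_mem_erase hx)
  · exact Finset.ne_of_mem_erase hx

/-- A step up gives the larger of two values to the smaller of two positions, which never reduces
the number of crossings of the gap between `p` and `m`. -/
theorem UpStep.card_crossing_le {n p m : ℕ} (hpm : p ≤ m) {w w' : Perm (Fin n)} (h : UpStep w w') :
    (crossing p m w).card ≤ (crossing p m w').card := by
  obtain ⟨i, j, hij, hw, rfl⟩ := h
  rw [crossing, crossing, Finset.card_filter, Finset.card_filter]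
  refine sum_le_sum_of_pair hij.ne ?_ ?_
  · intro x hi hj
    rw [Perm.mul_apply, swap_apply_of_ne_of_ne hi hj]
  · simp only [Perm.mul_apply, swap_apply_left, swap_apply_right]
    rw [Fin.lt_def] at hij hw
    split_ifs <;> omega

theorem Up.card_crossing_le {n p m : ℕ} (hpm : p ≤ m) {w w' : Perm (Fin n)} (h : Up w w') :
    (crossing p m w).card ≤ (crossing p m w').card := by
  induction h with
  | refl => exact le_rfl
  | tail _ h ih => exact ih.trans (h.card_crossing_le hpm)

theorem card_pos_lt {n t : ℕ} (h : t ≤ n) :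
    (Finset.univ.filter fun x : Fin n => pos x < t).card = t := by
  have : (Finset.univ.filter fun x : Fin n => pos x < t).image pos = Finset.range t := by
    ext p
    rw [Finset.mem_image, Finset.mem_range]
    constructor
    · rintro ⟨x, hx, rfl⟩
      exact (Finset.mem_filter.1 hx).2
    · intro hp
      obtain ⟨x, rfl⟩ := exists_pos_eq (hp.trans_le h)
      exact ⟨x, Finset.mem_filter.2 ⟨Finset.mem_univ _, hp⟩, rfl⟩
  rw [← Finset.card_image_of_injective _ (pos_injective n), this, Finset.card_range]

theorem pos_lt_iff {n t : ℕ} (h : t ≤ n) (x : Fin n) :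
    pos x < t ↔ (x : ℕ) < (t + 1) / 2 ∨ n - t / 2 ≤ (x : ℕ) := by
  have := x.2
  unfold pos
  split_ifs <;> omega

/-- For Kim's element at most `k` of the first `t` letters of the sequence `0, n - 1, 1, …` are not
moved to the opposite end, if `t` is the sum of the first `k` parts. -/
theorem le_card_crossing_sigma {n : ℕ} {l₁ l₂ : List ℕ} (hl : ∀ r ∈ l₁ ++ l₂, Odd r)
    (h : (l₁ ++ l₂).sum = n) :
    l₁.sum ≤ (crossing ((l₁.sum + 1) / 2) (n - l₁.sum / 2) (sigma n (l₁ ++ l₂))).card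
      + l₁.length := by
  set t := l₁.sum with ht
  have htn : t ≤ n := by rw [← h, List.sum_append]; omega
  set bad := (Finset.univ.filter fun x : Fin n => pos x < t) \
    crossing ((t + 1) / 2) (n - t / 2) (sigma n (l₁ ++ l₂)) with hbad
  have h1 : t ≤ (crossing ((t + 1) / 2) (n - t / 2) (sigma n (l₁ ++ l₂))).card + bad.card := by
    conv_lhs => rw [← card_pos_lt htn]
    refine (Finset.card_le_card ?_).trans (Finset.card_union_le _ _)
    rw [hbad, Finset.union_sdiff_self_eq_union]
    exact Finset.subset_union_right
  refine h1.trans (Nat.add_le_add_left ?_ _)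
  -- Only the last position of a block can fail to cross: from any other position one moves to the
  -- next one, which belongs to the opposite end.
  have h2 : bad.image pos ⊆ (Finset.range l₁.length).image fun k => (l₁.take (k + 1)).sum - 1 := by
    intro p hp
    obtain ⟨x, hx, rfl⟩ := Finset.mem_image.1 hp
    rw [hbad, Finset.mem_sdiff, Finset.mem_filter, crossing, Finset.mem_filter] at hx
    obtain ⟨⟨-, hxt⟩, hx⟩ := hx
    obtain ⟨m₁, r, m₂, a, e, hxa, ha⟩ := exists_block (ht ▸ hxt)
    rw [Finset.mem_image]
    refine ⟨m₁.length, by rw [e]; simp, ?_⟩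
    have e2 : l₁.take (m₁.length + 1) = m₁ ++ [r] := by
      rw [e, List.take_append, List.take_of_length_le (by omega), Nat.add_sub_cancel_left,
        List.take_succ_cons, List.take_zero]
    rw [e2, List.sum_append, List.sum_singleton, hxa]
    by_contra hne
    have hr := Nat.odd_iff.1 (hl r (by rw [e]; simp))
    apply hx
    refine ⟨Finset.mem_univ _, ?_⟩
    have hp : pos (sigma n (l₁ ++ l₂) x) = pos x + 1 := by
      have := pos_sigma_pow hl h (l₁ := m₁) (l₂ := m₂ ++ l₂) (by rw [e]; simp) ha hxa 1
      rw [pow_one] at this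
      rw [this, hxa, Nat.mod_eq_of_lt (by omega), add_assoc]
    have hp' : pos (sigma n (l₁ ++ l₂) x) < t := by
      rw [hp, hxa, ht, e, List.sum_append, List.sum_cons]
      omega
    generalize sigma n (l₁ ++ l₂) x = y at *
    have := x.2
    have := y.2
    clear_value t
    clear hxa e2 hne e ht hl h h1 hbad
    unfold pos at *
    split_ifs at * <;> omega
  calc bad.card = (bad.image pos).card := (Finset.card_image_of_injective _ (pos_injective n)).symm
    _ ≤ _ := Finset.card_le_card h2
    _ ≤ _ := Finset.card_image_le
    _ = _ := Finset.card_range _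

/-- An orbit of odd size is not contained in the crossing letters. -/
theorem exists_notMem_crossing {n p m : ℕ} (hpm : p ≤ m) {w : Perm (Fin n)} {i : Fin n}
    (hi : Odd (sz w i)) : ∃ t, (w ^ t) i ∉ crossing p m w := by
  by_contra! hc
  have e : ∀ t, (((w ^ t) i : Fin n) : ℕ) < p ∧ m ≤ (((w ^ (t + 1)) i : Fin n) : ℕ) ∨
      m ≤ (((w ^ t) i : Fin n) : ℕ) ∧ (((w ^ (t + 1)) i : Fin n) : ℕ) < p := by
    intro t
    have := (Finset.mem_filter.1 (hc t)).2
    rwa [← Perm.mul_apply, ← pow_succ'] at this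
  -- Crossing letters alternate between the two ends, so after an odd number of steps one cannot be
  -- back at the start.
  have par : ∀ t, ((((w ^ t) i : Fin n) : ℕ) < p ↔ ((i : ℕ) < p ↔ t % 2 = 0)) := by
    intro t
    induction t with
    | zero => simp
    | succ t ih =>
      have := e t
      omega
  have := par (sz w i)
  rw [pow_apply_eq_self_iff.2 dvd_rfl, Nat.odd_iff.1 hi] at this
  omega

/-- Each letter of `N` accounts for itself, for two more letters if its cycle is nontrivial, and for
another two if it is a `5`-cycle; each nontrivial cycle is counted once. -/
theorem card_orbits_le {n e f : ℕ} {w : Perm (Fin n)} (h : w.cycleType = fiveThree e f)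
    (N : Finset (Fin n)) :
    (Finset.univ.filter fun x => ∃ y ∈ N, w.SameCycle y x).card ≤
      N.card + 2 * min N.card (e + f) + 2 * min N.card e := by
  set N₀ := N.filter fun y => w y = y with hN₀
  set N₁ := N.filter fun y => ¬ w y = y with hN₁
  have hN : N₀.card + N₁.card = N.card := Finset.card_filter_add_card_filter_not _
  set C := N₁.image fun y => w.cycleOf y with hC
  have hCN : C.card ≤ N₁.card := Finset.card_image_le
  have hCw : C ⊆ w.cycleFactorsFinset := by
    intro c hc
    obtain ⟨y, hy, rfl⟩ := Finset.mem_image.1 hc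
    rw [Perm.cycleOf_mem_cycleFactorsFinset_iff, Perm.mem_support]
    exact (Finset.mem_filter.1 hy).2
  have hsub : (Finset.univ.filter fun x => ∃ y ∈ N, w.SameCycle y x) ⊆ N₀ ∪ C.biUnion Perm.support := by
    intro x hx
    obtain ⟨y, hy, hyx⟩ := (Finset.mem_filter.1 hx).2
    rw [Finset.mem_union]
    by_cases hf : w y = y
    · left
      rw [← hyx.eq_of_left hf]
      exact Finset.mem_filter.2 ⟨hy, hf⟩
    · right
      refine Finset.mem_biUnion.2 ⟨w.cycleOf y, Finset.mem_image_of_mem _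
        (Finset.mem_filter.2 ⟨hy, hf⟩), ?_⟩
      rw [Perm.mem_support_cycleOf_iff, Perm.mem_support]
      exact ⟨hyx, hf⟩
  have hc5 : (C.filter fun c => c.support.card = 5).card ≤ e := by
    have : w.cycleType.count 5 = e := by
      rw [h, fiveThree, Multiset.count_add, Multiset.count_replicate, Multiset.count_replicate]
      simp
    rw [← this, Perm.cycleType_def, Multiset.count_map, Finset.card_def]
    apply Multiset.card_le_card
    refine (Multiset.filter_le_filter _ (Finset.val_le_iff.2 hCw)).trans_eq ?_
    congr 1
    ext c
    exact eq_comm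
  have hcard : C.card ≤ e + f := by
    have : Multiset.card w.cycleType = e + f := by
      rw [h, fiveThree, Multiset.card_add, Multiset.card_replicate, Multiset.card_replicate]
    rw [← this, Perm.cycleType_def, Multiset.card_map]
    exact Finset.card_le_card hCw
  have hsum : ∑ c ∈ C, c.support.card =
      3 * C.card + 2 * (C.filter fun c => c.support.card = 5).card := by
    rw [Finset.card_filter, Finset.mul_sum, mul_comm, ← smul_eq_mul, ← Finset.sum_const,
      ← Finset.sum_add_distrib]
    refine Finset.sum_congr rfl fun c hc => ?_
    have : c.support.card ∈ w.cycleType := by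
      rw [Perm.cycleType_def]
      exact Multiset.mem_map.2 ⟨c, hCw hc, rfl⟩
    rw [h] at this
    rcases mem_fiveThree this with h | h <;> rw [h] <;> rfl
  have h1 := (Finset.card_le_card hsub).trans (Finset.card_union_le _ _)
  have h2 : (C.biUnion Perm.support).card ≤ _ := Finset.card_biUnion_le
  rw [hsum] at h2
  have h3 : (C.filter fun c => c.support.card = 5).card ≤ C.card := Finset.card_filter_le _ _
  omega

/-- Among the first `t` letters of the sequence all but `l₁.length` cross under Kim's element, hence
at least as many cross under `w`. Every cycle of `w` that meets these letters is odd, so it passes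
through one of the few among them that do not cross. These cycles therefore cover all `t` letters.
-/
theorem sum_le_of_up {n e f : ℕ} {l₁ l₂ : List ℕ} (hl : ∀ r ∈ l₁ ++ l₂, Odd r)
    (h : (l₁ ++ l₂).sum = n) {w : Perm (Fin n)} (hw : w.cycleType = fiveThree e f)
    (hu : Up (sigma n (l₁ ++ l₂)) w) :
    l₁.sum ≤ l₁.length + 2 * min l₁.length (e + f) + 2 * min l₁.length e := by
  set t := l₁.sum with ht
  have htn : t ≤ n := by rw [← h, List.sum_append]; omega
  have hpm : (t + 1) / 2 ≤ n - t / 2 := by omega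
  have hcard := (le_card_crossing_sigma hl h).trans (Nat.add_le_add_right
    (hu.card_crossing_le hpm) _)
  set S := Finset.univ.filter fun x : Fin n => pos x < t with hS
  set C := crossing ((t + 1) / 2) (n - t / 2) w with hC
  have hSt : S.card = t := card_pos_lt htn
  have hCS : C ⊆ S := by
    intro x hx
    rw [hS, Finset.mem_filter, pos_lt_iff htn]
    have := (Finset.mem_filter.1 hx).2
    exact ⟨Finset.mem_univ _, by omega⟩
  have hN : (S \ C).card ≤ l₁.length := by
    have := Finset.card_sdiff_add_card_eq_card hCS
    rw [hSt] at this
    omega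
  have hsub : S ⊆ Finset.univ.filter fun x => ∃ y ∈ S \ C, w.SameCycle y x := by
    intro x hx
    rw [Finset.mem_filter]
    refine ⟨Finset.mem_univ _, ?_⟩
    have hodd : Odd (sz w x) := by
      rcases sz_of_fiveThree hw x with h | h | h <;> rw [h] <;> decide
    have hex := exists_notMem_crossing hpm hodd
    -- Up to the first time at which the orbit does not cross, it stays among the outer letters.
    refine ⟨(w ^ Nat.find hex) x, Finset.mem_sdiff.2 ⟨?_, Nat.find_spec hex⟩,
      (Perm.sameCycle_pow_left).2 (Perm.SameCycle.refl _ _)⟩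
    rcases Nat.eq_zero_or_pos (Nat.find hex) with h0 | h0
    · rw [h0]
      exact hx
    · have hm := Nat.find_min hex (Nat.sub_lt h0 one_pos)
      have hm := (Finset.mem_filter.1 (not_not.1 hm)).2
      rw [← Perm.mul_apply, ← pow_succ', show Nat.find hex - 1 + 1 = Nat.find hex by omega] at hm
      rw [hS, Finset.mem_filter, pos_lt_iff htn]
      exact ⟨Finset.mem_univ _, by omega⟩
  have := (Finset.card_le_card hsub).trans (card_orbits_le hw _)
  rw [hSt] at this
  omega

theorem exists_sigma_isConj {n : ℕ} {y : Perm (Fin n)} (hy : ∀ r ∈ y.cycleType, Odd r) :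
    ∃ l : List ℕ, (∀ r ∈ l, Odd r) ∧ l.sum = n ∧ l.Pairwise (· ≥ ·) ∧
      (l : Multiset ℕ) = y.cycleType + Multiset.replicate (n - y.cycleType.sum) 1 ∧
      IsConj y (sigma n l) := by
  set s := y.cycleType + Multiset.replicate (n - y.cycleType.sum) 1 with hs
  have hsum : y.cycleType.sum ≤ n := by have := card_fixed y; omega
  have hl : ∀ r ∈ s.sort (fun a b => b ≤ a), Odd r := by
    intro r hr
    rw [Multiset.mem_sort, hs, Multiset.mem_add] at hr
    rcases hr with hr | hr
    · exact hy r hr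
    · rw [Multiset.eq_of_mem_replicate hr]
      exact odd_one
  have hsum' : (s.sort (fun a b => b ≤ a)).sum = n := by
    rw [← Multiset.sum_coe, Multiset.sort_eq, hs, Multiset.sum_add, Multiset.sum_replicate]
    simp [hsum]
  refine ⟨s.sort (fun a b => b ≤ a), hl, hsum', Multiset.pairwise_sort _ _, Multiset.sort_eq _ _, ?_⟩
  rw [Perm.isConj_iff_cycleType_eq, cycleType_sigma hl hsum', Multiset.sort_eq, hs,
    Multiset.filter_add, Multiset.filter_eq_self.2 (fun a ha => Perm.one_lt_of_mem_cycleType ha),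
    Multiset.filter_eq_nil.2, add_zero]
  intro a ha
  rw [Multiset.eq_of_mem_replicate ha]
  omega

/-- A list decreasing to `l` is the multiset of its large elements followed by the other ones. -/
theorem exists_append_filter {l : List ℕ} (h : l.Pairwise (· ≥ ·)) (m : ℕ) :
    ∃ l₁ l₂, l = l₁ ++ l₂ ∧ (l₁ : Multiset ℕ) = (l : Multiset ℕ).filter (m ≤ ·) := by
  induction l with
  | nil => exact ⟨[], [], rfl, rfl⟩
  | cons a l ih =>
    rw [List.pairwise_cons] at h
    by_cases ha : m ≤ a
    · obtain ⟨l₁, l₂, rfl, e⟩ := ih h.2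
      refine ⟨a :: l₁, l₂, rfl, ?_⟩
      rw [← Multiset.cons_coe, ← Multiset.cons_coe, Multiset.filter_cons_of_pos _ ha, e]
    · refine ⟨[], a :: l, rfl, ?_⟩
      symm
      rw [Multiset.coe_nil, Multiset.filter_eq_nil]
      intro b hb
      rw [Multiset.mem_coe, List.mem_cons] at hb
      rcases hb with rfl | hb
      · exact ha
      · have := h.1 b hb
        omega

/-- The comparison is applied to Kim's element of the type of `y`, which is top. The bound
`sum_le_of_up` for the largest part excludes cycles longer than `5`; for the parts `5` it gives `e ≤
E`, and for all the parts other than `1` it gives the second inequality. -/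
theorem fiveThree_of_classLE {n E F : ℕ} {y y' : Perm (Fin n)} (hy : ∀ r ∈ y.cycleType, Odd r)
    (h' : y'.cycleType = fiveThree E F)
    (h : ClassLE (fClass (y' * w₀ n)) (fClass (y * w₀ n))) :
    ∃ e f, y.cycleType = fiveThree e f ∧ e ≤ E ∧ f + 2 * e ≤ F + 2 * E := by
  obtain ⟨l, hl, hsum, hsort, hls, hconj⟩ := exists_sigma_isConj hy
  rw [classLE_iff] at h
  obtain ⟨z, hz, -, hu⟩ := h _ hconj (isTop_sigma hl hsum hsort)
  have hz' := (Perm.isConj_iff_cycleType_eq.1 hz).symm.trans h'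
  have hfil : ∀ m, 2 ≤ m → (l : Multiset ℕ).filter (m ≤ ·) = y.cycleType.filter (m ≤ ·) := by
    intro m hm
    rw [hls, Multiset.filter_add, add_eq_left, Multiset.filter_eq_nil]
    intro a ha
    rw [Multiset.eq_of_mem_replicate ha]
    omega
  have main : ∀ l₁ l₂, l = l₁ ++ l₂ →
      l₁.sum ≤ l₁.length + 2 * min l₁.length (E + F) + 2 * min l₁.length E := by
    rintro l₁ l₂ rfl
    exact sum_le_of_up hl hsum hz' hu
  have h5 : ∀ r ∈ y.cycleType, r ≤ 5 := by
    intro r hr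
    have hrl : r ∈ l := by
      rw [← Multiset.mem_coe, hls]
      exact Multiset.mem_add.2 (Or.inl hr)
    obtain _ | ⟨a, l⟩ := l
    · simp at hrl
    · have := main [a] l rfl
      rw [List.sum_singleton, List.length_singleton] at this
      rcases List.mem_cons.1 hrl with rfl | hrl
      · omega
      · have := (List.pairwise_cons.1 hsort).1 r hrl
        omega
  have htype : y.cycleType = fiveThree (y.cycleType.count 5) (y.cycleType.count 3) := by
    ext r
    rw [fiveThree, Multiset.count_add, Multiset.count_replicate, Multiset.count_replicate]
    by_cases hr : r ∈ y.cycleType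
    · have h1 := h5 r hr
      have h2 := hy r hr
      have h3 := Perm.two_le_of_mem_cycleType hr
      interval_cases r
      · exact absurd h2 (by decide)
      · simp
      · exact absurd h2 (by decide)
      · simp
    · rw [Multiset.count_eq_zero_of_notMem hr]
      split_ifs with h1 h2 h2
      · omega
      · rw [h1, Multiset.count_eq_zero_of_notMem hr]
      · rw [h2, Multiset.count_eq_zero_of_notMem hr]
      · rfl
  generalize y.cycleType.count 5 = e at htype
  generalize y.cycleType.count 3 = f at htype
  refine ⟨e, f, htype, ?_⟩
  have sums : ∀ m s, 2 ≤ m → y.cycleType.filter (m ≤ ·) = s → s.sum ≤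
      s.card + 2 * min s.card (E + F) + 2 * min s.card E := by
    rintro m s hm rfl
    obtain ⟨l₁, l₂, e, e₁⟩ := exists_append_filter hsort m
    have := main l₁ l₂ e
    rwa [← Multiset.sum_coe, ← Multiset.coe_card, e₁, hfil m hm] at this
  have a5 := sums 5 (fiveThree e 0) (by omega) (by
    rw [htype, fiveThree, fiveThree, Multiset.filter_add, Multiset.filter_eq_self.2,
      Multiset.filter_eq_nil.2, Multiset.replicate_zero]
    · intro a ha; rw [Multiset.eq_of_mem_replicate ha]; omega
    · intro a ha; rw [Multiset.eq_of_mem_replicate ha])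
  have a3 := sums 3 (fiveThree e f) (by omega) (by
    rw [htype, Multiset.filter_eq_self.2]
    intro a ha
    rcases mem_fiveThree ha with h | h <;> omega)
  have hc : ∀ e f, Multiset.card (fiveThree e f) = e + f := by
    intro e f
    rw [fiveThree, Multiset.card_add, Multiset.card_replicate, Multiset.card_replicate]
  rw [sum_fiveThree, hc] at a5 a3
  omega

end UnitaryClasses

namespace UnitaryClasses
open Equiv

/-! ### Cuspidal classes -/

/-- The simple reflections other than those exchanging `k - 1`, `k` or `n - k - 1`, `n - k`. -/
def leviReflections (n k : ℕ) : Set (Perm (Fin n)) :=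
  {s | ∃ i j : Fin n, (j : ℕ) = i + 1 ∧ (j : ℕ) ≠ k ∧ (j : ℕ) ≠ n - k ∧ s = swap i j}

/-- Permutations stabilizing the first `k` letters. -/
def StabilizesFirst {n : ℕ} (k : ℕ) (w : Perm (Fin n)) : Prop :=
  ∀ x : Fin n, (w x : ℕ) < k ↔ (x : ℕ) < k

theorem stabilizesFirst_swap {n k : ℕ} {i j : Fin n} (hij : (j : ℕ) = i + 1) (hk : (j : ℕ) ≠ k) :
    StabilizesFirst k (swap i j) := by
  intro x
  rw [swap_apply_def]
  split_ifs with h1 h2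
  · rw [h1]; omega
  · rw [h2]; omega
  · rfl

/-- The inverse of `w` is one of its powers, so invariance in one direction suffices. -/
theorem iff_of_forall_imp {n : ℕ} {w : Perm (Fin n)} {P : Fin n → Prop}
    (h : ∀ x, P x → P (w x)) (x : Fin n) : P (w x) ↔ P x := by
  refine ⟨fun hx => ?_, h x⟩
  have key : ∀ t, P ((w ^ t) (w x)) := by
    intro t
    induction t with
    | zero => exact hx
    | succ t ih => rw [pow_succ', Perm.mul_apply]; exact h _ ih
  have := key (orderOf w - 1)
  rwa [← Perm.mul_apply, ← pow_succ, Nat.sub_add_cancel (orderOf_pos w), pow_orderOf_eq_one] at this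

theorem stabilizesFirst_of_mapsTo {n k : ℕ} {w : Perm (Fin n)}
    (h : ∀ x : Fin n, (x : ℕ) < k → (w x : ℕ) < k) : StabilizesFirst k w :=
  iff_of_forall_imp h

theorem stabilizesFirst_of_mapsTo_compl {n k : ℕ} {w : Perm (Fin n)}
    (h : ∀ x : Fin n, k ≤ (x : ℕ) → k ≤ (w x : ℕ)) : StabilizesFirst k w := fun x => by
  rw [← not_iff_not, not_lt, not_lt]
  exact iff_of_forall_imp h x

theorem StabilizesFirst.mul {n k : ℕ} {w v : Perm (Fin n)} (hw : StabilizesFirst k w)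
    (hv : StabilizesFirst k v) : StabilizesFirst k (w * v) := fun x => by
  rw [Perm.mul_apply, hw, hv]

theorem StabilizesFirst.inv {n k : ℕ} {w : Perm (Fin n)} (hw : StabilizesFirst k w) :
    StabilizesFirst k w⁻¹ := fun x => by
  rw [← hw, Perm.inv_def, apply_symm_apply]

theorem stabilizesFirst_of_mem_closure {n k : ℕ} {J : Set (Perm (Fin n))}
    (hJ : ∀ s ∈ J, StabilizesFirst k s) {w : Perm (Fin n)} (hw : w ∈ Subgroup.closure J) :
    StabilizesFirst k w := by
  induction hw using Subgroup.closure_induction with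
  | mem x hx => exact hJ x hx
  | one => exact fun x => Iff.rfl
  | mul x y _ _ hx hy => exact hx.mul hy
  | inv x _ hx => exact hx.inv

theorem exists_descent {n : ℕ} {w : Perm (Fin n)} (hw : w ≠ 1) :
    ∃ i j : Fin n, (j : ℕ) = i + 1 ∧ w j < w i := by
  by_contra! hc
  apply hw
  cases n with
  | zero => exact Subsingleton.elim _ _
  | succ n =>
    have hm : StrictMono w := by
      rw [Fin.strictMono_iff_lt_succ]
      intro i
      refine lt_of_le_of_ne (hc i.castSucc i.succ (by simp)) fun h => ?_
      exact absurd (w.injective h) (Fin.castSucc_lt_succ).ne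
    have := (StrictMono.range_inj hm strictMono_id).1 (by simp [w.surjective.range_eq])
    ext i : 1
    rw [this]
    rfl

theorem nonInv_le {n : ℕ} (w : Perm (Fin n)) : nonInv w ≤ n * n := by
  refine (Finset.card_le_univ _).trans ?_
  simp

/-- Induction on the number of inversions: a descent at adjacent positions cannot straddle a
stabilized boundary, so the corresponding simple reflection is allowed. -/
theorem mem_closure_leviReflections {n k : ℕ} {w : Perm (Fin n)} (h1 : StabilizesFirst k w)
    (h2 : StabilizesFirst (n - k) w) : w ∈ Subgroup.closure (leviReflections n k) := by
  induction h : n * n - nonInv w using Nat.strong_induction_on generalizing w with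
  | _ m ih =>
    by_cases hw : w = 1
    · rw [hw]; exact one_mem _
    · obtain ⟨i, j, hij, hd⟩ := exists_descent hw
      have hne : ∀ p, StabilizesFirst p w → (j : ℕ) ≠ p := by
        intro p hp hj
        have a1 := hp i
        have a2 := hp j
        rw [Fin.lt_def] at hd
        omega
      have hs : swap i j ∈ leviReflections n k := ⟨i, j, hij, hne _ h1, hne _ h2, rfl⟩
      have hlt := nonInv_mul_swap_lt (w := w * swap i j) (i := i) (j := j)
        (by rw [Fin.lt_def]; omega) (by simpa using hd)
      rw [mul_swap_mul_self] at hlt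
      have := nonInv_le (w * swap i j)
      have hmem := ih _ (by omega) (h1.mul (stabilizesFirst_swap hij (hne _ h1)))
        (h2.mul (stabilizesFirst_swap hij (hne _ h2))) rfl
      have := mul_mem hmem (Subgroup.subset_closure hs)
      rwa [mul_swap_mul_self] at this

theorem frob_swap {n : ℕ} (i j : Fin n) : frob (swap i j) = swap i.rev j.rev := by
  rw [frob]
  nth_rw 2 [← w₀_inv]
  rw [← swap_apply_apply]
  rfl

theorem frob_frob {n : ℕ} (w : Perm (Fin n)) : frob (frob w) = w := by
  unfold frob
  simp only [← mul_assoc, w₀_mul_self, one_mul]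
  rw [mul_assoc, w₀_mul_self, mul_one]

/-- An `F`-stable proper `J` omits a simple reflection together with its image, so its subgroup
stabilizes the first `k` and the first `n - k` letters for some positive `k ≤ n - k`. Multiplied by
`w₀`, such an element exchanges the first `k` letters with the last `k`, and the cycles there are
even. -/
theorem isCuspidal_of_odd {n : ℕ} {y : Perm (Fin n)} (hy : ∀ r ∈ y.cycleType, Odd r) :
    IsCuspidal (fClass (y * w₀ n)) := by
  intro J hJ hF
  rw [Set.disjoint_left]
  intro x hx hxJ
  rw [mem_fClass_iff] at hx
  obtain ⟨s, ⟨i, j, hij, rfl⟩, hs⟩ := Set.exists_of_ssubset hJ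
  have hs' : frob (swap i j) ∉ J := by
    intro h
    rw [← hF] at h
    obtain ⟨t, ht, e⟩ := h
    have := congrArg frob e
    rw [frob_frob, frob_frob] at this
    exact hs (this ▸ ht)
  rw [frob_swap] at hs'
  have hi := i.2
  have hj := j.2
  have stab : ∀ k, (k = (j : ℕ) ∨ k = n - j) → StabilizesFirst k x := by
    intro k hk
    refine stabilizesFirst_of_mem_closure ?_ hxJ
    intro s hsJ
    obtain ⟨a, b, hab, rfl⟩ := hJ.1 hsJ
    apply stabilizesFirst_swap hab
    intro hbk
    have ha := a.2
    have hb := b.2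
    rcases hk with hk | hk
    · have e1 : a = i := by ext; omega
      have e2 : b = j := by ext; omega
      exact hs (e1 ▸ e2 ▸ hsJ)
    · have e1 : i.rev = b := by ext; rw [Fin.val_rev]; omega
      have e2 : j.rev = a := by ext; rw [Fin.val_rev]; omega
      rw [e1, e2, swap_comm] at hs'
      exact hs' hsJ
  obtain ⟨k, hk0, hkn, h1, h2⟩ : ∃ k, 0 < k ∧ k ≤ n - k ∧ StabilizesFirst k x ∧
      StabilizesFirst (n - k) x := by
    by_cases h : (j : ℕ) ≤ n - j
    · exact ⟨j, by omega, h, stab _ (Or.inl rfl), stab _ (Or.inr rfl)⟩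
    · exact ⟨n - j, by omega, by omega, stab _ (Or.inr rfl),
        by rw [show n - (n - j) = (j : ℕ) by omega]; exact stab _ (Or.inl rfl)⟩
  set z := x * w₀ n with hz
  have hzv : ∀ v : Fin n, ((z v : Fin n) : ℕ) < k ↔ n - k ≤ (v : ℕ) := by
    intro v
    have := v.2
    rw [hz, Perm.mul_apply, h1, w₀_apply, Fin.val_rev]
    omega
  have hzv' : ∀ v : Fin n, n - k ≤ ((z v : Fin n) : ℕ) ↔ (v : ℕ) < k := by
    intro v
    have := v.2
    rw [← not_lt, hz, Perm.mul_apply, h2, w₀_apply, Fin.val_rev]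
    omega
  have hodd : Odd (sz z ⟨0, by omega⟩) := by
    by_cases h : z ⟨0, by omega⟩ = ⟨0, by omega⟩
    · rw [sz_eq_one_iff.2 h]; exact odd_one
    · apply hy
      rw [Perm.isConj_iff_cycleType_eq.1 hx]
      exact sz_mem_cycleType h
  obtain ⟨t, ht⟩ := exists_notMem_crossing hkn hodd
  have key : ∀ t, (((z ^ t) ⟨0, by omega⟩ : Fin n) : ℕ) < k ∨
      n - k ≤ (((z ^ t) ⟨0, by omega⟩ : Fin n) : ℕ) := by
    intro t
    induction t with
    | zero => exact Or.inl hk0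
    | succ t ih =>
      rw [pow_succ', Perm.mul_apply, hzv, hzv']
      exact ih.symm
  apply ht
  rw [crossing, Finset.mem_filter, hzv, hzv', and_self, and_self]
  exact ⟨Finset.mem_univ _, key t⟩

/-- By multiple transitivity a cycle of length `2 * k` can be conjugated onto the first `2 * k`
letters of the sequence `0, n - 1, 1, …`, in this order. It then exchanges the two ends of length
`k`, so multiplication by `w₀` gives an element of the subgroup generated by `leviReflections n k`.
-/
theorem odd_of_isCuspidal {n : ℕ} {y : Perm (Fin n)} (h : IsCuspidal (fClass (y * w₀ n))) :
    ∀ r ∈ y.cycleType, Odd r := by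
  intro r hr
  by_contra hodd
  obtain ⟨i, hi⟩ := exists_sz_eq hr
  obtain ⟨k, rfl⟩ := (Nat.not_odd_iff_even.1 hodd).two_dvd
  have h2 := Perm.two_le_of_mem_cycleType hr
  have hn : 2 * k ≤ n := by
    have := Multiset.le_sum_of_mem hr
    have := card_fixed y
    omega
  have hv : ∀ l : Fin (2 * k), ∃ x : Fin n, pos x = l := fun l => exists_pos_eq (by omega)
  choose v hv using hv
  let v₁ : Fin (2 * k) ↪ Fin n := ⟨fun l => (y ^ (l : ℕ)) i, fun a b hab => by
    ext; exact pow_apply_inj (by omega) (by omega) hab⟩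
  let v₂ : Fin (2 * k) ↪ Fin n := ⟨v, fun a b hab => by
    ext; rw [← hv a, hab, hv b]⟩
  have := Perm.isMultiplyPretransitive (Fin n) (2 * k)
  obtain ⟨g, hg⟩ := MulAction.exists_smul_eq (Perm (Fin n)) v₁ v₂
  have hg' : ∀ t, pos (g ((y ^ t) i)) = t % (2 * k) := by
    intro t
    have ht := Nat.mod_lt t (show 0 < 2 * k by omega)
    have := DFunLike.congr_fun hg ⟨t % (2 * k), ht⟩
    rw [← pow_mod_sz, hi]
    refine (congrArg pos this).trans (hv _)
  set z := g * y * g⁻¹ with hz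
  have hzx : ∀ x, pos x < 2 * k → pos (z x) < 2 * k ∧ pos (z x) % 2 ≠ pos x % 2 := by
    intro x hx
    have e : x = g ((y ^ (pos x)) i) := pos_injective n (by rw [hg', Nat.mod_eq_of_lt hx])
    have e' : pos (z x) = (pos x + 1) % (2 * k) := by
      conv_lhs => rw [e]
      rw [hz, Perm.mul_apply, Perm.inv_def, symm_apply_apply, Perm.mul_apply]
      have := hg' (pos x + 1)
      rwa [pow_succ', Perm.mul_apply] at this
    rw [e', Nat.mod_mod_of_dvd _ (Dvd.intro k rfl)]
    exact ⟨Nat.mod_lt _ (by omega), by omega⟩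
  have hA : ∀ x : Fin n, (x : ℕ) < k → n - k ≤ ((z x : Fin n) : ℕ) := by
    intro x hx
    have hx' := hzx x ((pos_lt_iff hn x).2 (by omega))
    generalize z x = u at *
    have := u.2
    unfold pos at hx'
    split_ifs at hx' <;> omega
  have hB : ∀ x : Fin n, n - k ≤ (x : ℕ) → ((z x : Fin n) : ℕ) < k := by
    intro x hx
    have hx' := hzx x ((pos_lt_iff hn x).2 (by omega))
    generalize z x = u at *
    have := u.2
    have := x.2
    unfold pos at hx'
    split_ifs at hx' <;> omega
  have hk1 : StabilizesFirst k (z * w₀ n) := by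
    refine stabilizesFirst_of_mapsTo fun x hx => ?_
    have := x.2
    rw [Perm.mul_apply]
    apply hB
    rw [w₀_apply, Fin.val_rev]
    omega
  have hk2 : StabilizesFirst (n - k) (z * w₀ n) := by
    refine stabilizesFirst_of_mapsTo_compl fun x hx => ?_
    have := x.2
    rw [Perm.mul_apply]
    apply hA
    rw [w₀_apply, Fin.val_rev]
    omega
  have hsub : leviReflections n k ⊂ simpleReflections n := by
    rw [Set.ssubset_iff_of_subset]
    · refine ⟨swap ⟨k - 1, by omega⟩ ⟨k, by omega⟩, ⟨_, _, by simp only; omega, rfl⟩, ?_⟩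
      rintro ⟨a, b, hab, hb, -, e⟩
      have hne : a ≠ b := by rintro rfl; omega
      have h1 := DFunLike.congr_fun e a
      have h2 := DFunLike.congr_fun e b
      rw [swap_apply_left, swap_apply_def] at h1
      split_ifs at h1 with h3 h3
      · subst h3; subst h1; exact hb rfl
      · subst h3
        have : (b : ℕ) = k - 1 := by rw [← h1]
        simp only at hab
        omega
      · exact hne h1
    · rintro s ⟨a, b, hab, -, -, rfl⟩
      exact ⟨a, b, hab, rfl⟩
  have hfrob : ∀ s ∈ leviReflections n k, frob s ∈ leviReflections n k := by
    rintro s ⟨a, b, hab, h1, h2, rfl⟩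
    have := a.2
    have := b.2
    refine ⟨b.rev, a.rev, ?_, ?_, ?_, ?_⟩
    · rw [Fin.val_rev, Fin.val_rev]; omega
    · rw [Fin.val_rev]; omega
    · rw [Fin.val_rev]; omega
    · rw [frob_swap, swap_comm]
  have himage : frob '' leviReflections n k = leviReflections n k := by
    refine Set.Subset.antisymm (Set.image_subset_iff.2 hfrob) fun s hs => ?_
    exact ⟨frob s, hfrob s hs, frob_frob s⟩
  refine Set.disjoint_left.1 (h _ hsub himage) ?_ (mem_closure_leviReflections hk1 hk2)
  rw [mem_fClass_iff, mul_w₀_mul_w₀]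
  exact isConj_iff.2 ⟨g, rfl⟩

theorem isCuspidal_iff {n : ℕ} {y : Perm (Fin n)} :
    IsCuspidal (fClass (y * w₀ n)) ↔ ∀ r ∈ y.cycleType, Odd r :=
  ⟨odd_of_isCuspidal, isCuspidal_of_odd⟩

end UnitaryClasses

namespace UnitaryClasses
open Equiv

/-! ### Traces on left ideals of a group algebra -/

section Trace
variable {G : Type*} [Group G] [Fintype G]

/-- The coefficient of a basis element `h` in `g * h * y` is `y.coeff (h⁻¹ * g⁻¹ * h)`. -/
theorem trace_mul_mul (g : G) (y : MonoidAlgebra ℂ G) :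
    LinearMap.trace ℂ (MonoidAlgebra ℂ G)
      (LinearMap.mulLeft ℂ (MonoidAlgebra.of ℂ G g) ∘ₗ LinearMap.mulRight ℂ y) =
      ∑ h : G, y.coeff (h⁻¹ * g⁻¹ * h) := by
  classical
  rw [LinearMap.trace_eq_matrix_trace ℂ (MonoidAlgebra.basis G ℂ), Matrix.trace]
  refine Finset.sum_congr rfl fun h _ => ?_
  rw [Matrix.diag_apply, LinearMap.toMatrix_apply, MonoidAlgebra.basis_apply]
  change (MonoidAlgebra.single g 1 * (MonoidAlgebra.single h 1 * y)).coeff h = _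
  rw [MonoidAlgebra.coeff_single_mul_apply, MonoidAlgebra.coeff_single_mul_apply, one_mul, one_mul,
    mul_assoc]

/-- The map `x ↦ g * x * y` has its image in the left ideal, on which it acts as `κ` times `g`; its
trace is the trace of its restriction. -/
theorem mul_trace_span {y : MonoidAlgebra ℂ G} {κ : ℂ} (hy : y * y = κ • y) (g : G) :
    κ * LinearMap.trace ℂ (Ideal.span {y}) (Algebra.lsmul ℂ ℂ (Ideal.span {y})
      (MonoidAlgebra.of ℂ G g)) = ∑ h : G, y.coeff (h⁻¹ * g⁻¹ * h) := by
  rw [← trace_mul_mul]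
  set f := LinearMap.mulLeft ℂ (MonoidAlgebra.of ℂ G g) ∘ₗ LinearMap.mulRight ℂ y with hf
  have : Module.Finite ℂ (MonoidAlgebra ℂ G) := Module.Finite.of_basis (MonoidAlgebra.basis G ℂ)
  have hfx : ∀ x, f x = MonoidAlgebra.of ℂ G g * (x * y) := fun x => rfl
  have hmem : ∀ x, f x ∈ (Ideal.span {y}).restrictScalars ℂ := by
    intro x
    rw [hfx, ← mul_assoc]
    exact Ideal.mul_mem_left _ _ (Ideal.mem_span_singleton_self y)
  rw [← LinearMap.trace_restrict_eq_of_forall_mem _ f hmem, ← smul_eq_mul, ← map_smul]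
  congr 1
  refine LinearMap.ext fun ⟨x, hx⟩ => ?_
  obtain ⟨a, rfl⟩ := Ideal.mem_span_singleton'.1 hx
  refine Subtype.ext ?_
  change κ • (MonoidAlgebra.of ℂ G g * (a * y)) = MonoidAlgebra.of ℂ G g * (a * y * y)
  rw [mul_assoc a, hy, mul_smul_comm, mul_smul_comm]

/-- The trace on the left ideal generated by a quasi-idempotent. -/
theorem trace_span_ne_zero_iff {y : MonoidAlgebra ℂ G} {κ : ℂ} (hy : y * y = κ • y)
    (h1 : y.coeff 1 ≠ 0) (g : G) :
    LinearMap.trace ℂ (Ideal.span {y}) (Algebra.lsmul ℂ ℂ (Ideal.span {y})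
      (MonoidAlgebra.of ℂ G g)) ≠ 0 ↔ ∑ h : G, y.coeff (h⁻¹ * g⁻¹ * h) ≠ 0 := by
  rw [← mul_trace_span hy]
  -- At `g = 1` the sum is the order of the group times the coefficient of `1`, which is not zero.
  have hκ : κ ≠ 0 := by
    rintro rfl
    have := mul_trace_span hy 1
    simp at this
    exact h1 this
  simp [hκ]

end Trace

/-! ### Young symmetrizers -/

section Symmetrizer
variable {n : ℕ}

/-- The signed sum of the elements of a set. -/
noncomputable def signedSum (C : Finset (Perm (Fin n))) : MonoidAlgebra ℂ (Perm (Fin n)) :=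
  ∑ g ∈ C, ((Perm.sign g : ℤ) : ℂ) • MonoidAlgebra.of ℂ _ g

/-- The sum of the elements of a set. -/
noncomputable def plainSum (R : Finset (Perm (Fin n))) : MonoidAlgebra ℂ (Perm (Fin n)) :=
  ∑ g ∈ R, MonoidAlgebra.of ℂ _ g

theorem plainSum_mul_of {R : Subgroup (Perm (Fin n))} [DecidablePred (· ∈ R)] {g : Perm (Fin n)}
    (hg : g ∈ R) : plainSum (Finset.univ.filter (· ∈ R)) * MonoidAlgebra.of ℂ _ g =
      plainSum (Finset.univ.filter (· ∈ R)) := by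
  rw [plainSum, Finset.sum_mul]
  refine Finset.sum_equiv (Equiv.mulRight g) ?_ ?_
  · intro x
    simp [R.mul_mem_cancel_right hg]
  · intro x _
    rw [← map_mul]
    rfl

theorem of_mul_signedSum {C : Subgroup (Perm (Fin n))} [DecidablePred (· ∈ C)] {g : Perm (Fin n)}
    (hg : g ∈ C) : MonoidAlgebra.of ℂ _ g * signedSum (Finset.univ.filter (· ∈ C)) =
      ((Perm.sign g : ℤ) : ℂ) • signedSum (Finset.univ.filter (· ∈ C)) := by
  rw [signedSum, Finset.mul_sum, Finset.smul_sum]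
  refine Finset.sum_equiv (Equiv.mulLeft g) ?_ ?_
  · intro x
    simp [C.mul_mem_cancel_left hg]
  · intro x _
    rw [mul_smul_comm, ← map_mul, smul_smul, Equiv.coe_mulLeft, Perm.sign_mul, Units.val_mul,
      Int.cast_mul, ← mul_assoc, ← Int.cast_mul, Int.units_coe_mul_self, Int.cast_one, one_mul]

/-- A group of permutations stabilizing the fibres of a map. -/
def fiberStabilizer {α : Type*} (f : Fin n → α) : Subgroup (Perm (Fin n)) where
  carrier := {g | ∀ x, f (g x) = f x}
  one_mem' := fun _ => rfl
  mul_mem' := fun {g h} hg hh x => by rw [Perm.mul_apply, hg, hh]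
  inv_mem' := fun {g} hg x => by rw [← hg, Perm.inv_def, apply_symm_apply]

instance {α : Type*} [DecidableEq α] (f : Fin n → α) : DecidablePred (· ∈ fiberStabilizer f) :=
  fun g => inferInstanceAs (Decidable (∀ x, f (g x) = f x))

/-- Von Neumann's argument. Let `a` and `b` be the row and column sums. If some `t * x` with `t` in
`R` lies in `C`, then `a * x * b` is a multiple of `a * b`. If an odd `t` in `R` is conjugated into
`C` by `x`, then `a * x * b` equals its own negative. Expanding `b * a`, only `x = c * r` is needed.
-/
theorem exists_symmetrizer_mul_self {R C : Subgroup (Perm (Fin n))} [DecidablePred (· ∈ R)]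
    [DecidablePred (· ∈ C)] (h : ∀ c ∈ C, ∀ r ∈ R, (∃ t ∈ R, t * (c * r) ∈ C) ∨
      ∃ t ∈ R, (c * r)⁻¹ * t * (c * r) ∈ C ∧ Perm.sign t = -1) :
    ∃ κ : ℂ, (plainSum (Finset.univ.filter (· ∈ R)) * signedSum (Finset.univ.filter (· ∈ C))) *
      (plainSum (Finset.univ.filter (· ∈ R)) * signedSum (Finset.univ.filter (· ∈ C))) =
      κ • (plainSum (Finset.univ.filter (· ∈ R)) * signedSum (Finset.univ.filter (· ∈ C))) := by
  have hA : ∀ t ∈ R, plainSum (Finset.univ.filter (· ∈ R)) * MonoidAlgebra.of ℂ _ t =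
      plainSum (Finset.univ.filter (· ∈ R)) := fun t ht => plainSum_mul_of ht
  have hB : ∀ t ∈ C, MonoidAlgebra.of ℂ _ t * signedSum (Finset.univ.filter (· ∈ C)) =
      ((Perm.sign t : ℤ) : ℂ) • signedSum (Finset.univ.filter (· ∈ C)) :=
    fun t ht => of_mul_signedSum ht
  have hba : signedSum (Finset.univ.filter (· ∈ C)) * plainSum (Finset.univ.filter (· ∈ R)) =
      ∑ c ∈ Finset.univ.filter (· ∈ C), ∑ r ∈ Finset.univ.filter (· ∈ R),
        ((Perm.sign c : ℤ) : ℂ) • MonoidAlgebra.of ℂ _ (c * r) := by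
    rw [signedSum, plainSum, Finset.sum_mul_sum]
    simp only [map_mul, smul_mul_assoc]
  generalize plainSum (Finset.univ.filter (· ∈ R)) = a at *
  generalize signedSum (Finset.univ.filter (· ∈ C)) = b at *
  have key : ∀ c ∈ C, ∀ r ∈ R, ∃ κ : ℂ, a * MonoidAlgebra.of ℂ _ (c * r) * b = κ • (a * b) := by
    intro c hc r hr
    rcases h c hc r hr with ⟨t, ht, htc⟩ | ⟨t, ht, htc, hs⟩
    · refine ⟨((Perm.sign (t * (c * r)) : ℤ) : ℂ), ?_⟩
      calc a * MonoidAlgebra.of ℂ _ (c * r) * b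
          = (a * MonoidAlgebra.of ℂ _ t) * MonoidAlgebra.of ℂ _ (c * r) * b := by rw [hA t ht]
        _ = a * (MonoidAlgebra.of ℂ _ (t * (c * r)) * b) := by
          rw [map_mul _ t (c * r)]
          simp only [mul_assoc]
        _ = _ := by rw [hB _ htc, mul_smul_comm]
    · refine ⟨0, ?_⟩
      have hs' : Perm.sign ((c * r)⁻¹ * t * (c * r)) = -1 := by
        rw [mul_assoc, Perm.sign_mul, Perm.sign_mul, mul_comm, mul_assoc, ← Perm.sign_mul,
          mul_inv_cancel, Perm.sign_one, mul_one, hs]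
      have e : a * MonoidAlgebra.of ℂ _ (c * r) * b = -(a * MonoidAlgebra.of ℂ _ (c * r) * b) := by
        calc a * MonoidAlgebra.of ℂ _ (c * r) * b
            = (a * MonoidAlgebra.of ℂ _ t) * MonoidAlgebra.of ℂ _ (c * r) * b := by rw [hA t ht]
          _ = a * MonoidAlgebra.of ℂ _ (t * (c * r)) * b := by
            rw [map_mul _ t (c * r)]
            simp only [mul_assoc]
          _ = a * MonoidAlgebra.of ℂ _ ((c * r) * ((c * r)⁻¹ * t * (c * r))) * b := by
            congr 3
            group
          _ = a * MonoidAlgebra.of ℂ _ (c * r) *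
                (MonoidAlgebra.of ℂ _ ((c * r)⁻¹ * t * (c * r)) * b) := by
            rw [map_mul _ (c * r) _]
            simp only [mul_assoc]
          _ = _ := by
            rw [hB _ htc, hs']
            simp
      have e2 : (2 : ℂ) • (a * MonoidAlgebra.of ℂ _ (c * r) * b) = 0 := by
        rw [two_smul]
        nth_rw 1 [e]
        exact neg_add_cancel _
      rw [zero_smul]
      exact (smul_eq_zero.1 e2).resolve_left two_ne_zero
  choose! κ hκ using key
  refine ⟨∑ c ∈ Finset.univ.filter (· ∈ C), ∑ r ∈ Finset.univ.filter (· ∈ R),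
    ((Perm.sign c : ℤ) : ℂ) * κ c r, ?_⟩
  have : a * b * (a * b) = a * (b * a) * b := by simp only [mul_assoc]
  rw [this, hba, Finset.mul_sum, Finset.sum_mul, Finset.sum_smul]
  refine Finset.sum_congr rfl fun c hc => ?_
  rw [Finset.mul_sum, Finset.sum_mul, Finset.sum_smul]
  refine Finset.sum_congr rfl fun r hr => ?_
  rw [mul_smul_comm, smul_mul_assoc, hκ c (Finset.mem_filter.1 hc).2 r (Finset.mem_filter.1 hr).2,
    smul_smul]

/-! ### Characters as signed counts -/

theorem coeff_symmetrizer (R C : Finset (Perm (Fin n))) (g : Perm (Fin n)) :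
    (plainSum R * signedSum C).coeff g =
      ((∑ r ∈ R, ∑ c ∈ C, if r * c = g then (Perm.sign c : ℤ) else 0 : ℤ) : ℂ) := by
  have : plainSum R * signedSum C = ∑ r ∈ R, ∑ c ∈ C, MonoidAlgebra.single (r * c)
      ((Perm.sign c : ℤ) : ℂ) := by
    rw [plainSum, signedSum, Finset.sum_mul_sum]
    refine Finset.sum_congr rfl fun r _ => Finset.sum_congr rfl fun c _ => ?_
    rw [mul_smul_comm, ← map_mul, MonoidAlgebra.of_apply, MonoidAlgebra.smul_single', mul_one]
  rw [this, MonoidAlgebra.coeff_sum, Finset.sum_apply']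
  push_cast
  refine Finset.sum_congr rfl fun r _ => ?_
  rw [MonoidAlgebra.coeff_sum, Finset.sum_apply']
  refine Finset.sum_congr rfl fun c _ => ?_
  rw [MonoidAlgebra.coeff_single, Finsupp.single_apply]

/-- A permutation is conjugate to its inverse, so the solutions `h` are absent or form a coset of
the centralizer of `g`. -/
theorem card_conj_eq (g x : Perm (Fin n)) :
    (Finset.univ.filter fun h : Perm (Fin n) => h⁻¹ * g⁻¹ * h = x).card =
      if IsConj x g then (Finset.univ.filter fun h : Perm (Fin n) => h * g = g * h).card else 0 := by
  have hg : IsConj g⁻¹ g := Perm.isConj_iff_cycleType_eq.2 (Perm.cycleType_inv g)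
  split_ifs with hx
  · obtain ⟨k, hk⟩ := isConj_iff.1 (hg.trans hx.symm)
    have hxk : x = k * g⁻¹ * k⁻¹ := hk.symm
    refine Finset.card_equiv (Equiv.mulRight k) fun h => ?_
    rw [Finset.mem_filter, Finset.mem_filter, Equiv.coe_mulRight, hxk]
    simp only [Finset.mem_univ, true_and]
    constructor
    · intro e
      have : g⁻¹ = (h * k) * g⁻¹ * (h * k)⁻¹ := by
        calc g⁻¹ = h * (h⁻¹ * g⁻¹ * h) * h⁻¹ := by group
          _ = _ := by rw [e]; group
      have e2 : g = (h * k) * g * (h * k)⁻¹ := by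
        rw [← inv_inj, this]; group
      calc h * k * g = ((h * k) * g * (h * k)⁻¹) * (h * k) := by group
        _ = _ := by rw [← e2]
    · intro e
      have e2 : g = (h * k) * g * (h * k)⁻¹ := by rw [e]; group
      calc h⁻¹ * g⁻¹ * h = h⁻¹ * ((h * k) * g * (h * k)⁻¹)⁻¹ * h := by rw [← e2]
        _ = _ := by group
  · rw [Finset.card_eq_zero, Finset.filter_eq_empty_iff]
    rintro h - rfl
    apply hx
    refine IsConj.trans (isConj_iff.2 ⟨h, ?_⟩) hg
    group

/-- Up to the order of the centralizer, the sum is the signed number of products `r * c` conjugate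
to `g`, an integer that can be computed. -/
theorem sum_coeff_symmetrizer_ne_zero_iff (R C : Finset (Perm (Fin n))) (g : Perm (Fin n)) :
    ∑ h : Perm (Fin n), (plainSum R * signedSum C).coeff (h⁻¹ * g⁻¹ * h) ≠ 0 ↔
      ∑ r ∈ R, ∑ c ∈ C, (if IsConj (r * c) g then (Perm.sign c : ℤ) else 0) ≠ 0 := by
  have e : ∑ h : Perm (Fin n), (plainSum R * signedSum C).coeff (h⁻¹ * g⁻¹ * h) =
      (((Finset.univ.filter fun h : Perm (Fin n) => h * g = g * h).card *
        ∑ r ∈ R, ∑ c ∈ C, (if IsConj (r * c) g then (Perm.sign c : ℤ) else 0) : ℤ) : ℂ) := by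
    simp only [coeff_symmetrizer]
    rw [← Int.cast_sum, Finset.sum_comm, Finset.mul_sum]
    congr 1
    refine Finset.sum_congr rfl fun r _ => ?_
    rw [Finset.sum_comm, Finset.mul_sum]
    refine Finset.sum_congr rfl fun c _ => ?_
    rw [← Finset.sum_filter, Finset.sum_const, nsmul_eq_mul, mul_ite, mul_zero]
    have := card_conj_eq g (r * c)
    simp only [eq_comm (a := r * c)]
    rw [this]
    split_ifs <;> simp
  have hne : ((Finset.univ.filter fun h : Perm (Fin n) => h * g = g * h).card : ℤ) ≠ 0 := by
    rw [Nat.cast_ne_zero, Finset.card_ne_zero]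
    exact ⟨1, by simp⟩
  rw [e, Int.cast_ne_zero, mul_ne_zero_iff]
  exact and_iff_right hne

/-- The row of a letter in a tableau with rows of lengths `l`. -/
def rowOf (l : List ℕ) (x : Fin n) : ℕ := (tableauCell l x).1

/-- The column of a letter in a tableau with rows of lengths `l`. -/
def colOf (l : List ℕ) (x : Fin n) : ℕ := (tableauCell l x).2

/-- The stabilizers enter as explicit sets `R` and `C`, so that for a given shape all the hypotheses
are finite computations. -/
theorem symChar_ne_zero_iff {μ : n.Partition} {l : List ℕ}
    (hl : μ.parts.sort (fun a b => b ≤ a) = l) {R C : Finset (Perm (Fin n))}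
    (hR : ∀ g, g ∈ R ↔ g ∈ fiberStabilizer (rowOf l)) (hC : ∀ g, g ∈ C ↔ g ∈ fiberStabilizer (colOf l))
    (h : ∀ c ∈ C, ∀ r ∈ R, (∃ t ∈ R, t * (c * r) ∈ fiberStabilizer (colOf l)) ∨
      ∃ t ∈ R, (c * r)⁻¹ * t * (c * r) ∈ fiberStabilizer (colOf l) ∧ Perm.sign t = -1)
    (h1 : ∑ r ∈ R, ∑ c ∈ C, (if r * c = 1 then (Perm.sign c : ℤ) else 0) ≠ 0)
    (g : Perm (Fin n)) :
    symChar μ g ≠ 0 ↔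
      ∑ r ∈ R, ∑ c ∈ C, (if IsConj (r * c) g then (Perm.sign c : ℤ) else 0) ≠ 0 := by
  have hR' : R = Finset.univ.filter (· ∈ fiberStabilizer (rowOf l)) := by
    ext g; rw [hR, Finset.mem_filter]; simp
  have hC' : C = Finset.univ.filter (· ∈ fiberStabilizer (colOf l)) := by
    ext g; rw [hC, Finset.mem_filter]; simp
  have hy : youngSymmetrizer μ = plainSum R * signedSum C := by
    have e1 : rowStabilizer μ = R := by
      rw [hR', rowStabilizer]
      unfold cell
      rw [hl]
      rfl
    have e2 : columnStabilizer μ = C := by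
      rw [hC', columnStabilizer]
      unfold cell
      rw [hl]
      rfl
    rw [youngSymmetrizer, e1, e2]
    rfl
  obtain ⟨κ, hκ⟩ := exists_symmetrizer_mul_self (R := fiberStabilizer (rowOf l))
    (C := fiberStabilizer (colOf l)) (by
      intro c hc r hr
      rcases h c ((hC c).2 hc) r ((hR r).2 hr) with ⟨t, ht, h⟩ | ⟨t, ht, h⟩
      · exact Or.inl ⟨t, (hR t).1 ht, h⟩
      · exact Or.inr ⟨t, (hR t).1 ht, h⟩)
  rw [← hR', ← hC', ← hy] at hκ
  rw [symChar, trace_span_ne_zero_iff hκ, hy, sum_coeff_symmetrizer_ne_zero_iff]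
  rw [hy, coeff_symmetrizer, Int.cast_ne_zero]
  exact h1

end Symmetrizer

end UnitaryClasses

namespace UnitaryClasses
open Equiv

/-! ### The characters of triangular partitions -/

/-- The numbers of fixed points of `g`, `g²` and `g³`. -/
def fixCounts {n : ℕ} (g : Perm (Fin n)) : ℕ × ℕ × ℕ :=
  ((List.finRange n).countP fun x => g x = x, (List.finRange n).countP fun x => g (g x) = x,
    (List.finRange n).countP fun x => g (g (g x)) = x)

theorem countP_finRange {n : ℕ} (p : Fin n → Prop) [DecidablePred p] :
    (List.finRange n).countP (fun x => p x) = (Finset.univ.filter p).card := by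
  rw [List.countP_eq_length_filter]
  rfl

theorem fixCounts_eq {n : ℕ} (g : Perm (Fin n)) :
    fixCounts g = (n - g.cycleType.sum, n - g.cycleType.sum + 2 * g.cycleType.count 2,
      n - g.cycleType.sum + 3 * g.cycleType.count 3) := by
  have h1 : (Finset.univ.filter fun x => g x = x).card = n - g.cycleType.sum := by
    have := card_fixed g
    omega
  have hp : ∀ {p} (_ : p.Prime), (Finset.univ.filter fun x => (g ^ p) x = x).card =
      n - g.cycleType.sum + p * g.cycleType.count p := by
    intro p hp
    rw [← h1, ← card_sz_eq g hp.two_le, ← Finset.card_union_of_disjoint]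
    · congr 1
      ext x
      simp only [Finset.mem_filter, Finset.mem_union, Finset.mem_univ, true_and]
      rw [pow_apply_eq_self_iff, Nat.dvd_prime hp, sz_eq_one_iff]
    · rw [Finset.disjoint_filter]
      intro x _ hx
      rw [sz_eq_one_iff.2 hx]
      exact hp.one_lt.ne
  rw [fixCounts, countP_finRange, countP_finRange, countP_finRange, h1]
  congr 1
  congr 1
  · exact hp Nat.prime_two
  · exact hp Nat.prime_three

theorem sum_eq_of_le_six {s : Multiset ℕ} (h2 : ∀ m ∈ s, 2 ≤ m) (h6 : s.sum ≤ 6) :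
    s.sum = 2 * s.count 2 + 3 * s.count 3 + 4 * s.count 4 + 5 * s.count 5 + 6 * s.count 6 := by
  have := Finset.sum_multiset_count_of_subset s (Finset.Icc 2 6) (by
    intro m hm
    rw [Multiset.mem_toFinset] at hm
    have := Multiset.le_sum_of_mem hm
    exact Finset.mem_Icc.2 ⟨h2 m hm, by omega⟩)
  rw [this]
  simp only [smul_eq_mul, show Finset.Icc 2 6 = {2, 3, 4, 5, 6} from rfl]
  repeat rw [Finset.sum_insert (by decide)]
  rw [Finset.sum_singleton]
  ring

theorem eq_of_count_eq {s t : Multiset ℕ} (hs2 : ∀ m ∈ s, 2 ≤ m) (ht2 : ∀ m ∈ t, 2 ≤ m)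
    (hs : s.sum ≤ 6) (ht : t.sum ≤ 6) (h2 : s.count 2 = t.count 2) (h3 : s.count 3 = t.count 3)
    (h4 : s.count 4 = t.count 4) (h5 : s.count 5 = t.count 5) (h6 : s.count 6 = t.count 6) :
    s = t := by
  ext m
  by_cases hm : 2 ≤ m ∧ m ≤ 6
  · obtain ⟨h, h'⟩ := hm
    interval_cases m <;> assumption
  · rw [Multiset.count_eq_zero_of_notMem, Multiset.count_eq_zero_of_notMem]
    · intro h
      have := ht2 m h
      have := Multiset.le_sum_of_mem h
      omega
    · intro h
      have := hs2 m h
      have := Multiset.le_sum_of_mem h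
      omega

theorem sum_cycleType_le' {n : ℕ} (g : Perm (Fin n)) : g.cycleType.sum ≤ n := by
  have := card_fixed g
  omega

theorem eq_of_weighted_sum_eq {a b c a' b' c' : ℕ}
    (h : 4 * a + 5 * b + 6 * c = 4 * a' + 5 * b' + 6 * c') (h6 : 4 * a + 5 * b + 6 * c ≤ 6) :
    a = a' ∧ b = b' ∧ c = c' := by
  have : a ≤ 1 ∧ b ≤ 1 ∧ c ≤ 1 ∧ a' ≤ 1 ∧ b' ≤ 1 ∧ c' ≤ 1 := by omega
  obtain ⟨h1, h2, h3, h4, h5, h7⟩ := this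
  interval_cases a <;> interval_cases b <;> interval_cases c <;> omega

/-- The three numbers give the numbers of cycles of length `1`, `2`, `3`. On at most six letters the
remaining total `4a + 5b + 6c` determines the longer cycles. -/
theorem isConj_iff_fixCounts {n : ℕ} (hn : n ≤ 6) {g h : Perm (Fin n)} :
    IsConj g h ↔ fixCounts g = fixCounts h := by
  rw [Perm.isConj_iff_cycleType_eq]
  have hg := sum_cycleType_le' g
  have hh := sum_cycleType_le' h
  constructor
  · intro e
    rw [fixCounts_eq, fixCounts_eq, e]
  · intro e
    rw [fixCounts_eq, fixCounts_eq, Prod.mk.injEq, Prod.mk.injEq] at e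
    have g2 : ∀ m ∈ g.cycleType, 2 ≤ m := fun m => Perm.two_le_of_mem_cycleType
    have h2 : ∀ m ∈ h.cycleType, 2 ≤ m := fun m => Perm.two_le_of_mem_cycleType
    have e1 := sum_eq_of_le_six g2 (by omega)
    have e2 := sum_eq_of_le_six h2 (by omega)
    obtain ⟨e3, e4, e5⟩ := eq_of_weighted_sum_eq (a := g.cycleType.count 4) (b := g.cycleType.count 5)
      (c := g.cycleType.count 6) (a' := h.cycleType.count 4) (b' := h.cycleType.count 5)
      (c' := h.cycleType.count 6) (by omega) (by omega)
    apply eq_of_count_eq g2 h2 <;> omega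

/-! ### Computation with lists of values -/

/-- The values of a permutation. -/
def values {n : ℕ} (g : Perm (Fin n)) : List ℕ := (List.finRange n).map fun x => (g x : ℕ)

/-- `fixCounts` of the product of two permutations given by their values. -/
def fixCountsMul (u v : List ℕ) : ℕ × ℕ × ℕ :=
  let f : ℕ → ℕ := fun x => u.getD (v.getD x 0) 0
  ((List.range u.length).countP fun x => f x == x, (List.range u.length).countP fun x => f (f x) == x,
    (List.range u.length).countP fun x => f (f (f x)) == x)

theorem values_getD {n : ℕ} (g : Perm (Fin n)) (x : Fin n) : (values g).getD x 0 = g x := by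
  simp [values]

theorem fixCountsMul_values {n : ℕ} (g h : Perm (Fin n)) :
    fixCountsMul (values g) (values h) = fixCounts (g * h) := by
  have hlen : (values g).length = n := by simp [values]
  rw [fixCountsMul, fixCounts, hlen, ← List.map_coe_finRange_eq_range, List.countP_map,
    List.countP_map, List.countP_map]
  simp only [Function.comp_def, values_getD, ← Fin.ext_iff, beq_eq_decide, Perm.mul_apply]
  rfl

/-- The signed count, over the products of two sets of permutations, of those with given
`fixCounts`. -/
def signedCount (U : List (List ℕ)) (V : List (List ℕ × ℤ)) (P : ℕ × ℕ × ℕ) : ℤ :=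
  (U.map fun u => (V.map fun v => if fixCountsMul u v.1 = P then v.2 else 0).sum).sum

theorem sum_isConj_eq {n : ℕ} (hn : n ≤ 6) {R C : List (Perm (Fin n))} (hR : R.Nodup) (hC : C.Nodup)
    (g : Perm (Fin n)) :
    ∑ r ∈ R.toFinset, ∑ c ∈ C.toFinset, (if IsConj (r * c) g then (Perm.sign c : ℤ) else 0) =
      signedCount (R.map values) (C.map fun c => (values c, (Perm.sign c : ℤ))) (fixCounts g) := by
  rw [List.sum_toFinset _ hR, signedCount, List.map_map]
  congr 2
  ext r
  rw [List.sum_toFinset _ hC, Function.comp_apply, List.map_map]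
  congr 2
  ext c
  simp only [Function.comp_apply, fixCountsMul_values, isConj_iff_fixCounts hn]

theorem mem_of_signedCount_ne_zero {U : List (List ℕ)} {V : List (List ℕ × ℤ)} {P : ℕ × ℕ × ℕ}
    (h : signedCount U V P ≠ 0) : ∃ u ∈ U, ∃ v ∈ V, fixCountsMul u v.1 = P := by
  by_contra! hc
  apply h
  rw [signedCount]
  apply List.sum_eq_zero
  intro x hx
  obtain ⟨u, hu, rfl⟩ := List.mem_map.1 hx
  apply List.sum_eq_zero
  intro x hx
  obtain ⟨v, hv, rfl⟩ := List.mem_map.1 hx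
  rw [if_neg (hc u hu v hv)]

/-- The symmetric group of three letters. -/
def permsThree {n : ℕ} (a b c : Fin n) : List (Perm (Fin n)) :=
  [1, swap a b, swap a c, swap b c, swap a b * swap b c, swap b c * swap a b]

/-- The row stabilizer of the tableau of shape `(3, 2, 1)`. -/
def rowsSix : List (Perm (Fin 6)) :=
  permsThree 0 1 2 ++ (permsThree 0 1 2).map (· * swap 3 4)

/-- The column stabilizer of the tableau of shape `(3, 2, 1)`. -/
def columnsSix : List (Perm (Fin 6)) :=
  permsThree 0 3 5 ++ (permsThree 0 3 5).map (· * swap 1 4)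

theorem mem_rowsSix (g : Perm (Fin 6)) :
    g ∈ rowsSix.toFinset ↔ g ∈ fiberStabilizer (rowOf [3, 2, 1]) := by
  rw [List.mem_toFinset]
  constructor
  · revert g
    decide +kernel
  · revert g
    decide +kernel

theorem mem_columnsSix (g : Perm (Fin 6)) :
    g ∈ columnsSix.toFinset ↔ g ∈ fiberStabilizer (colOf [3, 2, 1]) := by
  rw [List.mem_toFinset]
  constructor
  · revert g
    decide +kernel
  · revert g
    decide +kernel

/-- Von Neumann's dichotomy for the shape `(3, 2, 1)`; in the first alternative transpositions of
the rows already suffice. -/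
theorem transfer_six : ∀ c ∈ columnsSix, ∀ r ∈ rowsSix,
    (∃ t ∈ ([swap 0 1, swap 0 2, swap 1 2, swap 3 4] : List (Perm (Fin 6))),
      (c * r)⁻¹ * t * (c * r) ∈ fiberStabilizer (colOf [3, 2, 1])) ∨
      ∃ t ∈ rowsSix, t * (c * r) ∈ fiberStabilizer (colOf [3, 2, 1]) := by
  decide +kernel

theorem transposition_six : ∀ t ∈ ([swap 0 1, swap 0 2, swap 1 2, swap 3 4] : List (Perm (Fin 6))),
    t ∈ rowsSix ∧ Perm.sign t = -1 := by
  decide +kernel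

theorem nodup_six : rowsSix.Nodup ∧ columnsSix.Nodup := by
  decide +kernel

theorem coeff_one_six : ∑ r ∈ rowsSix.toFinset, ∑ c ∈ columnsSix.toFinset,
    (if r * c = 1 then (Perm.sign c : ℤ) else 0) ≠ 0 := by
  decide +kernel

/-- The values of the elements of `rowsSix`. -/
def rowValues : List (List ℕ) :=
    [[0, 1, 2, 3, 4, 5], [1, 0, 2, 3, 4, 5], [2, 1, 0, 3, 4, 5], [0, 2, 1, 3, 4, 5],
      [1, 2, 0, 3, 4, 5], [2, 0, 1, 3, 4, 5], [0, 1, 2, 4, 3, 5], [1, 0, 2, 4, 3, 5],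
      [2, 1, 0, 4, 3, 5], [0, 2, 1, 4, 3, 5], [1, 2, 0, 4, 3, 5], [2, 0, 1, 4, 3, 5]]

/-- The values and the signs of the elements of `columnsSix`. -/
def columnValues : List (List ℕ × ℤ) :=
    [([0, 1, 2, 3, 4, 5], 1), ([3, 1, 2, 0, 4, 5], -1), ([5, 1, 2, 3, 4, 0], -1),
      ([0, 1, 2, 5, 4, 3], -1), ([3, 1, 2, 5, 4, 0], 1), ([5, 1, 2, 0, 4, 3], 1),
      ([0, 4, 2, 3, 1, 5], -1), ([3, 4, 2, 0, 1, 5], 1), ([5, 4, 2, 3, 1, 0], 1),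
      ([0, 4, 2, 5, 1, 3], 1), ([3, 4, 2, 5, 1, 0], -1), ([5, 4, 2, 0, 1, 3], -1)]

theorem values_rowsSix : rowsSix.map values = rowValues := by
  decide +kernel

theorem values_columnsSix : columnsSix.map (fun c => (values c, (Perm.sign c : ℤ))) =
    columnValues := by
  decide +kernel

/-- The `fixCounts` of the elements of `S₆` all of whose cycles have length `1`, `3` or `5`. -/
def oddCounts : List (ℕ × ℕ × ℕ) := [(6, 6, 6), (3, 3, 6), (0, 0, 6), (1, 1, 1)]

/-- The other `fixCounts` of elements of `S₆`. -/
def evenCounts : List (ℕ × ℕ × ℕ) :=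
  [(4, 6, 4), (2, 6, 2), (0, 6, 0), (2, 2, 2), (0, 2, 0), (0, 0, 0), (1, 3, 4)]

theorem fixCountsMul_six :
    ∀ u ∈ rowValues, ∀ v ∈ columnValues, fixCountsMul u v.1 ∈ oddCounts ++ evenCounts := by
  decide +kernel

theorem signedCount_evenCounts : ∀ P ∈ evenCounts, signedCount rowValues columnValues P = 0 := by
  decide +kernel

theorem signedCount_oddCounts : ∀ P ∈ oddCounts, signedCount rowValues columnValues P ≠ 0 := by
  decide +kernel

/-- Only triples realized by a product of a row and a column permutation can have a nonzero count,
which leaves eleven triples to be evaluated. -/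
theorem signedCount_six (P : ℕ × ℕ × ℕ) : signedCount (rowsSix.map values)
    (columnsSix.map fun c => (values c, (Perm.sign c : ℤ))) P ≠ 0 ↔ P ∈ oddCounts := by
  rw [values_rowsSix, values_columnsSix]
  constructor
  · intro h
    obtain ⟨u, hu, v, hv, hP⟩ := mem_of_signedCount_ne_zero h
    have hmem : P ∈ oddCounts ++ evenCounts := by
      rw [← hP]
      exact fixCountsMul_six u hu v hv
    rcases List.mem_append.1 hmem with hm | hm
    · exact hm
    · exfalso
      exact h (signedCount_evenCounts P hm)
  · exact signedCount_oddCounts P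

theorem fixCounts_mem_oddCounts_iff (g : Perm (Fin 6)) :
    fixCounts g ∈ oddCounts ↔ ∃ e f, g.cycleType = fiveThree e f := by
  have h2 : ∀ m ∈ g.cycleType, 2 ≤ m := fun m => Perm.two_le_of_mem_cycleType
  have hs := sum_cycleType_le' g
  have hsum := sum_eq_of_le_six h2 hs
  have hc : ∀ e f m, (fiveThree e f).count m = (if 5 = m then e else 0) + if 3 = m then f else 0 := by
    intro e f m
    rw [fiveThree, Multiset.count_add, Multiset.count_replicate, Multiset.count_replicate]
  rw [fixCounts_eq]
  simp only [oddCounts, List.mem_cons, List.not_mem_nil, or_false, Prod.mk.injEq]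
  constructor
  · intro h
    have h46 : g.cycleType.count 4 = 0 ∧ g.cycleType.count 6 = 0 := by
      have h5 : g.cycleType.count 5 ≤ 1 := by omega
      have h4 : g.cycleType.count 4 ≤ 1 := by omega
      have h6 : g.cycleType.count 6 ≤ 1 := by omega
      generalize g.cycleType.count 5 = b at *
      generalize g.cycleType.count 4 = a at *
      generalize g.cycleType.count 6 = c at *
      interval_cases a <;> interval_cases b <;> interval_cases c <;> omega
    refine ⟨g.cycleType.count 5, g.cycleType.count 3, ?_⟩
    have hm : ∀ m ∈ fiveThree (g.cycleType.count 5) (g.cycleType.count 3), 2 ≤ m := by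
      intro m hm
      rcases mem_fiveThree hm with h | h <;> omega
    apply eq_of_count_eq h2 hm hs (by rw [sum_fiveThree]; omega) <;> rw [hc] <;>
      split_ifs <;> omega
  · rintro ⟨e, f, h⟩
    rw [h, sum_fiveThree] at hs
    rw [h, sum_fiveThree, hc, hc]
    simp
    have : e ≤ 1 := by omega
    have : f ≤ 2 := by omega
    interval_cases e <;> interval_cases f <;> simp_all

/-- A triangular partition has no rim hook of even length, which is the conceptual reason for
vanishing at even cycles; here the vanishing and the nonvanishing are both read off from the signed
counts. -/
theorem symChar_six {μ : Nat.Partition 6} (hl : μ.parts.sort (fun a b => b ≤ a) = [3, 2, 1])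
    (g : Perm (Fin 6)) : symChar μ g ≠ 0 ↔ ∃ e f, g.cycleType = fiveThree e f := by
  rw [symChar_ne_zero_iff hl mem_rowsSix mem_columnsSix _ coeff_one_six,
    sum_isConj_eq le_rfl nodup_six.1 nodup_six.2, signedCount_six, fixCounts_mem_oddCounts_iff]
  intro c hc r hr
  rcases transfer_six c (List.mem_toFinset.1 hc) r (List.mem_toFinset.1 hr) with
    ⟨t, ht, h⟩ | ⟨t, ht, h⟩
  · obtain ⟨h1, h2⟩ := transposition_six t ht
    exact Or.inr ⟨t, List.mem_toFinset.2 h1, h, h2⟩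
  · exact Or.inl ⟨t, List.mem_toFinset.2 ht, h⟩

theorem symChar_three {μ : Nat.Partition 3} (hl : μ.parts.sort (fun a b => b ≤ a) = [2, 1])
    (g : Perm (Fin 3)) : symChar μ g ≠ 0 ↔ ∃ e f, g.cycleType = fiveThree e f := by
  rw [symChar_ne_zero_iff (R := {1, swap 0 1}) (C := {1, swap 0 2}) hl (by decide) (by decide)
    (by decide) (by decide)]
  have h3 : ∀ g : Perm (Fin 3), ∑ r ∈ {1, swap 0 1}, ∑ c ∈ {1, swap 0 2},
      (if IsConj (r * c) g then (Perm.sign c : ℤ) else 0) ≠ 0 ↔ g ^ 3 = 1 := by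
    decide +kernel
  rw [h3]
  constructor
  · intro h
    have : Fact (Nat.Prime 3) := ⟨Nat.prime_three⟩
    refine ⟨0, Multiset.card g.cycleType, ?_⟩
    rw [fiveThree, Multiset.replicate_zero, zero_add]
    exact Perm.cycleType_of_pow_prime_eq_one h
  · rintro ⟨e, f, h⟩
    have h15 := pow_eq_one_of_fiveThree h
    revert h15
    clear h
    revert g
    decide +kernel

theorem symChar_one {μ : Nat.Partition 1} (hl : μ.parts.sort (fun a b => b ≤ a) = [1])
    (g : Perm (Fin 1)) : symChar μ g ≠ 0 ↔ ∃ e f, g.cycleType = fiveThree e f := by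
  rw [symChar_ne_zero_iff (R := {1}) (C := {1}) hl (by decide) (by decide)
    (by decide) (by decide)]
  obtain rfl : g = 1 := Subsingleton.elim _ _
  simp
  exact ⟨0, 0, rfl⟩

theorem sort_parts_triangular (d : ℕ) : (triangular d).parts.sort (fun a b => b ≤ a) =
    ((List.range d).map (· + 1)).reverse := by
  apply List.Perm.eq_of_pairwise (le := fun a b => b ≤ a)
  · intro a b _ _ h1 h2
    exact le_antisymm h2 h1
  · exact Multiset.pairwise_sort _ _
  · rw [List.pairwise_reverse, List.pairwise_map]
    exact List.pairwise_lt_range.imp fun h => by omega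
  · rw [← Multiset.coe_eq_coe, Multiset.sort_eq, triangular, Multiset.coe_reverse]
    rfl

theorem part_triangular (d k : ℕ) : part (triangular d) k = d - k := by
  rw [part, sort_parts_triangular]
  by_cases hk : k < d
  · rw [List.getD_eq_getElem _ _ (by simpa using hk)]
    simp
    omega
  · rw [List.getD_eq_default _ _ (by simpa using hk)]
    omega

theorem symChar_triangular_ne_zero_iff {d : ℕ} (h0 : 0 < d) (h3 : d ≤ 3)
    (g : Perm (Fin (triSize d))) :
    symChar (triangular d) g ≠ 0 ↔ ∃ e f, g.cycleType = fiveThree e f := by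
  have hs := sort_parts_triangular d
  interval_cases d
  · exact symChar_one hs g
  · exact symChar_three hs g
  · exact symChar_six hs g

end UnitaryClasses

namespace UnitaryClasses
open Equiv

/-! ### Young subgroups -/

section Young
variable {m n : ℕ} {N : Fin m → ℕ} (h : ∑ i, N i = n) (w : ∀ i, Perm (Fin (N i)))

/-- The letters of the `i`-th factor of a Young subgroup. -/
def youngEquiv : (Σ i, Fin (N i)) ≃ Fin n := finSigmaFinEquiv.trans (finCongr h)

theorem youngElement_pow_apply (k : ℕ) (i : Fin m) (x : Fin (N i)) :
    (youngElement N h w ^ k) (youngEquiv h ⟨i, x⟩) = youngEquiv h ⟨i, (w i ^ k) x⟩ := by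
  induction k with
  | zero => rfl
  | succ k ih =>
    rw [pow_succ', Perm.mul_apply, ih, pow_succ', Perm.mul_apply]
    unfold youngElement
    rw [Equiv.permCongr_apply]
    change youngEquiv h _ = _
    congr 1
    change Perm.sigmaCongrRight w ((youngEquiv h).symm (youngEquiv h _)) = _
    rw [symm_apply_apply]
    rfl

theorem sz_youngElement (i : Fin m) (x : Fin (N i)) :
    sz (youngElement N h w) (youngEquiv h ⟨i, x⟩) = sz (w i) x := by
  have key : ∀ k, sz (youngElement N h w) (youngEquiv h ⟨i, x⟩) ∣ k ↔ sz (w i) x ∣ k := by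
    intro k
    rw [← pow_apply_eq_self_iff, ← pow_apply_eq_self_iff, youngElement_pow_apply,
      EmbeddingLike.apply_eq_iff_eq]
    simp
  exact Nat.dvd_antisymm ((key _).2 dvd_rfl) ((key _).1 dvd_rfl)

/-- For each `r ≥ 2` the letters in cycles of size `r` are counted, factor by factor. -/
theorem cycleType_youngElement : (youngElement N h w).cycleType = ∑ i, (w i).cycleType := by
  ext r
  rw [Multiset.count_sum']
  by_cases hr : 2 ≤ r
  · apply Nat.eq_of_mul_eq_mul_left (show 0 < r by omega)
    rw [← card_sz_eq _ hr, Finset.mul_sum]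
    have e : ∀ i, r * (w i).cycleType.count r = (Finset.univ.filter fun x => sz (w i) x = r).card :=
      fun i => (card_sz_eq _ hr).symm
    simp only [e]
    rw [← Finset.card_sigma]
    symm
    refine Finset.card_equiv (youngEquiv h) ?_
    rintro ⟨i, x⟩
    simp [sz_youngElement]
  · rw [Multiset.count_eq_zero_of_notMem fun hm => hr (Perm.two_le_of_mem_cycleType hm),
      Finset.sum_eq_zero fun i _ => Multiset.count_eq_zero_of_notMem fun hm =>
        hr (Perm.two_le_of_mem_cycleType hm)]

end Young

/-! ### Multipartitions with members of size at most `6` -/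

theorem fiveThree_add (e f e' f' : ℕ) : fiveThree e f + fiveThree e' f' = fiveThree (e + e') (f + f') := by
  simp only [fiveThree, Multiset.replicate_add]
  abel

theorem sum_fiveThree_eq {ι : Type*} (s : Finset ι) (e f : ι → ℕ) :
    ∑ i ∈ s, fiveThree (e i) (f i) = fiveThree (∑ i ∈ s, e i) (∑ i ∈ s, f i) := by
  classical
  induction s using Finset.induction_on with
  | empty => rfl
  | insert a s ha ih => rw [Finset.sum_insert ha, Finset.sum_insert ha, Finset.sum_insert ha, ih,
      fiveThree_add]

theorem exists_sum_eq {m : ℕ} (c : Fin m → ℕ) {k : ℕ} (hk : k ≤ ∑ i, c i) :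
    ∃ g : Fin m → ℕ, (∀ i, g i ≤ c i) ∧ ∑ i, g i = k := by
  induction k with
  | zero => exact ⟨0, fun _ => Nat.zero_le _, by simp⟩
  | succ k ih =>
    obtain ⟨g, hg, hs⟩ := ih (by omega)
    obtain ⟨i, -, hi⟩ := Finset.exists_lt_of_sum_lt (s := Finset.univ) (f := g) (g := c) (by omega)
    refine ⟨Function.update g i (g i + 1), fun j => ?_, ?_⟩
    · by_cases hj : j = i
      · subst hj
        rw [Function.update_self]
        exact hi
      · rw [Function.update_of_ne hj]
        exact hg j
    · rw [Finset.sum_update_of_mem (Finset.mem_univ i), ← hs,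
        ← Finset.add_sum_erase _ g (Finset.mem_univ i), Finset.sdiff_singleton_eq_erase]
      ring

/-- Both sides say that the cell in row `k` and column `j` belongs to the diagram. -/
theorem lt_part_iff {n : ℕ} (μ : n.Partition) (j k : ℕ) : j < part μ k ↔ k < dualPart μ j := by
  have key : ∀ l : List ℕ, l.Pairwise (fun a b => b ≤ a) →
      ∀ k, j < l.getD k 0 ↔ k < l.countP (j < ·) := by
    intro l hl
    induction l with
    | nil => simp
    | cons a l ih =>
      rw [List.pairwise_cons] at hl
      intro k
      have h0 : ¬ j < a → l.countP (j < ·) = 0 := by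
        intro ha
        rw [List.countP_eq_zero]
        intro b hb
        have := hl.1 b hb
        simp only [decide_eq_true_eq]
        omega
      rw [List.countP_cons]
      cases k with
      | zero =>
        rw [List.getD_cons_zero]
        by_cases ha : j < a
        · simp [ha]
        · rw [h0 ha]
          simp [ha]
      | succ k =>
        rw [List.getD_cons_succ, ih hl.2]
        by_cases ha : j < a
        · simp [ha]
        · rw [h0 ha]
          simp [ha]
  rw [part, key _ (Multiset.pairwise_sort _ _), dualPart, ← Multiset.countP_eq_card_filter]
  conv_rhs => rw [← Multiset.sort_eq μ.parts (fun a b => b ≤ a)]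
  rw [Multiset.coe_countP]

theorem sum_part_eq {n : ℕ} {μ : n.Partition} (h : dualPart μ 3 = 0) (r : ℕ) :
    ∑ k ∈ Finset.range r, part μ k =
      min r (dualPart μ 0) + min r (dualPart μ 1) + min r (dualPart μ 2) := by
  induction r with
  | zero => simp
  | succ r ih =>
    rw [Finset.sum_range_succ, ih]
    have h0 := lt_part_iff μ 0 r
    have h1 := lt_part_iff μ 1 r
    have h2 := lt_part_iff μ 2 r
    have h3 := lt_part_iff μ 3 r
    omega

theorem sum_dualPart {n : ℕ} {μ : n.Partition} (h : dualPart μ 3 = 0) :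
    dualPart μ 0 + dualPart μ 1 + dualPart μ 2 = n := by
  have key : ∀ s : Multiset ℕ, (s.filter (3 < ·)).card = 0 → (s.filter (0 < ·)).card +
      (s.filter (1 < ·)).card + (s.filter (2 < ·)).card = s.sum := by
    intro s
    induction s using Multiset.induction_on with
    | empty => simp
    | cons a s ih =>
      simp only [← Multiset.countP_eq_card_filter, Multiset.countP_cons, Multiset.sum_cons] at *
      intro h
      have := ih (by omega)
      split_ifs at * <;> omega
  exact (key _ h).trans μ.parts_sum

section Encoding
variable {n m : ℕ} {μ : n.Partition} {d : Fin m → ℕ}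

theorem IsTriangularMultipartition.dualPart_eq (hd : IsTriangularMultipartition d μ) (k : ℕ) :
    dualPart μ k = ∑ i, (d i - k) := by
  rw [hd.2]
  simp only [part_triangular]

theorem IsTriangularMultipartition.le_three (hd : IsTriangularMultipartition d μ)
    (h : dualPart μ 3 = 0) (i : Fin m) : d i ≤ 3 := by
  rw [hd.dualPart_eq, Finset.sum_eq_zero_iff] at h
  have := h i (Finset.mem_univ i)
  omega

theorem IsTriangularMultipartition.sum_triSize (hd : IsTriangularMultipartition d μ)
    (h : dualPart μ 3 = 0) : ∑ i, triSize (d i) = n := by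
  rw [← sum_dualPart h, hd.dualPart_eq, hd.dualPart_eq, hd.dualPart_eq, ← Finset.sum_add_distrib,
    ← Finset.sum_add_distrib]
  refine Finset.sum_congr rfl fun i _ => ?_
  have h1 := hd.1 i
  have h3 := hd.le_three h i
  interval_cases d i <;> rfl

theorem IsTriangularMultipartition.cycleType_sigma (hd : IsTriangularMultipartition d μ)
    (h : dualPart μ 3 = 0) : (sigma n (barParts d)).cycleType =
      fiveThree (dualPart μ 2) (dualPart μ 1 - 2 * dualPart μ 2) := by
  have hb : ∀ i, barBlock (triSize (d i)) = {1} ∧ d i = 1 ∨ barBlock (triSize (d i)) = {3} ∧ d i = 2 ∨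
      barBlock (triSize (d i)) = {5, 1} ∧ d i = 3 := by
    intro i
    have h1 := hd.1 i
    have h3 := hd.le_three h i
    interval_cases d i <;> decide
  have hodd : ∀ r ∈ barParts d, Odd r := by
    intro r hr
    rw [barParts, Multiset.mem_sort, Multiset.mem_sum] at hr
    obtain ⟨i, -, hi⟩ := hr
    rcases hb i with ⟨e, -⟩ | ⟨e, -⟩ | ⟨e, -⟩ <;> rw [e] at hi
    · rw [Multiset.mem_singleton.1 hi]; decide
    · rw [Multiset.mem_singleton.1 hi]; decide
    · rcases Multiset.mem_cons.1 hi with rfl | hi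
      · decide
      · rw [Multiset.mem_singleton.1 hi]; decide
  have hsum : (barParts d).sum = n := by
    rw [← hd.sum_triSize h, barParts, ← Multiset.sum_coe, Multiset.sort_eq, Multiset.sum_sum]
    refine Finset.sum_congr rfl fun i _ => ?_
    rcases hb i with ⟨e, e'⟩ | ⟨e, e'⟩ | ⟨e, e'⟩ <;> rw [e, e'] <;> rfl
  rw [UnitaryClasses.cycleType_sigma hodd hsum, barParts, Multiset.sort_eq]
  -- The truncated differences are chosen so that `d i = 1, 2, 3` gives no cycle, one `3`-cycle, one
  -- `5`-cycle.
  have e : (∑ i, barBlock (triSize (d i))).filter (1 < ·) =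
      ∑ i, fiveThree (d i - 2) ((d i - 1) - 2 * (d i - 2)) := by
    let φ : Multiset ℕ →+ Multiset ℕ :=
      { toFun := Multiset.filter (1 < ·)
        map_zero' := rfl
        map_add' := Multiset.filter_add _ }
    refine (map_sum φ _ _).trans (Finset.sum_congr rfl fun i _ => ?_)
    change Multiset.filter (1 < ·) _ = _
    rcases hb i with ⟨e, e'⟩ | ⟨e, e'⟩ | ⟨e, e'⟩ <;> rw [e, e'] <;> rfl
  rw [e, sum_fiveThree_eq, hd.dualPart_eq, hd.dualPart_eq]
  congr 1
  apply Nat.eq_sub_of_add_eq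
  rw [Finset.mul_sum, ← Finset.sum_add_distrib]
  refine Finset.sum_congr rfl fun i _ => Nat.sub_add_cancel ?_
  have := hd.le_three h i
  omega

theorem IsTriangularMultipartition.exists_fiveThree_of_mem (hd : IsTriangularMultipartition d μ)
    (h : dualPart μ 3 = 0) (hn : ∑ i, triSize (d i) = n) (w : ∀ i, Perm (Fin (triSize (d i))))
    (hw : ∏ i, symChar (triangular (d i)) (w i) ≠ 0) :
    ∃ e f, (youngElement (fun i => triSize (d i)) hn w).cycleType = fiveThree e f ∧
      e ≤ dualPart μ 2 ∧ f + 2 * e ≤ dualPart μ 1 := by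
  rw [Finset.prod_ne_zero_iff] at hw
  have hw' : ∀ i, ∃ e f, (w i).cycleType = fiveThree e f := fun i =>
    (symChar_triangular_ne_zero_iff (hd.1 i) (hd.le_three h i) (w i)).1 (hw i (Finset.mem_univ i))
  choose e f hef using hw'
  -- Three letters hold at most one `3`-cycle, and six letters hold one `5`-cycle or at most two
  -- `3`-cycles.
  have hcap : ∀ i, e i ≤ d i - 2 ∧ f i + 2 * e i ≤ d i - 1 := by
    intro i
    have := sum_cycleType_le' (w i)
    rw [hef, sum_fiveThree] at this
    have h1 := hd.1 i
    have h3 := hd.le_three h i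
    have hs : triSize 1 = 1 ∧ triSize 2 = 3 ∧ triSize 3 = 6 := by decide
    have hd' : d i = 1 ∨ d i = 2 ∨ d i = 3 := by omega
    rcases hd' with hd' | hd' | hd' <;> rw [hd'] at this ⊢ <;> omega
  refine ⟨∑ i, e i, ∑ i, f i, ?_, ?_, ?_⟩
  · rw [cycleType_youngElement, ← sum_fiveThree_eq]
    exact Finset.sum_congr rfl fun i _ => hef i
  · rw [hd.dualPart_eq]
    exact Finset.sum_le_sum fun i _ => (hcap i).1
  · rw [hd.dualPart_eq, Finset.mul_sum, ← Finset.sum_add_distrib]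
    exact Finset.sum_le_sum fun i _ => (hcap i).2

/-- The `5`-cycles are distributed first, over the factors with six letters; the `3`-cycles then fit
into the remaining capacity. -/
theorem IsTriangularMultipartition.exists_mem_of_fiveThree (hd : IsTriangularMultipartition d μ)
    (h : dualPart μ 3 = 0) (hn : ∑ i, triSize (d i) = n) {e f : ℕ} (he : e ≤ dualPart μ 2)
    (hf : f + 2 * e ≤ dualPart μ 1) :
    ∃ w : ∀ i, Perm (Fin (triSize (d i))), ∏ i, symChar (triangular (d i)) (w i) ≠ 0 ∧
      (youngElement (fun i => triSize (d i)) hn w).cycleType = fiveThree e f := by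
  rw [hd.dualPart_eq] at he hf
  obtain ⟨e', he', rfl⟩ := exists_sum_eq _ he
  have hcap : ∀ i, 2 * e' i ≤ d i - 1 := by
    intro i
    have := he' i
    have := hd.le_three h i
    omega
  obtain ⟨f', hf', rfl⟩ := exists_sum_eq (fun i => (d i - 1) - 2 * e' i) (k := f) (by
    have : ∑ i, ((d i - 1) - 2 * e' i) + 2 * ∑ i, e' i = ∑ i, (d i - 1) := by
      rw [Finset.mul_sum, ← Finset.sum_add_distrib]
      exact Finset.sum_congr rfl fun i _ => Nat.sub_add_cancel (hcap i)
    omega)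
  have hw : ∀ i, ∃ w : Perm (Fin (triSize (d i))), w.cycleType = fiveThree (e' i) (f' i) := by
    intro i
    rw [Perm.exists_with_cycleType_iff, sum_fiveThree, Fintype.card_fin]
    constructor
    · have h1 := hd.1 i
      have h3 := hd.le_three h i
      have he := he' i
      have hf := hf' i
      have hs : triSize 1 = 1 ∧ triSize 2 = 3 ∧ triSize 3 = 6 := by decide
      have hd' : d i = 1 ∨ d i = 2 ∨ d i = 3 := by omega
      rcases hd' with hd' | hd' | hd' <;> rw [hd'] at he hf ⊢ <;> omega
    · intro a ha
      rcases mem_fiveThree ha with h | h <;> omega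
  choose w hw using hw
  refine ⟨w, ?_, ?_⟩
  · rw [Finset.prod_ne_zero_iff]
    intro i _
    exact (symChar_triangular_ne_zero_iff (hd.1 i) (hd.le_three h i) (w i)).2 ⟨_, _, hw i⟩
  · rw [cycleType_youngElement, ← sum_fiveThree_eq]
    exact Finset.sum_congr rfl fun i _ => hw i

end Encoding

/-! ### The sets of classes in terms of cycle types -/

theorem mem_classSet_iff {n : ℕ} {μ : n.Partition} (hμ : DualIsSumOfTriangular μ)
    (h : dualPart μ 3 = 0) (y : Perm (Fin n)) : fClass (y * w₀ n) ∈ classSet μ ↔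
      ∃ e f, y.cycleType = fiveThree e f ∧ e ≤ dualPart μ 2 ∧ f + 2 * e ≤ dualPart μ 1 := by
  constructor
  · rintro ⟨m, d, hd, hn, w, hw, he⟩
    have hc := Perm.isConj_iff_cycleType_eq.1 (isConj_of_fClass_eq he)
    rw [hc]
    exact hd.exists_fiveThree_of_mem h hn w hw
  · rintro ⟨e, f, hy, he, hf⟩
    obtain ⟨m, d, hd⟩ := hμ
    have hn := hd.sum_triSize h
    obtain ⟨w, hw, hc⟩ := hd.exists_mem_of_fiveThree h hn he hf
    exact ⟨m, d, hd, hn, w, hw, fClass_eq_of_isConj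
      (Perm.isConj_iff_cycleType_eq.2 (hy.trans hc.symm))⟩

theorem exists_eq_fClass {n : ℕ} (w : Perm (Fin n)) : ∃ y, fClass w = fClass (y * w₀ n) :=
  ⟨w * w₀ n, by rw [mul_w₀_mul_w₀]⟩

/-- The first inequality makes the truncated difference in the type of the bar class a true one; the
second one provides the room that is needed for going up. -/
theorem two_mul_dualPart_le {n : ℕ} {μ : n.Partition} (hμ : DualIsSumOfTriangular μ)
    (h : dualPart μ 3 = 0) : 2 * dualPart μ 2 ≤ dualPart μ 1 ∧ 3 * dualPart μ 1 ≤ n := by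
  obtain ⟨m, d, hd⟩ := hμ
  have hs : triSize 1 = 1 ∧ triSize 2 = 3 ∧ triSize 3 = 6 := by decide
  have hle : ∀ i, 2 * (d i - 2) ≤ d i - 1 ∧ 3 * (d i - 1) ≤ triSize (d i) := by
    intro i
    have h1 := hd.1 i
    have h3 := hd.le_three h i
    have hd' : d i = 1 ∨ d i = 2 ∨ d i = 3 := by omega
    rcases hd' with hd' | hd' | hd' <;> rw [hd'] <;> omega
  refine ⟨?_, ?_⟩
  · rw [hd.dualPart_eq, hd.dualPart_eq, Finset.mul_sum]
    exact Finset.sum_le_sum fun i _ => (hle i).1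
  · conv_rhs => rw [← hd.sum_triSize h]
    rw [hd.dualPart_eq, Finset.mul_sum]
    exact Finset.sum_le_sum fun i _ => (hle i).2

/-- With `E = dualPart μ 2` and `F = dualPart μ 1 - 2 * E`, the inequalities describing `C_μ` are
those of the two comparison results for classes. -/
theorem classesAreUpperSet {n : ℕ} {μ : n.Partition} (hμ : DualIsSumOfTriangular μ)
    (h : dualPart μ 3 = 0) : ClassesAreUpperSet μ := by
  rintro B ⟨m, d, hd, rfl⟩
  obtain ⟨h2, h1⟩ := two_mul_dualPart_le hμ h
  have hB := hd.cycleType_sigma h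
  ext O
  rw [Set.mem_ofPred_eq]
  have main : ∀ y : Perm (Fin n), fClass (y * w₀ n) ∈ classSet μ ↔ IsCuspidal (fClass (y * w₀ n)) ∧
      ClassLE (fClass (sigma n (barParts d) * w₀ n)) (fClass (y * w₀ n)) := by
    intro y
    rw [mem_classSet_iff hμ h, isCuspidal_iff]
    constructor
    · rintro ⟨e, f, hy, he, hf⟩
      refine ⟨fun r hr => ?_, classLE_of_fiveThree hy hB he (by omega) (by omega)⟩
      rw [hy] at hr
      rcases mem_fiveThree hr with rfl | rfl <;> decide
    · rintro ⟨hodd, hle⟩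
      obtain ⟨e, f, hy, he, hf⟩ := fiveThree_of_classLE hodd hB hle
      exact ⟨e, f, hy, he, by omega⟩
  constructor
  · intro hO
    have hO' := hO
    obtain ⟨m', d', hd', hn', w, hw, rfl⟩ := hO
    exact ⟨⟨_, rfl⟩, (main _).1 hO'⟩
  · rintro ⟨⟨w, rfl⟩, hO⟩
    obtain ⟨y, hy⟩ := exists_eq_fClass w
    rw [hy] at hO ⊢
    exact (main y).2 hO

/-! ### Partitions with parts at most `3` -/

/-- The multipartition with `e`, `f` and `t` members of sizes `6`, `3` and `1`. -/
def encoding (e f t : ℕ) : Fin (e + f + t) → ℕ :=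
  Fin.append (Fin.append (fun _ : Fin e => 3) (fun _ : Fin f => 2)) (fun _ : Fin t => 1)

theorem sum_encoding (e f t : ℕ) (g : ℕ → ℕ) :
    ∑ i, g (encoding e f t i) = e * g 3 + f * g 2 + t * g 1 := by
  rw [Fin.sum_univ_add, Fin.sum_univ_add]
  simp [encoding]

theorem encoding_pos (e f t : ℕ) (i : Fin (e + f + t)) : 0 < encoding e f t i := by
  refine Fin.addCases (fun i => ?_) (fun i => ?_) i
  · refine Fin.addCases (fun i => ?_) (fun i => ?_) i <;> simp [encoding]
  · simp [encoding]

theorem dualPart_of_parts {n a b c : ℕ} {μ : n.Partition} (hμ : μ.parts =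
    Multiset.replicate a 3 + Multiset.replicate b 2 + Multiset.replicate c 1) (k : ℕ) :
    dualPart μ k = (if k < 3 then a else 0) + (if k < 2 then b else 0) + if k < 1 then c else 0 := by
  have hr : ∀ m x, ((Multiset.replicate m x).filter (k < ·)).card = if k < x then m else 0 := by
    intro m x
    split_ifs with h
    · rw [Multiset.filter_eq_self.2, Multiset.card_replicate]
      intro y hy
      rwa [Multiset.eq_of_mem_replicate hy]
    · rw [Multiset.filter_eq_nil.2, Multiset.card_zero]
      intro y hy
      rwa [Multiset.eq_of_mem_replicate hy]
  rw [dualPart, hμ, Multiset.filter_add, Multiset.filter_add, Multiset.card_add, Multiset.card_add,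
    hr, hr, hr]

theorem isTriangularMultipartition_encoding {n e f t : ℕ} {μ : n.Partition} (hμ : μ.parts =
    Multiset.replicate e 3 + Multiset.replicate (e + f) 2 + Multiset.replicate (e + f + t) 1) :
    IsTriangularMultipartition (encoding e f t) μ := by
  refine ⟨encoding_pos e f t, fun k => ?_⟩
  simp only [part_triangular]
  rw [sum_encoding e f t (fun a => a - k), dualPart_of_parts hμ]
  rcases Nat.lt_or_ge k 3 with hk | hk
  · interval_cases k <;> simp <;> ring
  · rw [if_neg (by omega), if_neg (by omega), if_neg (by omega), show 3 - k = 0 by omega,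
      show 2 - k = 0 by omega, show 1 - k = 0 by omega]
    simp

theorem classesFromBelow {n : ℕ} {μ : n.Partition} (hμ : DualIsSumOfTriangular μ)
    (h : dualPart μ 3 = 0) : ClassesFromBelow μ := by
  intro O hO
  have hO' := hO
  obtain ⟨m, d, hd, hn, w, hw, rfl⟩ := hO
  rw [mem_classSet_iff hμ h] at hO'
  obtain ⟨e, f, hy, he, hf⟩ := hO'
  obtain ⟨h2, h1⟩ := two_mul_dualPart_le hμ h
  have hsum := sum_dualPart h
  -- The type `5^e 3^f` is that of the bar class for `e` members of size `6`, `f` of size `3`, and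
  -- one of size `1` for each of the `t` remaining letters.
  obtain ⟨t, ht⟩ := Nat.exists_eq_add_of_le (show 6 * e + 3 * f ≤ n by omega)
  let ν : n.Partition :=
    { parts := Multiset.replicate e 3 + Multiset.replicate (e + f) 2 +
        Multiset.replicate (e + f + t) 1
      parts_pos := by
        intro i hi
        rw [Multiset.mem_add, Multiset.mem_add] at hi
        rcases hi with (hi | hi) | hi <;> rw [Multiset.eq_of_mem_replicate hi] <;> decide
      parts_sum := by
        simp only [Multiset.sum_add, Multiset.sum_replicate, smul_eq_mul]
        omega }
  have hν : IsTriangularMultipartition (encoding e f t) ν := isTriangularMultipartition_encoding rfl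
  have hq := dualPart_of_parts (μ := ν) rfl
  have hν3 : dualPart ν 3 = 0 := hq 3
  have hq0 : dualPart ν 0 = e + (e + f) + (e + f + t) := hq 0
  have hq1 : dualPart ν 1 = e + (e + f) := by rw [hq 1]; simp
  have hq2 : dualPart ν 2 = e := by rw [hq 2]; simp
  refine ⟨ν, ?_, ⟨_, _, hν⟩, _, _, hν, ?_⟩
  -- Both diagrams have `n` cells in three columns, and the second and third columns of `ν` are no
  -- longer than those of `μ`.
  · intro r
    rw [sum_part_eq h, sum_part_eq hν3]
    omega
  · apply fClass_eq_of_isConj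
    rw [Perm.isConj_iff_cycleType_eq, hν.cycleType_sigma hν3, hy, hq1, hq2]
    congr 1
    omega

theorem satisfiesAssumptions {n : ℕ} {μ : n.Partition} (hμ : DualIsSumOfTriangular μ)
    (h : dualPart μ 3 = 0) : SatisfiesAssumptions μ := by
  refine ⟨hμ, classesFromBelow hμ h, fun ν hν hν' => ?_⟩
  -- The largest part does not grow in the dominance order.
  have h3 : dualPart ν 3 = 0 := by
    have h1 := hν 1
    rw [Finset.sum_range_one, Finset.sum_range_one] at h1
    have a1 := lt_part_iff μ 3 0
    have a2 := lt_part_iff ν 3 0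
    omega
  exact ⟨classesFromBelow hν' h3, classesAreUpperSet hν' h3⟩

theorem satisfiesAssumptions_of_parts {n e f t : ℕ} {μ : n.Partition} (hμ : μ.parts =
    Multiset.replicate e 3 + Multiset.replicate (e + f) 2 + Multiset.replicate (e + f + t) 1) :
    SatisfiesAssumptions μ :=
  satisfiesAssumptions ⟨_, _, isTriangularMultipartition_encoding hμ⟩ (dualPart_of_parts hμ 3)

end UnitaryClasses

/-! ### The three families -/

theorem mainTheorem12 :
    (∀ (n b : ℕ) (μ : n.Partition), 3 * b ≤ n →
      μ.parts = Multiset.replicate b 2 + Multiset.replicate (n - 2 * b) 1 →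
        UnitaryClasses.SatisfiesAssumptions μ) ∧
    (∀ (i j n : ℕ) (μ : n.Partition),
      (1 ≤ i ∧ i ≤ 3 ∧ i ≤ j ∧ j ≤ 10) ∨ (i = 4 ∧ 4 ≤ j ∧ j ≤ 7) →
      μ.parts = {3} + Multiset.replicate i 2 + Multiset.replicate j 1 →
        UnitaryClasses.SatisfiesAssumptions μ) ∧
    (∀ (k n : ℕ) (μ : n.Partition), 2 ≤ k → k ≤ 8 →
      μ.parts = Multiset.replicate 2 3 + Multiset.replicate 2 2 + Multiset.replicate k 1 →
        UnitaryClasses.SatisfiesAssumptions μ) := by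
  -- In each case the numbers of members `(3,2,1)`, `(2,1)`, `(1)` are the successive differences of
  -- the multiplicities of the parts `3`, `2`, `1`.
  refine ⟨fun n b μ hb hμ => ?_, fun i j n μ hij hμ => ?_, fun k n μ hk _ hμ => ?_⟩
  · apply UnitaryClasses.satisfiesAssumptions_of_parts (e := 0) (f := b) (t := n - 3 * b)
    rw [hμ, Multiset.replicate_zero, zero_add, zero_add, show b + (n - 3 * b) = n - 2 * b by omega]
  · apply UnitaryClasses.satisfiesAssumptions_of_parts (e := 1) (f := i - 1) (t := j - i)
    rw [hμ, Multiset.replicate_one, show 1 + (i - 1) = i by omega, show i + (j - i) = j by omega]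
  · apply UnitaryClasses.satisfiesAssumptions_of_parts (e := 2) (f := 0) (t := k - 2)
    rw [hμ, show 2 + 0 + (k - 2) = k by omega]
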